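/- **Corollary 1.** Let $R>0$ and $mR>3/2$, put $\mu=\sqrt{(mR)^2-9/4}$, $\omega(k)=\sqrt{1+|k|^2}$, and let $\tilde f(k)=(2\pi)^{-3/2}\int e^{-ik\cdot x}f(x)\,dx$ denote the Fourier transform on $\mathbb R^3$, extended to tempered distributions. For $s\in\mathbb R$ let $H^{s}=H^s(\mathbb R^3)$ be the real Hilbert space of real tempered distributions $f$ on $\mathbb R^3$ whose Fourier transform is a function with $\omega^{s}\tilde f\in L^2$. Let $$v(t,k)=t^{3/2}e^{-\mu\pi/2}H^{(1)}_{i\mu}(kt),\qquad t,k>0,$$ with $H^{(1)}_\nu$ the Hankel function, $v'=\partial_t v$, and $W=v\bar v'-\bar v v'$. For $t\ge 1$ define the real-linear map $K_t:H^{1/2}\times H^{-1/2}\to L^2(\mathbb R^3;\mathbb C)$ by $$[K_t(f,h)](k)=\frac{1}{tW(t,|k|)}\Big(\tilde f(k)\,t\,\bar v'(t,|k|)-R\,\tilde h(k)\,\bar v(t,|k|)\Big),$$ put $K=K_1$, and $\hat U_0(t,s)=K\,K_t^{-1}K_s\,K^{-1}$. Fix $T\ge1$ and let $V(t,x)$,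 $1\le t\le T$, be a real potential such that each $V(t,\cdot)$ has an integrable Fourier transform $\tilde V(t,\cdot)$, with $\tilde V$ jointly measurable and $\|\tilde V(t,\cdot)\|_{L^1}\le C$ for all $1\le t\le T$. Write $V(t)(f,h)=(0,V(t,\cdot)f)$, $\hat V(t)=KV(t)K^{-1}$, and $$\hat U_V(t,1)=\hat U_0(t,1)+\sum_{n\ge1}(-1)^n\int_1^t\!\cdots\!\int_1^{s_{n-1}}\hat U_0(t,s_1)\hat V(s_1)\cdots\hat V(s_n)\hat U_0(s_n,1)\,ds_n\cdots ds_1,$$ $$U_V(t,1)=K^{-1}\hat U_V(t,1)K,\qquad H_0(t)=\begin{pmatrix}0&-\frac Rt\\-\frac tR\Delta+\frac Rt m^2&-\frac3t\end{pmatrix}.$$ Then each $K_t$, $t\ge 1$, is a bounded bijection with bounded inverse, $V(t)$ maps $H^{1/2}\times H^{-1/2}$ into itself, and the integrals and the series, applied to any $\psi\in L^2$, converge in $L^2$ for $1\le t\le T$. For every $t\in[1,T]$, $U_V(t,1)$ is a bounded operator on $H^{1/2}\times H^{-1/2}$, and $U_V$ solves $$\frac{dU_V}{dt}(t,1)=-[H_0(t)+V(t)]\,U_V(t,1),\qquad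 U_V(1,1)=I,$$ in the following (strong) sense. For every $F\in H^{1/2}\times H^{-1/2}$ the curve $t\mapsto U_V(t,1)F$ is continuous from $[1,T]$ to $H^{1/2}\times H^{-1/2}$ and Lipschitz from $[1,T]$ to $H^{-1/2}\times H^{-3/2}$, and $U_V(1,1)F=F$. For almost every $t\in[1,T]$, and for every $t\in[1,T]$ at which $s\mapsto\tilde V(s,\cdot)$ is continuous on $[1,T]$ as a map into $L^1(\mathbb R^3)$ (hence for every $t\in[1,T]$ if it is continuous throughout), the equation, applied to any $F\in H^{1/2}\times H^{-1/2}$, holds with the derivative (relative to $[1,T]$) taken in the norm of $H^{-1/2}\times H^{-3/2}$. -/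

import Mathlib

open MeasureTheory Set Filter Topology
open scoped FourierTransform SchwartzMap Laplacian ENNReal ComplexConjugate

namespace DeSitter

/-- Euclidean space `ℝ³`. -/
abbrev E3 : Type := EuclideanSpace ℝ (Fin 3)

/-- The complex Hilbert space `L²(ℝ³)`, in which the coefficients `ψ` live. -/
abbrev L2 : Type := Lp ℂ 2 (volume : Measure E3)

/-! ### Real Sobolev spaces -/

/-- A tempered distribution is real if it takes real values on real test functions. -/
def IsReal (u : 𝓢'(E3, ℂ)) : Prop :=
  ∀ φ : 𝓢(E3, ℂ), (∀ x, (φ x).im = 0) → (u φ).im = 0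

/-- The real tempered distributions in the Bessel potential space `H^s(ℝ³)`. -/
noncomputable def sobolevSubmodule (s : ℝ) : Submodule ℝ 𝓢'(E3, ℂ) where
  carrier := {u | IsReal u ∧ TemperedDistribution.MemSobolev s 2 u}
  add_mem' := by
    rintro u v ⟨hu, hu2⟩ ⟨hv, hv2⟩
    refine ⟨fun φ hφ => ?_, hu2.add hv2⟩
    have h1 := hu φ hφ
    have h2 := hv φ hφ
    simp [h1, h2]
  zero_mem' := ⟨fun φ _ => by simp, TemperedDistribution.memSobolev_fun_zero E3 ℂ s 2⟩
  smul_mem' := by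
    rintro c u ⟨hu, hu2⟩
    refine ⟨fun φ hφ => ?_, ?_⟩
    · have h1 := hu φ hφ
      simp [h1]
    · exact hu2.smul (c : ℂ)

/-- The real Sobolev space `H^s(ℝ³)`, for any real order `s`. -/
def Sob (s : ℝ) : Type := sobolevSubmodule s

noncomputable instance (s : ℝ) : AddCommGroup (Sob s) :=
  inferInstanceAs (AddCommGroup (sobolevSubmodule s))

noncomputable instance (s : ℝ) : Module ℝ (Sob s) :=
  inferInstanceAs (Module ℝ (sobolevSubmodule s))

/-- The tempered distribution underlying an element of `H^s(ℝ³)`. -/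
noncomputable def Sob.dist {s : ℝ} : Sob s →ₗ[ℝ] 𝓢'(E3, ℂ) := (sobolevSubmodule s).subtype

theorem Sob.dist_injective {s : ℝ} : Function.Injective (Sob.dist (s := s)) :=
  Subtype.val_injective

theorem toDist_injective :
    Function.Injective (Lp.toTemperedDistributionCLM ℂ (volume : Measure E3) 2) :=
  LinearMap.ker_eq_bot.mp Lp.ker_toTemperedDistributionCLM_eq_bot

theorem Sob.exists_bessel {s : ℝ} (u : Sob s) : ∃ g : L2,
    TemperedDistribution.besselPotential E3 ℂ s u.dist =
      Lp.toTemperedDistributionCLM ℂ (volume : Measure E3) 2 g := u.2.2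

/-- The Bessel potential `𝓕⁻¹ (1 + |ξ|²)^(s/2) 𝓕 u` of `u ∈ H^s`, as an element of `L²`. -/
noncomputable def Sob.bessel {s : ℝ} : Sob s →ₗ[ℝ] L2 where
  toFun u := u.exists_bessel.choose
  map_add' u v := by
    apply toDist_injective
    rw [← (u + v).exists_bessel.choose_spec, map_add, map_add, map_add,
      ← u.exists_bessel.choose_spec, ← v.exists_bessel.choose_spec]
  map_smul' c u := by
    apply toDist_injective
    rw [← (c • u).exists_bessel.choose_spec, RingHom.id_apply, map_smul,
      ContinuousLinearMap.map_smul_of_tower, ContinuousLinearMap.map_smul_of_tower,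
      ← u.exists_bessel.choose_spec]

theorem Sob.bessel_spec {s : ℝ} (u : Sob s) :
    TemperedDistribution.besselPotential E3 ℂ s u.dist =
      Lp.toTemperedDistributionCLM ℂ (volume : Measure E3) 2 u.bessel :=
  u.exists_bessel.choose_spec

theorem Sob.bessel_injective {s : ℝ} : Function.Injective (Sob.bessel (s := s)) := by
  intro u v h
  apply Sob.dist_injective
  have h1 := u.bessel_spec
  rw [h, ← v.bessel_spec] at h1
  have h2 := (TemperedDistribution.besselPotential_neg_apply_eq_iff s
    (TemperedDistribution.besselPotential E3 ℂ s v.dist) u.dist).mpr h1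
  rw [← h2]
  exact (TemperedDistribution.besselPotential_neg_apply_eq_iff s _ _).mpr rfl

/-- The norm of `H^s(ℝ³)` is the `L²` norm of the Bessel potential of order `s`. -/
noncomputable instance (s : ℝ) : NormedAddCommGroup (Sob s) :=
  NormedAddCommGroup.induced (Sob s) L2 Sob.bessel Sob.bessel_injective

noncomputable instance (s : ℝ) : NormedSpace ℝ (Sob s) :=
  NormedSpace.induced ℝ (Sob s) L2 Sob.bessel

/-- The Fourier transform `ũ(k) = (2π)^(-3/2) ∫ exp(-i k·x) u(x) dx` of `u ∈ H^s`, as a function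
of the wave vector `k`. With Mathlib's normalisation of `𝓕` it is `(2π)^(-3/2) (𝓕 u)(k / 2π)`,
and `𝓕 u` is `(1 + |ξ|²)^(-s/2)` times the transform of the Bessel potential of `u`. -/
noncomputable def Sob.fourier {s : ℝ} (u : Sob s) (k : E3) : ℂ :=
  (((2 * Real.pi) ^ (-(3 / 2) : ℝ) * (1 + ‖(2 * Real.pi)⁻¹ • k‖ ^ 2) ^ (-(s / 2)) : ℝ) : ℂ) *
    (𝓕 u.bessel : L2) ((2 * Real.pi)⁻¹ • k)

/-- The inclusion `H^s ⊆ H^r` for `r ≤ s`. -/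
noncomputable def Sob.incl {s r : ℝ} (h : r ≤ s) (u : Sob s) : Sob r :=
  ⟨u.dist, u.2.1, u.2.2.mono h⟩

theorem im_laplacian_eq_zero (φ : 𝓢(E3, ℂ)) (hφ : ∀ x, (φ x).im = 0) (x : E3) :
    ((Δ φ) x).im = 0 := by
  have h1 : (Δ φ) x = (Δ (φ : E3 → ℂ)) x := by
    exact SchwartzMap.laplacian_apply φ x
  have h2 : (Δ (Complex.imCLM ∘ (φ : E3 → ℂ))) x = Complex.imCLM ((Δ (φ : E3 → ℂ)) x) :=
    (φ.contDiffAt 2).laplacian_CLM_comp_left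
  have h3 : (Complex.imCLM ∘ (φ : E3 → ℂ)) = fun _ => (0 : ℝ) := by
    funext y
    exact hφ y
  rw [h1]
  rw [h3] at h2
  have h4 : (Δ (fun _ : E3 => (0 : ℝ))) x = 0 := by
    simp [InnerProductSpace.laplacian_const]
  rw [h4] at h2
  exact h2.symm

/-- The distributional Laplacian, as a map from `H^s` to `H^r` for `r ≤ s - 2`. -/
noncomputable def Sob.lap {s r : ℝ} (h : r ≤ s - 2) (u : Sob s) : Sob r :=
  ⟨Δ u.dist, fun φ hφ => by
    rw [TemperedDistribution.laplacian_apply_apply]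
    exact u.2.1 _ (im_laplacian_eq_zero φ hφ), u.2.2.laplacian.mono h⟩

/-- The space of real Cauchy data `H^{1/2}(ℝ³) × H^{-1/2}(ℝ³)`. -/
abbrev Data : Type := Sob (1 / 2) × Sob (-1 / 2)

/-- The space `H^{-1/2}(ℝ³) × H^{-3/2}(ℝ³)`, to which the generator maps the Cauchy data. -/
abbrev Data1 : Type := Sob (-1 / 2) × Sob (-3 / 2)

/-- The inclusion of `H^{1/2} × H^{-1/2}` in `H^{-1/2} × H^{-3/2}`. -/
noncomputable def embed (F : Data) : Data1 :=
  (Sob.incl (by norm_num) F.1, Sob.incl (by norm_num) F.2)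

/-! ### Mode functions -/

/-- The Bessel function `J_ν(x)`, for `x > 0`. -/
noncomputable def besselJ (ν : ℂ) (x : ℝ) : ℂ :=
  ∑' n : ℕ, (-1) ^ n / ((n.factorial : ℂ) * Complex.Gamma (n + ν + 1)) *
    ((x / 2 : ℝ) : ℂ) ^ (ν + 2 * n)

/-- The Hankel function `H_ν^{(1)}(x)`, for `x > 0` and `ν` not an integer. -/
noncomputable def hankel1 (ν : ℂ) (x : ℝ) : ℂ :=
  (besselJ (-ν) x - Complex.exp (-(Complex.I * Real.pi * ν)) * besselJ ν x) /
    (Complex.I * Complex.sin (ν * Real.pi))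

/-- `μ = √((mR)² - 9/4)`. -/
noncomputable def mu (R m : ℝ) : ℝ := Real.sqrt ((m * R) ^ 2 - 9 / 4)

/-- The mode function `v(t,k) = t^{3/2} e^{-μπ/2} H_{iμ}^{(1)}(kt)`. -/
noncomputable def mode (R m t k : ℝ) : ℂ :=
  ((t ^ (3 / 2 : ℝ) * Real.exp (-(mu R m * Real.pi / 2)) : ℝ) : ℂ) *
    hankel1 (Complex.I * mu R m) (k * t)

/-- The time derivative `v'(t,k)`. -/
noncomputable def modeDeriv (R m t k : ℝ) : ℂ := deriv (fun τ : ℝ => mode R m τ k) t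

/-- The Wronskian `W(t,k)` of `v` and its complex conjugate. -/
noncomputable def wronskian (R m t k : ℝ) : ℂ :=
  Matrix.det !![mode R m t k, conj (mode R m t k);
    modeDeriv R m t k, conj (modeDeriv R m t k)]

/-! ### The map from Cauchy data to coefficients, and the unperturbed evolution -/

/-- The coefficient function `k ↦ ψ(k)` of Cauchy data `(f,h)` at time `t`. -/
noncomputable def coeff (R m t : ℝ) (F : Data) (k : E3) : ℂ :=
  1 / ((t : ℂ) * wronskian R m t ‖k‖) *
    Matrix.det !![F.1.fourier k, conj (mode R m t ‖k‖);
      (R : ℂ) * F.2.fourier k, (t : ℂ) * conj (modeDeriv R m t ‖k‖)]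

open Classical in
/-- The map `K_t` from Cauchy data at time `t` to coefficients in `L²`
(with the value `0` where the coefficient function is not square integrable). -/
noncomputable def K (R m t : ℝ) (F : Data) : L2 :=
  if h : MemLp (coeff R m t F) 2 (volume : Measure E3) then h.toLp (coeff R m t F) else 0

/-- The inverse `K_t⁻¹`. -/
noncomputable def Kinv (R m t : ℝ) : L2 → Data := Function.invFun (K R m t)

/-- The free evolution `U_0(t,s) = K_t⁻¹ K_s` of Cauchy data from time `s` to time `t`. -/
noncomputable def U0 (R m t s : ℝ) (F : Data) : Data := Kinv R m t (K R m s F)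

/-- `Û_0(t,s) = K U_0(t,s) K⁻¹`, with `K = K_1`. -/
noncomputable def U0hat (R m t s : ℝ) (ψ : L2) : L2 := K R m 1 (U0 R m t s (Kinv R m 1 ψ))

/-! ### The potential -/

/-- `Vt` is integrable and is the Fourier transform
`Ṽ(k) = (2π)^(-3/2) ∫ exp(-i k·x) V(x) dx`, in the sense of tempered distributions, of `V`;
this says that `V` is almost everywhere the inverse Fourier integral of `Vt`. -/
def HasIntegrableFourier (V : E3 → ℝ) (Vt : E3 → ℂ) : Prop :=
  Integrable Vt ∧ ∀ᵐ x : E3, (V x : ℂ) =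
    (((2 * Real.pi) ^ (-(3 / 2) : ℝ) : ℝ) : ℂ) *
      ∫ k : E3, Complex.exp (Complex.I * (inner ℝ k x : ℝ)) * Vt k

/-- `g` is the product `V f`: the distribution `f` is an `L²` function, and `g` is the
distribution given by its pointwise product with `V`. -/
def IsProduct (V : E3 → ℝ) (f : Sob (1 / 2)) (g : Sob (-1 / 2)) : Prop :=
  ∃ f₀ : L2, f.dist = Lp.toTemperedDistribution f₀ ∧
    ∀ φ : 𝓢(E3, ℂ), Integrable (fun x => φ x * ((V x : ℂ) * f₀ x)) ∧
      g.dist φ = ∫ x, φ x * ((V x : ℂ) * f₀ x)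

open Classical in
/-- Multiplication by `V`, from `H^{1/2}` to `H^{-1/2}`
(with the value `0` where the product is not in `H^{-1/2}`). -/
noncomputable def potMul (V : E3 → ℝ) (f : Sob (1 / 2)) : Sob (-1 / 2) :=
  if h : ∃ g, IsProduct V f g then h.choose else 0

/-- The perturbation `(f, h) ↦ (0, V f)`. -/
noncomputable def pot (V : E3 → ℝ) (F : Data) : Data := (0, potMul V F.1)

/-- `V̂ = K V K⁻¹`, with `K = K_1`. -/
noncomputable def potHat (R m : ℝ) (V : E3 → ℝ) (ψ : L2) : L2 :=
  K R m 1 (pot V (Kinv R m 1 ψ))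

/-! ### The generator and the perturbed evolution -/

/-- The free Hamiltonian
`H_0(t)(f, h) = (-(R/t) h, -(t/R) Δ f + (R/t) m² f - (3/t) h)`. -/
noncomputable def H0 (R m t : ℝ) (F : Data) : Data1 :=
  (-((R / t) • F.2),
    -((t / R) • Sob.lap (by norm_num) F.1) + (R / t * m ^ 2) • Sob.incl (by norm_num) F.1
      - (3 / t) • Sob.incl (by norm_num) F.2)

/-- The `n`-th term of the Dyson series of `Û_V(t,1)`, applied to `ψ`:
`(-1)^n ∫_1^t ⋯ ∫_1^{s_{n-1}} Û_0(t,s_1) V̂(s_1) ⋯ V̂(s_n) Û_0(s_n,1) ψ ds_n ⋯ ds_1`. -/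
noncomputable def dyson (R m : ℝ) (V : ℝ → E3 → ℝ) : ℕ → ℝ → L2 → L2
  | 0, t, ψ => U0hat R m t 1 ψ
  | n + 1, t, ψ => -∫ s in (1 : ℝ)..t, U0hat R m t s (potHat R m (V s) (dyson R m V n s ψ))

/-- `Û_V(t,1)`, the sum of the Dyson series. -/
noncomputable def UVhat (R m : ℝ) (V : ℝ → E3 → ℝ) (t : ℝ) (ψ : L2) : L2 :=
  ∑' n : ℕ, dyson R m V n t ψ

/-- The perturbed evolution `U_V(t,1) = K⁻¹ Û_V(t,1) K`, with `K = K_1`. -/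
noncomputable def UV (R m : ℝ) (V : ℝ → E3 → ℝ) (t : ℝ) (F : Data) : Data :=
  Kinv R m 1 (UVhat R m V t (K R m 1 F))

/-- At time `t`, the curves `τ ↦ U_V(τ,1) F` satisfy `dU_V/dt F = -(H_0(t) + V(t)) U_V F`, for
every `F` in `H^{1/2} × H^{-1/2}`; the derivative is relative to `[1, T]`, in the norm of
`H^{-1/2} × H^{-3/2}`. -/
def SolvesAt (R m : ℝ) (V : ℝ → E3 → ℝ) (T t : ℝ) : Prop :=
  ∀ F : Data, HasDerivWithinAt (fun τ => embed (UV R m V τ F))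
    (-(H0 R m t (UV R m V t F) + embed (pot (V t) (UV R m V t F)))) (Icc 1 T) t

end DeSitter

open DeSitter

/-! The proof is an interaction-picture argument on the Fourier side. Real data correspond to
weighted Fourier transforms fixed by `C = conjRefl`, `g(k) ↦ conj (g (-k))`. The components of
`K_t⁻¹ ψ` are `a ψ + conj a · C ψ` and `b ψ + conj b · C ψ`, where `a = symA` and `b = symB` are `v`
and `(t/R) v'` with the weights of the orders `1/2` and `-1/2`.

Two facts about the modes govern `K_t`. The Wronskian is a nonzero constant times `t²`
(`wronskian_eq`, `wronskianConst_ne_zero`), so Cramer's rule inverts `K_t` (`symbol_identities`).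
Moreover `|v| ≤ C (1+k)^(-1/2)` and `|v'| ≤ C (1+k)^(1/2)`, uniformly for `t ∈ [1,T]`
(`exists_mode_bound`), so the symbols are bounded and `K_t`, `K_t⁻¹` are uniformly bounded and
strongly continuous. These bounds need no asymptotics of Hankel functions: they follow from two
energies of Bessel's equation, one increasing and one decreasing (`IsBesselPair.exists_bound`).

Multiplication by `V(s)` is bounded on `L²` by the `L¹` norm of its Fourier transform, so `B(s) =
K_s V(s) K_s⁻¹` (`interaction`) is a bounded family. The conjugations by `K` telescope: `U_V(t,1) =
K_t⁻¹ D(t) K_1` (`UV_eq`), where `D` is the Dyson series of `-B` and satisfies `D(t) = 1 - ∫ B D`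
(`IsBoundedFamily.dysonSum_eq`).

In the weaker norm `K_t⁻¹ ψ` has the derivative `-H_0(t) K_t⁻¹ ψ`
(`hasDerivWithinAt_embed_KinvCLM`): this is the mode equation, and the loss of one order keeps the
differentiated symbols bounded. `D` is differentiated at the Lebesgue points of the `L¹`-valued
curve given by the Fourier transform of `V(s)`. These are almost all times, include every continuity
point, and do not depend on `F`. There `D' = -B D`, and the product rule together with `K_t⁻¹ B(t) =
V(t) K_t⁻¹` gives the equation (`solvesAt_of_isLittleO`). -/

namespace DeSitter

/-! ### Bessel functions of complex order -/

/-- The coefficients of the entire function `y ↦ (√y)^(-ν) J_ν(2√y)`. -/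
noncomputable def besselCoeff (ν : ℂ) (n : ℕ) : ℂ :=
  (-1) ^ n / ((n.factorial : ℂ) * Complex.Gamma (n + ν + 1))

/-- The entire function `y ↦ (√y)^(-ν) J_ν(2√y)`. -/
noncomputable def besselSeries (ν y : ℂ) : ℂ := ∑' n : ℕ, besselCoeff ν n * y ^ n

theorem natCast_add_add_one_ne_zero {ν : ℂ} (hν : 0 ≤ ν.re) (n : ℕ) : (n : ℂ) + ν + 1 ≠ 0 := by
  intro h
  have h1 := congrArg Complex.re h
  simp at h1
  have : (0 : ℝ) ≤ n := n.cast_nonneg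
  linarith

theorem besselCoeff_succ {ν : ℂ} (hν : 0 ≤ ν.re) (n : ℕ) :
    besselCoeff ν (n + 1) = -besselCoeff ν n / ((n + 1) * (n + ν + 1)) := by
  have h0 := natCast_add_add_one_ne_zero hν n
  have h1 : Complex.Gamma ((n + 1 : ℕ) + ν + 1) =
      (n + ν + 1) * Complex.Gamma (n + ν + 1) := by
    rw [← Complex.Gamma_add_one _ h0]
    congr 1
    push_cast
    ring
  have h2 : (n : ℂ) + 1 ≠ 0 := by exact_mod_cast n.succ_ne_zero
  rw [besselCoeff, besselCoeff, h1, Nat.factorial_succ, pow_succ]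
  push_cast
  simp only [div_eq_mul_inv, mul_inv]
  ring

theorem besselCoeff_order_succ {ν : ℂ} (hν : 0 ≤ ν.re) (n : ℕ) :
    besselCoeff ν n = (n + ν + 1) * besselCoeff (ν + 1) n := by
  have h0 := natCast_add_add_one_ne_zero hν n
  have h1 : Complex.Gamma (n + (ν + 1) + 1) = (n + ν + 1) * Complex.Gamma (n + ν + 1) := by
    rw [← Complex.Gamma_add_one _ h0]
    congr 1
    ring
  rw [besselCoeff, besselCoeff, h1]
  field_simp

theorem besselCoeff_succ_mul {ν : ℂ} (hν : 0 ≤ ν.re) (n : ℕ) :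
    besselCoeff ν (n + 1) * (n + 1) = -besselCoeff (ν + 1) n := by
  have h0 := natCast_add_add_one_ne_zero hν n
  have h2 : (n : ℂ) + 1 ≠ 0 := by exact_mod_cast n.succ_ne_zero
  rw [besselCoeff_succ hν, besselCoeff_order_succ hν]
  field_simp

/-- Since `|n + ν + 1| ≥ 1` for `Re ν ≥ 0`, each step of the recursion gains at least a factor `n +
1`. One factorial is cruder than the truth but suffices for termwise differentiation on every disc.
-/
theorem norm_besselCoeff_le {ν : ℂ} (hν : 0 ≤ ν.re) (n : ℕ) :
    ‖besselCoeff ν n‖ ≤ ‖besselCoeff ν 0‖ / n.factorial := by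
  induction n with
  | zero => simp
  | succ n ih =>
    rw [besselCoeff_succ hν, norm_div, norm_neg, norm_mul, Nat.factorial_succ]
    have h1 : (1 : ℝ) ≤ ‖(n : ℂ) + ν + 1‖ := by
      refine le_trans ?_ (Complex.re_le_norm _)
      simp
      positivity
    have h2 : ‖(n : ℂ) + 1‖ = n + 1 := by
      have : (n : ℂ) + 1 = ((n + 1 : ℕ) : ℂ) := by push_cast; ring
      rw [this, Complex.norm_natCast]
      push_cast
      ring
    rw [h2]
    push_cast
    have h3 : (0 : ℝ) < (n : ℝ) + 1 := by positivity
    calc ‖besselCoeff ν n‖ / ((n + 1) * ‖(n : ℂ) + ν + 1‖)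
        ≤ ‖besselCoeff ν n‖ / ((n + 1) * 1) := by gcongr
      _ ≤ (‖besselCoeff ν 0‖ / n.factorial) / ((n + 1) * 1) := by gcongr
      _ = _ := by field_simp

theorem summable_besselCoeff {ν : ℂ} (hν : 0 ≤ ν.re) (y : ℂ) :
    Summable (fun n => besselCoeff ν n * y ^ n) := by
  refine Summable.of_norm_bounded
    (g := fun n => ‖besselCoeff ν 0‖ * (‖y‖ ^ n / n.factorial)) ?_ ?_
  · exact (Real.summable_pow_div_factorial _).mul_left _
  · intro n
    rw [norm_mul, norm_pow]
    calc _ ≤ (‖besselCoeff ν 0‖ / n.factorial) * ‖y‖ ^ n := by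
          gcongr
          exact norm_besselCoeff_le hν n
      _ = _ := by ring

theorem hasSum_besselCoeff_deriv {ν : ℂ} (hν : 0 ≤ ν.re) (y : ℂ) :
    HasSum (fun n : ℕ => besselCoeff ν n * (n * y ^ (n - 1))) (-besselSeries (ν + 1) y) := by
  rw [← hasSum_nat_add_iff' 1]
  have h : 0 ≤ (ν + 1).re := by simp; linarith
  have h1 := (summable_besselCoeff h y).hasSum.neg
  simp only [Finset.range_one, Finset.sum_singleton, Nat.cast_zero, zero_mul, mul_zero, sub_zero]
  refine h1.congr_fun ?_ |> fun h => h
  intro n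
  have := besselCoeff_succ_mul hν n
  push_cast
  rw [← mul_assoc, this]
  simp

/-- Termwise differentiation on a disc around `0` containing `y`. The shift of index in
`besselCoeff_succ_mul` raises the order by one. -/
theorem hasDerivAt_besselSeries {ν : ℂ} (hν : 0 ≤ ν.re) (y : ℂ) :
    HasDerivAt (besselSeries ν) (-besselSeries (ν + 1) y) y := by
  rw [← (hasSum_besselCoeff_deriv hν y).tsum_eq]
  set r : ℝ := ‖y‖ + 1
  have hr : 0 < r := by positivity
  refine hasDerivAt_tsum_of_isPreconnected (t := Metric.ball (0 : ℂ) r) (y₀ := 0)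
    (u := fun n : ℕ => ‖besselCoeff ν 0‖ * (n * r ^ (n - 1) / n.factorial))
    (g := fun n (y : ℂ) => besselCoeff ν n * y ^ n)
    (g' := fun n (y : ℂ) => besselCoeff ν n * (n * y ^ (n - 1))) (Summable.mul_left _ ?_) Metric.isOpen_ball
    (convex_ball _ _).isPreconnected ?_ ?_ (Metric.mem_ball_self hr) (summable_besselCoeff hν 0) ?_
  · rw [← summable_nat_add_iff 1]
    refine (Real.summable_pow_div_factorial r).congr fun n => ?_
    rw [Nat.factorial_succ, Nat.add_sub_cancel]
    push_cast
    field_simp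
  · intro n z _
    exact (hasDerivAt_pow n z).const_mul _
  · intro n z hz
    have hz' : ‖z‖ ≤ r := by simpa using (Metric.mem_ball.mp hz).le
    rw [norm_mul, norm_mul, norm_pow, Complex.norm_natCast]
    calc _ ≤ (‖besselCoeff ν 0‖ / n.factorial) * (n * r ^ (n - 1)) := by
          gcongr
          exact norm_besselCoeff_le hν n
      _ = _ := by ring
  · simp [r]

/-- In `besselCoeff ν n = (n + ν + 1) * besselCoeff (ν + 1) n` the constant `ν + 1` gives the first
term, and the factor `n` acts as `y d/dy`, which gives the second. This is Bessel's equation with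
the power `(x/2)^ν` stripped off. -/
theorem besselSeries_recurrence {ν : ℂ} (hν : 0 ≤ ν.re) (y : ℂ) :
    besselSeries ν y = (ν + 1) * besselSeries (ν + 1) y - y * besselSeries (ν + 2) y := by
  have h : 0 ≤ (ν + 1).re := by simp; linarith
  have h1 := (summable_besselCoeff h y).hasSum.mul_left (ν + 1)
  have h2 := (hasSum_besselCoeff_deriv h y).mul_left y
  have h3 := h1.add h2
  have h4 : ν + 1 + 1 = ν + 2 := by ring
  rw [h4] at h3
  rw [besselSeries]
  have h5 : (fun n : ℕ => besselCoeff ν n * y ^ n) = fun n : ℕ =>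
      (ν + 1) * (besselCoeff (ν + 1) n * y ^ n) +
        y * (besselCoeff (ν + 1) n * (n * y ^ (n - 1))) := by
    funext n
    rw [besselCoeff_order_succ hν]
    rcases n with _ | n
    · simp
    · rw [Nat.add_sub_cancel, pow_succ]
      ring
  rw [h5, h3.tsum_eq, ← besselSeries]
  ring

theorem besselJ_eq (ν : ℂ) {x : ℝ} (hx : 0 < x) :
    besselJ ν x = ((x / 2 : ℝ) : ℂ) ^ ν * besselSeries ν (((x / 2 : ℝ) : ℂ) ^ 2) := by
  rw [besselJ, besselSeries, ← tsum_mul_left]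
  congr 1
  funext n
  have h0 : ((x / 2 : ℝ) : ℂ) ≠ 0 := by
    exact_mod_cast (by positivity : (x / 2 : ℝ) ≠ 0)
  rw [Complex.cpow_add _ _ h0, ← pow_mul, besselCoeff]
  have : ((x / 2 : ℝ) : ℂ) ^ (2 * (n : ℂ)) = ((x / 2 : ℝ) : ℂ) ^ (2 * n) := by
    rw [← Complex.cpow_natCast]
    congr 1
    push_cast
    ring
  rw [this]
  ring

/-- The function `x ↦ x J_ν'(x)`. -/
noncomputable def besselP (ν : ℂ) (x : ℝ) : ℂ :=
  ((x / 2 : ℝ) : ℂ) ^ ν * (ν * besselSeries ν (((x / 2 : ℝ) : ℂ) ^ 2) -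
    2 * ((x / 2 : ℝ) : ℂ) ^ 2 * besselSeries (ν + 1) (((x / 2 : ℝ) : ℂ) ^ 2))

theorem hasDerivAt_half_cpow (ν : ℂ) {x : ℝ} (hx : 0 < x) :
    HasDerivAt (fun x : ℝ => ((x / 2 : ℝ) : ℂ) ^ ν) (((x / 2 : ℝ) : ℂ) ^ ν * ν / x) x := by
  have h0 : ((x / 2 : ℝ) : ℂ) ∈ Complex.slitPlane := by
    rw [Complex.ofReal_mem_slitPlane]
    positivity
  have h1 : HasDerivAt (fun x : ℝ => ((x / 2 : ℝ) : ℂ)) ((1 / 2 : ℝ) : ℂ) x :=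
    ((hasDerivAt_id x).div_const 2).ofReal_comp
  have h2 := ((hasDerivAt_id _).cpow_const (c := ν) h0).comp x h1
  refine HasDerivAt.congr_deriv (f := fun x : ℝ => ((x / 2 : ℝ) : ℂ) ^ ν) h2 ?_
  have hx' : (x : ℂ) ≠ 0 := by exact_mod_cast hx.ne'
  change ν * ((x / 2 : ℝ) : ℂ) ^ (ν - 1) * 1 * _ = _
  rw [Complex.cpow_sub _ _ (Complex.slitPlane_ne_zero h0), Complex.cpow_one]
  push_cast
  field_simp

theorem hasDerivAt_besselSeries_half {ν : ℂ} (hν : 0 ≤ ν.re) {x : ℝ} (hx : 0 < x) :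
    HasDerivAt (fun x : ℝ => besselSeries ν (((x / 2 : ℝ) : ℂ) ^ 2))
      (-2 * ((x / 2 : ℝ) : ℂ) ^ 2 * besselSeries (ν + 1) (((x / 2 : ℝ) : ℂ) ^ 2) / x) x := by
  have h1 : HasDerivAt (fun x : ℝ => ((x / 2 : ℝ) : ℂ)) ((1 / 2 : ℝ) : ℂ) x :=
    ((hasDerivAt_id x).div_const 2).ofReal_comp
  have h2 := h1.pow 2
  have h3 := (hasDerivAt_besselSeries hν (((x / 2 : ℝ) : ℂ) ^ 2)).comp x h2
  refine h3.congr_deriv ?_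
  have hx' : (x : ℂ) ≠ 0 := by exact_mod_cast hx.ne'
  push_cast
  field_simp

theorem hasDerivAt_besselJ {ν : ℂ} (hν : 0 ≤ ν.re) {x : ℝ} (hx : 0 < x) :
    HasDerivAt (besselJ ν) (besselP ν x / x) x := by
  have h1 := (hasDerivAt_half_cpow ν hx).mul (hasDerivAt_besselSeries_half hν hx)
  have h2 : besselJ ν =ᶠ[𝓝 x] fun x : ℝ => ((x / 2 : ℝ) : ℂ) ^ ν *
      besselSeries ν (((x / 2 : ℝ) : ℂ) ^ 2) := by
    filter_upwards [lt_mem_nhds hx] with z hz using besselJ_eq ν hz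
  refine (h1.congr_of_eventuallyEq h2).congr_deriv ?_
  rw [besselP]
  ring

/-- Bessel's equation `x (x J')' = (ν² - x²) J`. After differentiation the only input is
`besselSeries_recurrence`. -/
theorem hasDerivAt_besselP {ν : ℂ} (hν : 0 ≤ ν.re) {x : ℝ} (hx : 0 < x) :
    HasDerivAt (besselP ν) ((ν ^ 2 - x ^ 2) * besselJ ν x / x) x := by
  have h : 0 ≤ (ν + 1).re := by simp; linarith
  have h0 : HasDerivAt (fun x : ℝ => ((x / 2 : ℝ) : ℂ)) ((1 / 2 : ℝ) : ℂ) x :=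
    ((hasDerivAt_id x).div_const 2).ofReal_comp
  have h1 := (hasDerivAt_half_cpow ν hx).mul
    (((hasDerivAt_besselSeries_half hν hx).const_mul ν).sub
      (((h0.pow 2).const_mul 2).mul (hasDerivAt_besselSeries_half h hx)))
  refine h1.congr_deriv ?_
  rw [besselJ_eq ν hx]
  have h3 := besselSeries_recurrence hν (((x / 2 : ℝ) : ℂ) ^ 2)
  have h4 : ν + 1 + 1 = ν + 2 := by ring
  rw [h4]
  have hx' : (x : ℂ) ≠ 0 := by exact_mod_cast hx.ne'
  have h5 : (x : ℂ) ^ 2 = 4 * ((x / 2 : ℝ) : ℂ) ^ 2 := by push_cast; ring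
  have h6 : ((1 / 2 : ℝ) : ℂ) = ((x / 2 : ℝ) : ℂ) / x := by push_cast; field_simp
  simp only [Pi.mul_apply, Pi.sub_apply, Pi.pow_apply]
  rw [h5, h6]
  generalize ((x / 2 : ℝ) : ℂ) = y at *
  field_simp
  push_cast
  linear_combination (4 * y ^ 2 * y ^ ν) * h3

/-! ### Solutions of Bessel's equation of imaginary order -/

/-- `H` solves Bessel's equation of order `iμ` on `(0,∞)`, written as a first-order system for `H`
and `P(x) = x H'(x)`. -/
structure IsBesselPair (μ : ℝ) (H P : ℝ → ℂ) : Prop where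
  deriv_fst : ∀ x : ℝ, 0 < x → HasDerivAt H (P x / x) x
  deriv_snd : ∀ x : ℝ, 0 < x → HasDerivAt P (-(μ ^ 2 + x ^ 2) * H x / x) x

namespace IsBesselPair

variable {μ : ℝ} {H P : ℝ → ℂ}

/-- The coefficient `-(μ² + x²)` is real, so the conjugate pair solves the same system and the terms
of the derivative cancel. -/
theorem wronskian_eq (h : IsBesselPair μ H P) {x : ℝ} (hx : 0 < x) :
    H x * conj (P x) - conj (H x) * P x = H 1 * conj (P 1) - conj (H 1) * P 1 := by
  have hd : ∀ y ∈ Ioi (0 : ℝ), HasDerivAt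
      (fun x => H x * conj (P x) - conj (H x) * P x) 0 y := by
    intro y hy
    have h1 := h.deriv_fst y hy
    have h2 := h.deriv_snd y hy
    have h3 := ((h1.mul (Complex.conjCLE.toContinuousLinearMap.hasFDerivAt.comp_hasDerivAt y h2)).sub
      ((Complex.conjCLE.toContinuousLinearMap.hasFDerivAt.comp_hasDerivAt y h1).mul h2))
    refine h3.congr_deriv ?_
    simp
    ring
  have := (convex_Ioi (0 : ℝ)).is_const_of_fderivWithin_eq_zero (𝕜 := ℝ)
    (f := fun x => H x * conj (P x) - conj (H x) * P x)
    (fun y hy => (hd y hy).differentiableAt.differentiableWithinAt) (fun y hy => by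
      rw [fderivWithin_of_isOpen isOpen_Ioi hy]
      ext
      simpa using (hd y hy).deriv) hx (show (1 : ℝ) ∈ Ioi 0 by simp)
  exact this

theorem hasDerivAt_norm_sq {f : ℝ → ℂ} {f' : ℂ} {x : ℝ} (hf : HasDerivAt f f' x) :
    HasDerivAt (fun x => ‖f x‖ ^ 2) (2 * ((f x).re * f'.re + (f x).im * f'.im)) x := by
  refine hf.norm_sq.congr_deriv ?_
  rw [Complex.inner]
  simp
  ring

/-- The cross terms cancel and only the explicit `x²` contributes to the derivative. Being
increasing, this energy gives bounds towards `0`, where `μ² > 0` keeps it coercive in `H`. -/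
theorem energy_monotone (h : IsBesselPair μ H P) :
    MonotoneOn (fun x => ‖P x‖ ^ 2 + (μ ^ 2 + x ^ 2) * ‖H x‖ ^ 2) (Ioi 0) := by
  have hd : ∀ x ∈ Ioi (0 : ℝ), HasDerivAt
      (fun x => ‖P x‖ ^ 2 + (μ ^ 2 + x ^ 2) * ‖H x‖ ^ 2) (2 * x * ‖H x‖ ^ 2) x := by
    intro x hx
    have hx' : x ≠ 0 := ne_of_gt hx
    have h1 := h.deriv_fst x hx
    have h2 := h.deriv_snd x hx
    have h3 := (hasDerivAt_norm_sq h2).add ((((hasDerivAt_id x).pow 2).const_add (μ ^ 2)).mul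
      (hasDerivAt_norm_sq h1))
    refine h3.congr_deriv ?_
    have e1 : (P x / x) = ((1 / x : ℝ) : ℂ) * P x := by push_cast; ring
    have e2 : (-(μ ^ 2 + x ^ 2) * H x / x : ℂ) = ((-(μ ^ 2 + x ^ 2) / x : ℝ) : ℂ) * H x := by
      push_cast; ring
    rw [e1, e2]
    simp only [Complex.re_ofReal_mul, Complex.im_ofReal_mul, ← Complex.normSq_eq_norm_sq,
      Complex.normSq_apply, Pi.pow_apply, id]
    field_simp
    push_cast
    ring
  refine monotoneOn_of_deriv_nonneg (convex_Ioi 0)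
    (fun x hx => (hd x hx).continuousAt.continuousWithinAt) ?_ ?_
  · rw [interior_Ioi]
    exact fun x hx => (hd x hx).differentiableAt.differentiableWithinAt
  · rw [interior_Ioi]
    intro x hx
    rw [(hd x hx).deriv]
    have : (0 : ℝ) < x := hx
    positivity

/-- For `u = √x H` Bessel's equation becomes `u'' = -(1 + (μ² + 1/4)/x²) u`, and the function here
is `|u'|² + (1 + (μ² + 1/4)/x²) |u|²`. It decreases because the coefficient of `|u|²` does, and
gives bounds towards infinity. -/
theorem energy_antitone (h : IsBesselPair μ H P) :
    AntitoneOn (fun x => ‖P x + H x / 2‖ ^ 2 / x + x * ‖H x‖ ^ 2 +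
      (μ ^ 2 + 1 / 4) * ‖H x‖ ^ 2 / x) (Ioi 0) := by
  have hd : ∀ x ∈ Ioi (0 : ℝ), HasDerivAt (fun x => ‖P x + H x / 2‖ ^ 2 / x + x * ‖H x‖ ^ 2 +
      (μ ^ 2 + 1 / 4) * ‖H x‖ ^ 2 / x) (-(2 * (μ ^ 2 + 1 / 4) * ‖H x‖ ^ 2 / x ^ 2)) x := by
    intro x hx
    have hx' : x ≠ 0 := ne_of_gt hx
    have h1 := h.deriv_fst x hx
    have h2 := h.deriv_snd x hx
    have h3 := (((hasDerivAt_norm_sq (h2.add (h1.div_const 2))).div (hasDerivAt_id x) hx').add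
      ((hasDerivAt_id x).mul (hasDerivAt_norm_sq h1))).add
      (((hasDerivAt_norm_sq h1).const_mul (μ ^ 2 + 1 / 4)).div (hasDerivAt_id x) hx')
    refine h3.congr_deriv ?_
    have e1 : (P x / x) = ((1 / x : ℝ) : ℂ) * P x := by push_cast; ring
    have e2 : (-(μ ^ 2 + x ^ 2) * H x / x : ℂ) = ((-(μ ^ 2 + x ^ 2) / x : ℝ) : ℂ) * H x := by
      push_cast; ring
    have e3 : ∀ z : ℂ, z / 2 = ((1 / 2 : ℝ) : ℂ) * z := by intro z; push_cast; ring
    simp only [e1, e2, e3, Pi.add_apply]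
    simp only [Complex.re_ofReal_mul, Complex.im_ofReal_mul, ← Complex.normSq_eq_norm_sq,
      Complex.normSq_apply, Complex.add_re, Complex.add_im, id]
    field_simp
    ring
  refine antitoneOn_of_deriv_nonpos (convex_Ioi 0)
    (fun x hx => (hd x hx).continuousAt.continuousWithinAt) ?_ ?_
  · rw [interior_Ioi]
    exact fun x hx => (hd x hx).differentiableAt.differentiableWithinAt
  · rw [interior_Ioi]
    intro x hx
    rw [(hd x hx).deriv]
    have : (0 : ℝ) < x := hx
    have : 0 ≤ 2 * (μ ^ 2 + 1 / 4) * ‖H x‖ ^ 2 / x ^ 2 := by positivity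
    linarith

/-- The increasing energy is compared with its value at `1` on `(0,1]`, the decreasing one on
`[1,∞)`. The growth rates are those which the Sobolev weights of order `±1/2` compensate. -/
theorem exists_bound (h : IsBesselPair μ H P) (hμ : 0 < μ) : ∃ C : ℝ, 0 ≤ C ∧
    ∀ x : ℝ, 0 < x → ‖H x‖ * √(1 + x) ≤ C ∧ ‖P x‖ ≤ C * √(1 + x) := by
  have mem1 : (1 : ℝ) ∈ Ioi (0 : ℝ) := by simp
  set e := ‖P 1‖ ^ 2 + (μ ^ 2 + 1 ^ 2) * ‖H 1‖ ^ 2 with he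
  set E := ‖P 1 + H 1 / 2‖ ^ 2 / 1 + 1 * ‖H 1‖ ^ 2 + (μ ^ 2 + 1 / 4) * ‖H 1‖ ^ 2 / 1 with hE
  have he0 : 0 ≤ e := by positivity
  have hE0 : 0 ≤ E := by positivity
  -- A common bound: `(0,1]` needs `e` and `2 e / μ²`, and `[1,∞)` needs `2 E`.
  set M := e + 2 * (e / μ ^ 2) + 2 * E with hM
  have hM0 : 0 ≤ M := by positivity
  have key : ∀ x : ℝ, 0 < x → ‖H x‖ ^ 2 * (1 + x) ≤ M ∧ ‖P x‖ ^ 2 ≤ M * (1 + x) := by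
    intro x hx
    have hH := sq_nonneg ‖H x‖
    rcases le_total x 1 with h1 | h1
    · have h2 : ‖P x‖ ^ 2 + (μ ^ 2 + x ^ 2) * ‖H x‖ ^ 2 ≤ e := h.energy_monotone hx mem1 h1
      have h3 : ‖P x‖ ^ 2 ≤ e := by
        have : 0 ≤ (μ ^ 2 + x ^ 2) * ‖H x‖ ^ 2 := by positivity
        linarith
      have h4 : ‖H x‖ ^ 2 ≤ e / μ ^ 2 := by
        rw [le_div_iff₀ (by positivity)]
        have : 0 ≤ x ^ 2 * ‖H x‖ ^ 2 := by positivity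
        have := sq_nonneg ‖P x‖
        nlinarith
      have h5 : 0 ≤ e / μ ^ 2 := by positivity
      constructor
      · calc ‖H x‖ ^ 2 * (1 + x) ≤ e / μ ^ 2 * (1 + 1) := by gcongr
          _ ≤ M := by linarith
      · calc ‖P x‖ ^ 2 ≤ e := h3
          _ ≤ M := by linarith
          _ ≤ M * (1 + x) := by nlinarith
    · have h2 : ‖P x + H x / 2‖ ^ 2 / x + x * ‖H x‖ ^ 2 + (μ ^ 2 + 1 / 4) * ‖H x‖ ^ 2 / x ≤ E :=
        h.energy_antitone mem1 hx h1
      have a1 : 0 ≤ ‖P x + H x / 2‖ ^ 2 / x := by positivity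
      have a2 : 0 ≤ x * ‖H x‖ ^ 2 := by positivity
      have a3 : 0 ≤ (μ ^ 2 + 1 / 4) * ‖H x‖ ^ 2 / x := by positivity
      have h3 : x * ‖H x‖ ^ 2 ≤ E := by linarith
      have h4 : ‖P x + H x / 2‖ ^ 2 ≤ E * x := by
        rw [← div_le_iff₀ hx]
        linarith
      have h5 : ‖H x‖ ^ 2 ≤ E := by nlinarith
      have h7 : 0 ≤ e / μ ^ 2 := by positivity
      constructor
      · calc ‖H x‖ ^ 2 * (1 + x) = ‖H x‖ ^ 2 + x * ‖H x‖ ^ 2 := by ring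
          _ ≤ M := by linarith
      · have h6 : ‖P x‖ ≤ ‖P x + H x / 2‖ + ‖H x‖ / 2 := by
          have := norm_sub_le (P x + H x / 2) (H x / 2)
          rw [add_sub_cancel_right, norm_div] at this
          simpa using this
        have h8 : ‖P x‖ ^ 2 ≤ 2 * ‖P x + H x / 2‖ ^ 2 + ‖H x‖ ^ 2 := by
          have := norm_nonneg (P x)
          have := norm_nonneg (H x)
          have := sq_nonneg (‖P x + H x / 2‖ - ‖H x‖ / 2)
          nlinarith
        calc ‖P x‖ ^ 2 ≤ 2 * (E * x) + E := by linarith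
          _ ≤ 2 * E * (1 + x) := by linarith
          _ ≤ M * (1 + x) := by
            gcongr
            linarith
  refine ⟨√M, Real.sqrt_nonneg _, fun x hx => ⟨?_, ?_⟩⟩
  · apply Real.le_sqrt_of_sq_le
    rw [mul_pow, Real.sq_sqrt (by positivity)]
    exact (key x hx).1
  · rw [← Real.sqrt_mul hM0]
    exact Real.le_sqrt_of_sq_le (key x hx).2

end IsBesselPair

/-! ### The Hankel function of imaginary order -/

theorem conj_besselCoeff (ν : ℂ) (n : ℕ) :
    conj (besselCoeff ν n) = besselCoeff (conj ν) n := by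
  simp [besselCoeff, ← Complex.Gamma_conj]

theorem conj_besselSeries (ν y : ℂ) :
    conj (besselSeries ν y) = besselSeries (conj ν) (conj y) := by
  simp [besselSeries, Complex.conj_tsum, conj_besselCoeff]

theorem conj_half_cpow (ν : ℂ) {x : ℝ} (hx : 0 < x) :
    conj (((x / 2 : ℝ) : ℂ) ^ ν) = ((x / 2 : ℝ) : ℂ) ^ (conj ν) := by
  rw [Complex.cpow_conj _ _ ?_, Complex.conj_ofReal]
  rw [Complex.arg_ofReal_of_nonneg (by positivity)]
  exact Real.pi_ne_zero.symm

theorem conj_besselJ (ν : ℂ) {x : ℝ} (hx : 0 < x) :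
    conj (besselJ ν x) = besselJ (conj ν) x := by
  rw [besselJ_eq ν hx, besselJ_eq _ hx, map_mul, conj_half_cpow ν hx, conj_besselSeries, map_pow,
    Complex.conj_ofReal]

theorem conj_besselP (ν : ℂ) {x : ℝ} (hx : 0 < x) :
    conj (besselP ν x) = besselP (conj ν) x := by
  simp only [besselP, map_mul, map_sub, conj_half_cpow ν hx, conj_besselSeries, map_pow,
    Complex.conj_ofReal, map_add, map_one, map_ofNat]

theorem isBesselPair_besselJ (μ : ℝ) :
    IsBesselPair μ (besselJ (Complex.I * μ)) (besselP (Complex.I * μ)) where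
  deriv_fst x hx := hasDerivAt_besselJ (by simp) hx
  deriv_snd x hx := by
    refine (hasDerivAt_besselP (by simp) hx).congr_deriv ?_
    rw [mul_pow, Complex.I_sq]
    ring

/-- The Wronskian is constant on `(0,∞)`, and for imaginary `ν` the factor `(x/2)^ν` has modulus
one. What remains after removing it extends continuously to `x = 0`, with the value `-2ν /
|Γ(ν+1)|²`. -/
theorem besselJ_wronskian_ne_zero {μ : ℝ} (hμ : 0 < μ) :
    besselJ (Complex.I * μ) 1 * conj (besselP (Complex.I * μ) 1) -
      conj (besselJ (Complex.I * μ) 1) * besselP (Complex.I * μ) 1 ≠ 0 := by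
  set ν : ℂ := Complex.I * μ with hν
  have hre : 0 ≤ ν.re := by simp [hν]
  have hconj : conj ν = -ν := by simp [hν]
  set g : ℝ → ℂ := fun x => besselSeries ν (((x / 2 : ℝ) : ℂ) ^ 2) with hg
  set g₁ : ℝ → ℂ := fun x => besselSeries (ν + 1) (((x / 2 : ℝ) : ℂ) ^ 2) with hg₁
  -- The Wronskian with the unimodular factors removed; unlike `besselJ` itself, it is continuous at
  -- `0`.
  set Φ : ℝ → ℂ := fun x => -2 * ν * (g x * conj (g x)) -
    2 * ((x / 2 : ℝ) : ℂ) ^ 2 * (g x * conj (g₁ x) - conj (g x) * g₁ x) with hΦ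
  have hcont : Continuous Φ := by
    have h1 : Continuous (besselSeries ν) :=
      continuous_iff_continuousAt.2 fun y => (hasDerivAt_besselSeries hre y).continuousAt
    have h2 : Continuous (besselSeries (ν + 1)) :=
      continuous_iff_continuousAt.2 fun y =>
        (hasDerivAt_besselSeries (by simp; linarith) y).continuousAt
    have h3 : Continuous (fun x : ℝ => ((x / 2 : ℝ) : ℂ)) := by fun_prop
    have h4 : Continuous g := h1.comp (h3.pow 2)
    have h5 : Continuous g₁ := h2.comp (h3.pow 2)
    have h6 : Continuous (fun x => conj (g x)) := Complex.continuous_conj.comp h4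
    have h7 : Continuous (fun x => conj (g₁ x)) := Complex.continuous_conj.comp h5
    fun_prop
  have hΦx : ∀ x : ℝ, 0 < x → Φ x =
      besselJ ν 1 * conj (besselP ν 1) - conj (besselJ ν 1) * besselP ν 1 := by
    intro x hx
    rw [← (isBesselPair_besselJ μ).wronskian_eq hx, ← hν, besselJ_eq ν hx, besselP]
    simp only [map_mul, map_sub, hconj, map_pow, Complex.conj_ofReal, map_ofNat]
    have h1 : ((x / 2 : ℝ) : ℂ) ^ ν * conj (((x / 2 : ℝ) : ℂ) ^ ν) = 1 := by
      have h0 : ((x / 2 : ℝ) : ℂ) ≠ 0 := by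
        exact_mod_cast (by positivity : (x / 2 : ℝ) ≠ 0)
      rw [conj_half_cpow ν hx, hconj, ← Complex.cpow_add _ _ h0]
      simp
    simp only [hΦ, hg, hg₁]
    linear_combination (-(-2 * ν * (g x * conj (g x)) -
      2 * ((x / 2 : ℝ) : ℂ) ^ 2 * (g x * conj (g₁ x) - conj (g x) * g₁ x))) * h1
  have hlim : Tendsto Φ (𝓝[>] 0) (𝓝 (Φ 0)) := hcont.continuousAt.continuousWithinAt
  have hlim' : Tendsto Φ (𝓝[>] 0) (𝓝 (besselJ ν 1 * conj (besselP ν 1) -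
      conj (besselJ ν 1) * besselP ν 1)) := by
    refine tendsto_const_nhds.congr' ?_
    filter_upwards [self_mem_nhdsWithin] with x hx using (hΦx x hx).symm
  rw [← tendsto_nhds_unique hlim hlim']
  have hg0 : g 0 = (Complex.Gamma (ν + 1))⁻¹ := by
    simp only [hg, besselSeries]
    rw [tsum_eq_single 0]
    · simp [besselCoeff]
    · intro n hn
      simp [hn]
  have hg0' : g 0 ≠ 0 := by
    rw [hg0]
    refine inv_ne_zero (Complex.Gamma_ne_zero_of_re_pos ?_)
    simp
    linarith
  have hν0 : ν ≠ 0 := by simp [hν, hμ.ne']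
  simp [hΦ, hν0, hg0']

/-- The function `x ↦ x H_ν'(x)`. -/
noncomputable def hankelP (ν : ℂ) (x : ℝ) : ℂ :=
  (besselP (-ν) x - Complex.exp (-(Complex.I * Real.pi * ν)) * besselP ν x) /
    (Complex.I * Complex.sin (ν * Real.pi))

theorem isBesselPair_hankel1 (μ : ℝ) :
    IsBesselPair μ (hankel1 (Complex.I * μ)) (hankelP (Complex.I * μ)) where
  deriv_fst x hx := by
    have h1 := hasDerivAt_besselJ (ν := -(Complex.I * μ)) (by simp) hx
    have h2 := hasDerivAt_besselJ (ν := Complex.I * μ) (by simp) hx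
    refine ((h1.sub (h2.const_mul _)).div_const _).congr_deriv ?_
    rw [hankelP]
    ring
  deriv_snd x hx := by
    have h1 := hasDerivAt_besselP (ν := -(Complex.I * μ)) (by simp) hx
    have h2 := hasDerivAt_besselP (ν := Complex.I * μ) (by simp) hx
    refine ((h1.sub (h2.const_mul _)).div_const _).congr_deriv ?_
    rw [hankel1, neg_sq, mul_pow, Complex.I_sq]
    ring

/-- For `ν = iμ`, `J_{-ν}` is the conjugate of `J_ν`, so the Hankel function is `(conj J - a J) / S`
with `a = exp (π μ)`. Its Wronskian is that of `J` times `(a² - 1) / |S|²`, and `a > 1`. -/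
theorem hankel1_wronskian_ne_zero {μ : ℝ} (hμ : 0 < μ) :
    hankel1 (Complex.I * μ) 1 * conj (hankelP (Complex.I * μ) 1) -
      conj (hankel1 (Complex.I * μ) 1) * hankelP (Complex.I * μ) 1 ≠ 0 := by
  have h0 := besselJ_wronskian_ne_zero hμ
  set ν : ℂ := Complex.I * μ with hν
  have hconj : conj ν = -ν := by simp [hν]
  have hJ : besselJ (-ν) 1 = conj (besselJ ν 1) := by rw [conj_besselJ ν one_pos, hconj]
  have hP : besselP (-ν) 1 = conj (besselP ν 1) := by rw [conj_besselP ν one_pos, hconj]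
  set a : ℝ := Real.exp (Real.pi * μ) with ha
  have ha1 : Complex.exp (-(Complex.I * Real.pi * ν)) = (a : ℂ) := by
    rw [ha, Complex.ofReal_exp]
    congr 1
    rw [hν]
    push_cast
    linear_combination (-(Real.pi : ℂ) * μ) * Complex.I_sq
  have ha2 : (a : ℂ) ^ 2 - 1 ≠ 0 := by
    have : 1 < a := by
      rw [ha, Real.one_lt_exp_iff]
      exact mul_pos Real.pi_pos hμ
    have h3 : a ^ 2 - 1 ≠ 0 := by nlinarith
    exact_mod_cast h3
  set S : ℂ := Complex.I * Complex.sin (ν * Real.pi) with hS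
  have hS0 : S ≠ 0 := by
    refine mul_ne_zero Complex.I_ne_zero ?_
    have : ν * Real.pi = ((μ * Real.pi : ℝ) : ℂ) * Complex.I := by
      rw [hν]; push_cast; ring
    rw [this, Complex.sin_mul_I, ← Complex.ofReal_sinh]
    refine mul_ne_zero ?_ Complex.I_ne_zero
    have : Real.sinh (μ * Real.pi) ≠ 0 := by
      rw [Ne, Real.sinh_eq_zero]
      positivity
    exact_mod_cast this
  have hS1 : conj S ≠ 0 := by simpa using hS0
  have key : hankel1 ν 1 * conj (hankelP ν 1) - conj (hankel1 ν 1) * hankelP ν 1 =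
      ((a : ℂ) ^ 2 - 1) / (S * conj S) *
        (besselJ ν 1 * conj (besselP ν 1) - conj (besselJ ν 1) * besselP ν 1) := by
    rw [hankel1, hankelP, ha1, hJ, hP, ← hS]
    simp only [map_div₀, map_sub, map_mul, Complex.conj_conj, Complex.conj_ofReal]
    field_simp
    ring
  rw [key]
  exact mul_ne_zero (div_ne_zero ha2 (mul_ne_zero hS0 hS1)) h0

/-! ### Mode functions -/

theorem mu_pos {R m : ℝ} (hm : 3 / 2 < m * R) : 0 < mu R m :=
  Real.sqrt_pos.2 (by nlinarith)

theorem mu_sq {R m : ℝ} (hm : 3 / 2 < m * R) : mu R m ^ 2 = (m * R) ^ 2 - 9 / 4 :=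
  Real.sq_sqrt (by nlinarith)

theorem hasDerivAt_mode' (R m : ℝ) {t k : ℝ} (ht : 0 < t) (hk : 0 < k) :
    HasDerivAt (fun τ => mode R m τ k)
      (((t ^ (1 / 2 : ℝ) * Real.exp (-(mu R m * Real.pi / 2)) : ℝ) : ℂ) *
        (3 / 2 * hankel1 (Complex.I * mu R m) (k * t) +
          hankelP (Complex.I * mu R m) (k * t))) t := by
  have h1 : HasDerivAt (fun τ : ℝ => ((τ ^ (3 / 2 : ℝ) * Real.exp (-(mu R m * Real.pi / 2)) : ℝ) : ℂ))
      _ t := ((Real.hasDerivAt_rpow_const (p := 3 / 2) (Or.inl ht.ne')).mul_const _).ofReal_comp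
  have h2 := ((isBesselPair_hankel1 (mu R m)).deriv_fst (k * t) (by positivity)).scomp t
    ((hasDerivAt_id t).const_mul k)
  refine (h1.mul h2).congr_deriv ?_
  have h3 : t ^ (3 / 2 : ℝ) = t ^ (1 / 2 : ℝ) * t := by
    rw [← Real.rpow_add_one ht.ne']
    norm_num
  have h4 : (3 / 2 - 1 : ℝ) = 1 / 2 := by norm_num
  have ht' : (t : ℂ) ≠ 0 := by exact_mod_cast ht.ne'
  have hk' : (k : ℂ) ≠ 0 := by exact_mod_cast hk.ne'
  rw [h3, h4]
  simp only [Function.comp, mul_one, Complex.real_smul]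
  push_cast
  field_simp

theorem modeDeriv_eq (R m : ℝ) {t k : ℝ} (ht : 0 < t) (hk : 0 < k) :
    modeDeriv R m t k = ((t ^ (1 / 2 : ℝ) * Real.exp (-(mu R m * Real.pi / 2)) : ℝ) : ℂ) *
        (3 / 2 * hankel1 (Complex.I * mu R m) (k * t) +
          hankelP (Complex.I * mu R m) (k * t)) :=
  (hasDerivAt_mode' R m ht hk).deriv

theorem hasDerivAt_mode (R m : ℝ) {t k : ℝ} (ht : 0 < t) (hk : 0 < k) :
    HasDerivAt (fun τ => mode R m τ k) (modeDeriv R m t k) t := by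
  rw [modeDeriv_eq R m ht hk]
  exact hasDerivAt_mode' R m ht hk

/-- The mode equation `(t v')' = 3 v' - (t k² + (mR)²/t) v`. -/
theorem hasDerivAt_mul_modeDeriv {R m : ℝ} (hm : 3 / 2 < m * R) {t k : ℝ} (ht : 0 < t)
    (hk : 0 < k) :
    HasDerivAt (fun τ : ℝ => (τ : ℂ) * modeDeriv R m τ k)
      (3 * modeDeriv R m t k - (t * k ^ 2 + (m * R) ^ 2 / t) * mode R m t k) t := by
  have hev : (fun τ : ℝ => (τ : ℂ) * modeDeriv R m τ k) =ᶠ[𝓝 t] fun τ : ℝ =>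
      ((τ ^ (3 / 2 : ℝ) * Real.exp (-(mu R m * Real.pi / 2)) : ℝ) : ℂ) *
        (3 / 2 * hankel1 (Complex.I * mu R m) (k * τ) +
          hankelP (Complex.I * mu R m) (k * τ)) := by
    filter_upwards [lt_mem_nhds ht] with τ hτ
    have h3 : τ ^ (3 / 2 : ℝ) = τ ^ (1 / 2 : ℝ) * τ := by
      rw [← Real.rpow_add_one (ne_of_gt hτ)]
      norm_num
    rw [modeDeriv_eq R m hτ hk, h3]
    push_cast
    ring
  have h1 : HasDerivAt (fun τ : ℝ => ((τ ^ (3 / 2 : ℝ) * Real.exp (-(mu R m * Real.pi / 2)) : ℝ) : ℂ))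
      _ t := ((Real.hasDerivAt_rpow_const (p := 3 / 2) (Or.inl ht.ne')).mul_const _).ofReal_comp
  have h2 := ((isBesselPair_hankel1 (mu R m)).deriv_fst (k * t) (by positivity)).scomp t
    ((hasDerivAt_id t).const_mul k)
  have h2' := ((isBesselPair_hankel1 (mu R m)).deriv_snd (k * t) (by positivity)).scomp t
    ((hasDerivAt_id t).const_mul k)
  refine ((h1.mul ((h2.const_mul (3 / 2 : ℂ)).add h2')).congr_of_eventuallyEq hev).congr_deriv ?_
  have h3 : t ^ (3 / 2 : ℝ) = t ^ (1 / 2 : ℝ) * t := by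
    rw [← Real.rpow_add_one ht.ne']
    norm_num
  have h4 : (3 / 2 - 1 : ℝ) = 1 / 2 := by norm_num
  have ht' : (t : ℂ) ≠ 0 := by exact_mod_cast ht.ne'
  have hk' : (k : ℂ) ≠ 0 := by exact_mod_cast hk.ne'
  have hμ : (mu R m : ℂ) ^ 2 = (m * R) ^ 2 - 9 / 4 := by
    rw [← Complex.ofReal_pow, mu_sq hm]
    push_cast
    ring
  rw [modeDeriv_eq R m ht hk, mode, h3, h4]
  simp only [Function.comp, mul_one, Complex.real_smul, Pi.add_apply]
  push_cast
  rw [hμ]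
  field_simp
  ring

/-- The constant `W(t,k) / t²`. -/
noncomputable def wronskianConst (R m : ℝ) : ℂ :=
  ((Real.exp (-(mu R m * Real.pi / 2)) ^ 2 : ℝ) : ℂ) *
    (hankel1 (Complex.I * mu R m) 1 * conj (hankelP (Complex.I * mu R m) 1) -
      conj (hankel1 (Complex.I * mu R m) 1) * hankelP (Complex.I * mu R m) 1)

theorem wronskianConst_ne_zero {R m : ℝ} (hm : 3 / 2 < m * R) : wronskianConst R m ≠ 0 := by
  refine mul_ne_zero ?_ (hankel1_wronskian_ne_zero (mu_pos hm))
  exact_mod_cast (by positivity : Real.exp (-(mu R m * Real.pi / 2)) ^ 2 ≠ 0)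

theorem conj_wronskianConst (R m : ℝ) : conj (wronskianConst R m) = -wronskianConst R m := by
  simp only [wronskianConst, map_mul, map_sub, Complex.conj_ofReal, Complex.conj_conj]
  ring

theorem wronskian_def (R m t k : ℝ) : wronskian R m t k =
    mode R m t k * conj (modeDeriv R m t k) - conj (mode R m t k) * modeDeriv R m t k := by
  rw [wronskian, Matrix.det_fin_two_of]

/-- The term `3/2 H` of the derivative drops out by antisymmetry, and `t^(3/2) t^(1/2)` gives `t²`.
Since `k` does not enter, the division in `coeff` creates no singularity in `k`. -/
theorem wronskian_eq (R m : ℝ) {t k : ℝ} (ht : 0 < t) (hk : 0 < k) :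
    wronskian R m t k = wronskianConst R m * t ^ 2 := by
  rw [wronskian_def, modeDeriv_eq R m ht hk, mode, wronskianConst,
    ← (isBesselPair_hankel1 (mu R m)).wronskian_eq (x := k * t) (by positivity)]
  have h3 : t ^ (3 / 2 : ℝ) = t ^ (1 / 2 : ℝ) * t := by
    rw [← Real.rpow_add_one ht.ne']
    norm_num
  have h5 : ((t ^ (1 / 2 : ℝ) : ℝ) : ℂ) * ((t ^ (1 / 2 : ℝ) : ℝ) : ℂ) = t := by
    rw [← Complex.ofReal_mul, ← Real.rpow_add ht]
    norm_num
  rw [h3]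
  simp only [map_mul, Complex.conj_ofReal, map_add, map_div₀, map_ofNat]
  push_cast at h5 ⊢
  linear_combination (t * Complex.exp (-(mu R m * Real.pi / 2)) ^ 2 *
    (hankel1 (Complex.I * mu R m) (k * t) * conj (hankelP (Complex.I * mu R m) (k * t)) -
      conj (hankel1 (Complex.I * mu R m) (k * t)) * hankelP (Complex.I * mu R m) (k * t))) * h5

theorem exists_mode_bound {R m : ℝ} (hm : 3 / 2 < m * R) {T : ℝ} (hT : 1 ≤ T) : ∃ C : ℝ, 0 ≤ C ∧
    ∀ t ∈ Icc 1 T, ∀ k : ℝ, 0 < k →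
      ‖mode R m t k‖ * √(1 + k) ≤ C ∧ ‖modeDeriv R m t k‖ ≤ C * √(1 + k) := by
  obtain ⟨C, hC, h⟩ := (isBesselPair_hankel1 (mu R m)).exists_bound (mu_pos hm)
  -- The derivative costs `3/2 + 1`, rounded up to `3`; one factor `T` comes from `t^(1/2)` and the
  -- other from `√(1 + kt) ≤ T √(1 + k)`.
  refine ⟨3 * T ^ 2 * C, by positivity, fun t ht k hk => ?_⟩
  have ht0 : 0 < t := by linarith [ht.1]
  have hT0 : 0 < T := by linarith
  obtain ⟨h1, h2⟩ := h (k * t) (by positivity)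
  have hE : Real.exp (-(mu R m * Real.pi / 2)) ≤ 1 := by
    rw [Real.exp_le_one_iff]
    have := mu_pos hm
    have := Real.pi_pos
    have : 0 < mu R m * Real.pi / 2 := by positivity
    linarith
  have hpow : t ^ (3 / 2 : ℝ) ≤ T ^ 2 := by
    calc t ^ (3 / 2 : ℝ) ≤ T ^ (3 / 2 : ℝ) := Real.rpow_le_rpow ht0.le ht.2 (by norm_num)
      _ ≤ T ^ (2 : ℝ) := Real.rpow_le_rpow_of_exponent_le hT (by norm_num)
      _ = T ^ 2 := Real.rpow_two T
  have hpow' : t ^ (1 / 2 : ℝ) ≤ T := by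
    calc t ^ (1 / 2 : ℝ) ≤ T ^ (1 / 2 : ℝ) := Real.rpow_le_rpow ht0.le ht.2 (by norm_num)
      _ ≤ T ^ (1 : ℝ) := Real.rpow_le_rpow_of_exponent_le hT (by norm_num)
      _ = T := Real.rpow_one T
  have hs1 : √(1 + k) ≤ √(1 + k * t) := Real.sqrt_le_sqrt (by nlinarith [ht.1])
  have hs2 : √(1 + k * t) ≤ T * √(1 + k) := by
    rw [Real.sqrt_le_left (by positivity), mul_pow, Real.sq_sqrt (by positivity)]
    have : t ≤ T ^ 2 := by nlinarith [ht.2]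
    have : (1 : ℝ) ≤ T ^ 2 := by nlinarith
    nlinarith
  have hs3 : 1 ≤ √(1 + k * t) := Real.one_le_sqrt.2 (by nlinarith [ht.1])
  have hs4 : 1 ≤ √(1 + k) := Real.one_le_sqrt.2 (by linarith)
  set H := hankel1 (Complex.I * mu R m) (k * t)
  set P := hankelP (Complex.I * mu R m) (k * t)
  set E := Real.exp (-(mu R m * Real.pi / 2))
  have hE0 : 0 ≤ E := (Real.exp_pos _).le
  have hH : ‖H‖ ≤ C := by
    calc ‖H‖ ≤ ‖H‖ * √(1 + k * t) := le_mul_of_one_le_right (norm_nonneg _) hs3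
      _ ≤ C := h1
  have hr1 : 0 ≤ t ^ (3 / 2 : ℝ) := by positivity
  have hr2 : 0 ≤ t ^ (1 / 2 : ℝ) := by positivity
  constructor
  · rw [mode, norm_mul, Complex.norm_real, Real.norm_of_nonneg (by positivity)]
    calc t ^ (3 / 2 : ℝ) * E * ‖H‖ * √(1 + k)
        ≤ T ^ 2 * 1 * ‖H‖ * √(1 + k * t) := by gcongr
      _ = T ^ 2 * (‖H‖ * √(1 + k * t)) := by ring
      _ ≤ T ^ 2 * C := by gcongr
      _ ≤ 3 * T ^ 2 * C := by nlinarith [mul_nonneg (sq_nonneg T) hC]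
  · rw [modeDeriv_eq R m ht0 hk, norm_mul, Complex.norm_real, Real.norm_of_nonneg (by positivity)]
    have h6 : ‖3 / 2 * H + P‖ ≤ 3 / 2 * C + C * (T * √(1 + k)) := by
      calc ‖3 / 2 * H + P‖ ≤ ‖3 / 2 * H‖ + ‖P‖ := norm_add_le _ _
        _ ≤ 3 / 2 * ‖H‖ + C * √(1 + k * t) := by
          rw [norm_mul]
          norm_num
          exact h2
        _ ≤ _ := by gcongr
    have h7 : 3 / 2 * C ≤ 3 / 2 * C * (T * √(1 + k)) := by
      refine le_mul_of_one_le_right (by positivity) ?_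
      nlinarith
    calc t ^ (1 / 2 : ℝ) * E * ‖3 / 2 * H + P‖
        ≤ T * 1 * (3 / 2 * C + C * (T * √(1 + k))) := by gcongr
      _ ≤ T * 1 * (3 / 2 * C * (T * √(1 + k)) + C * (T * √(1 + k))) := by gcongr
      _ = 5 / 2 * (T ^ 2 * C * √(1 + k)) := by ring
      _ ≤ 3 * (T ^ 2 * C * √(1 + k)) := by gcongr; norm_num
      _ = _ := by ring

theorem continuousOn_mode (R m : ℝ) {t : ℝ} (ht : 0 < t) :
    ContinuousOn (fun k => mode R m t k) (Ioi 0) := by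
  intro k hk
  have hk : (0 : ℝ) < k := hk
  have h1 := ((isBesselPair_hankel1 (mu R m)).deriv_fst (k * t) (by positivity)).continuousAt
  have h2 : ContinuousAt (fun k => hankel1 (Complex.I * mu R m) (k * t)) k :=
    h1.comp_of_eq (f := fun k : ℝ => k * t) (by fun_prop) rfl
  exact (continuousAt_const.mul h2).continuousWithinAt

theorem continuousOn_modeDeriv (R m : ℝ) {t : ℝ} (ht : 0 < t) :
    ContinuousOn (fun k => modeDeriv R m t k) (Ioi 0) := by
  have : ContinuousOn (fun k => ((t ^ (1 / 2 : ℝ) * Real.exp (-(mu R m * Real.pi / 2)) : ℝ) : ℂ) *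
        (3 / 2 * hankel1 (Complex.I * mu R m) (k * t) +
          hankelP (Complex.I * mu R m) (k * t))) (Ioi 0) := by
    intro k hk
    have hk : (0 : ℝ) < k := hk
    have h1 := ((isBesselPair_hankel1 (mu R m)).deriv_fst (k * t) (by positivity)).continuousAt
    have h1' := ((isBesselPair_hankel1 (mu R m)).deriv_snd (k * t) (by positivity)).continuousAt
    have h2 : ContinuousAt (fun k => hankel1 (Complex.I * mu R m) (k * t)) k :=
      h1.comp_of_eq (f := fun k : ℝ => k * t) (by fun_prop) rfl
    have h2' : ContinuousAt (fun k => hankelP (Complex.I * mu R m) (k * t)) k :=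
      h1'.comp_of_eq (f := fun k : ℝ => k * t) (by fun_prop) rfl
    exact (continuousAt_const.mul ((continuousAt_const.mul h2).add h2')).continuousWithinAt
  exact this.congr fun k hk => modeDeriv_eq R m ht hk

/-! ### Weights and symbols -/

/-- The weight `(1 + |k/2π|²)^(s/2)`. -/
noncomputable def wt (s : ℝ) (k : E3) : ℝ := (1 + ‖(2 * Real.pi)⁻¹ • k‖ ^ 2) ^ (s / 2)

theorem wt_pos (s : ℝ) (k : E3) : 0 < wt s k := by
  rw [wt]
  positivity

theorem wt_mul (s r : ℝ) (k : E3) : wt s k * wt r k = wt (s + r) k := by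
  rw [wt, wt, wt, ← Real.rpow_add (by positivity)]
  congr 1
  ring

@[simp] theorem wt_zero (k : E3) : wt 0 k = 1 := by simp [wt]

@[simp] theorem wt_neg_arg (s : ℝ) (k : E3) : wt s (-k) = wt s k := by simp [wt]

theorem wt_le_one {s : ℝ} (hs : s ≤ 0) (k : E3) : wt s k ≤ 1 :=
  Real.rpow_le_one_of_one_le_of_nonpos (by simp) (by linarith)

theorem continuous_wt (s : ℝ) : Continuous (wt s) := by
  have : Continuous fun k : E3 => 1 + ‖(2 * Real.pi)⁻¹ • k‖ ^ 2 := by fun_prop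
  exact this.rpow_const fun k => Or.inl (by positivity)

theorem wt_half_le (k : E3) : wt (1 / 2) k ≤ √(1 + ‖k‖) := by
  have h : (1 + ‖(2 * Real.pi)⁻¹ • k‖ ^ 2) ≤ (1 + ‖k‖) ^ 2 := by
    rw [norm_smul, Real.norm_of_nonneg (by positivity)]
    have h1 : (2 * Real.pi)⁻¹ ≤ 1 := inv_le_one_of_one_le₀ (by linarith [Real.pi_gt_three])
    have h2 : (2 * Real.pi)⁻¹ * ‖k‖ ≤ ‖k‖ := mul_le_of_le_one_left (norm_nonneg _) h1
    have h3 : 0 ≤ (2 * Real.pi)⁻¹ * ‖k‖ := by positivity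
    nlinarith [norm_nonneg k]
  calc wt (1 / 2) k ≤ ((1 + ‖k‖) ^ 2) ^ ((1 / 2 : ℝ) / 2) :=
        Real.rpow_le_rpow (by positivity) h (by norm_num)
    _ = √(1 + ‖k‖) := by
      rw [← Real.rpow_two, ← Real.rpow_mul (by positivity), Real.sqrt_eq_rpow]
      norm_num

/-- Boundedness of the Laplacian from order `s` to order `s - 2`; the weight is in `k / 2π`, and
`40` exceeds `(2π)²`. -/
theorem norm_sq_mul_wt_le (k : E3) : ‖k‖ ^ 2 * wt (-2) k ≤ 40 := by
  have h : wt (-2) k = (1 + ‖(2 * Real.pi)⁻¹ • k‖ ^ 2)⁻¹ := by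
    rw [wt, show (-2 / 2 : ℝ) = -1 by norm_num, Real.rpow_neg_one]
  rw [h, norm_smul, Real.norm_of_nonneg (by positivity), ← div_eq_mul_inv,
    div_le_iff₀ (by positivity), mul_pow, inv_pow]
  have h2 : (2 * Real.pi) ^ 2 ≤ 40 := by nlinarith [Real.pi_lt_d2, Real.pi_gt_three]
  have h3 : 1 ≤ 40 * ((2 * Real.pi) ^ 2)⁻¹ := by
    rw [← div_eq_mul_inv, le_div_iff₀ (by positivity)]
    linarith
  nlinarith [sq_nonneg ‖k‖]

/-- In the fourth power all exponents are integers, and the previous bound yields `2 + 80 ≤ 4 ^ 4`.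
-/
theorem sqrt_mul_wt_le (k : E3) : √(1 + ‖k‖) * wt (-1 / 2) k ≤ 4 := by
  have h1 : (√(1 + ‖k‖) * wt (-1 / 2) k) ^ 4 ≤ 4 ^ 4 := by
    have h2 : √(1 + ‖k‖) ^ 4 = (1 + ‖k‖) ^ 2 := by
      rw [show 4 = 2 * 2 by norm_num, pow_mul, Real.sq_sqrt (by positivity)]
    have h3 : wt (-1 / 2) k ^ 4 = wt (-2) k := by
      rw [show (-2 : ℝ) = -1 / 2 + -1 / 2 + -1 / 2 + -1 / 2 by norm_num, ← wt_mul, ← wt_mul,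
        ← wt_mul]
      ring
    rw [mul_pow, h2, h3]
    have h4 := norm_sq_mul_wt_le k
    have h5 := wt_le_one (s := -2) (by norm_num) k
    have h6 := wt_pos (-2) k
    have h7 : (1 + ‖k‖) ^ 2 ≤ 2 * (1 + ‖k‖ ^ 2) := by nlinarith [sq_nonneg (1 - ‖k‖)]
    calc (1 + ‖k‖) ^ 2 * wt (-2) k ≤ 2 * (1 + ‖k‖ ^ 2) * wt (-2) k := by gcongr
      _ = 2 * wt (-2) k + 2 * (‖k‖ ^ 2 * wt (-2) k) := by ring
      _ ≤ 4 ^ 4 := by linarith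
  exact le_of_pow_le_pow_left₀ (by norm_num) (by norm_num) h1

/-- The symbol `(1 + |k/2π|²)^(1/4) v(t,|k|)`. -/
noncomputable def symA (R m t : ℝ) (k : E3) : ℂ := (wt (1 / 2) k : ℂ) * mode R m t ‖k‖

/-- The symbol `(t/R) (1 + |k/2π|²)^(-1/4) v'(t,|k|)`. -/
noncomputable def symB (R m t : ℝ) (k : E3) : ℂ :=
  ((t / R * wt (-1 / 2) k : ℝ) : ℂ) * modeDeriv R m t ‖k‖

@[simp] theorem symA_neg (R m t : ℝ) (k : E3) : symA R m t (-k) = symA R m t k := by simp [symA]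

@[simp] theorem symB_neg (R m t : ℝ) (k : E3) : symB R m t (-k) = symB R m t k := by simp [symB]

/-- The weights of orders `1/2` and `-1/2` cancel, so the normalised symbols still have a Wronskian
independent of `k`. -/
theorem symA_symB_wronskian {R : ℝ} (hR : 0 < R) (m : ℝ) {t : ℝ} (ht : 0 < t) {k : E3}
    (hk : k ≠ 0) : symA R m t k * conj (symB R m t k) - conj (symA R m t k) * symB R m t k =
      wronskianConst R m * t ^ 3 / R := by
  have h1 := wronskian_eq R m ht (norm_pos_iff.2 hk)
  rw [wronskian_def] at h1
  have h2 : (wt (1 / 2) k : ℂ) * (wt (-1 / 2) k : ℂ) = 1 := by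
    rw [← Complex.ofReal_mul, wt_mul]
    norm_num
  have hR' : (R : ℂ) ≠ 0 := by exact_mod_cast hR.ne'
  simp only [symA, symB, map_mul, Complex.conj_ofReal]
  push_cast
  rw [show (t : ℂ) ^ 3 = t * t ^ 2 by ring, show wronskianConst R m * (t * (t : ℂ) ^ 2) / R =
    t / R * (wronskianConst R m * t ^ 2) by ring, ← h1]
  linear_combination (t / R * (mode R m t ‖k‖ * conj (modeDeriv R m t ‖k‖) -
    conj (mode R m t ‖k‖) * modeDeriv R m t ‖k‖)) * h2

/-- The decay of `v` balances the weight of order `1/2`, and the growth of `v'` the weight of order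
`-1/2`. The origin, where the mode functions carry no information, is a null set. -/
theorem exists_sym_bound {R m : ℝ} (hR : 0 < R) (hm : 3 / 2 < m * R) {T : ℝ} (hT : 1 ≤ T) :
    ∃ C : ℝ, 0 ≤ C ∧ ∀ t ∈ Icc 1 T, ∀ k : E3, k ≠ 0 →
      ‖symA R m t k‖ ≤ C ∧ ‖symB R m t k‖ ≤ C := by
  obtain ⟨C, hC, h⟩ := exists_mode_bound hm hT
  refine ⟨C + T / R * 4 * C, by positivity, fun t ht k hk => ?_⟩
  have ht0 : 0 < t := by linarith [ht.1]
  obtain ⟨h1, h2⟩ := h t ht ‖k‖ (norm_pos_iff.2 hk)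
  have hT0 : 0 < T := by linarith
  have p1 : 0 ≤ T / R * 4 * C := by positivity
  have p2 := wt_pos (-1 / 2) k
  constructor
  · rw [symA, norm_mul, Complex.norm_real, Real.norm_of_nonneg (wt_pos _ _).le, mul_comm]
    calc ‖mode R m t ‖k‖‖ * wt (1 / 2) k ≤ ‖mode R m t ‖k‖‖ * √(1 + ‖k‖) := by
          gcongr
          exact wt_half_le k
      _ ≤ _ := by linarith
  · rw [symB, norm_mul, Complex.norm_real, Real.norm_of_nonneg (by positivity)]
    calc t / R * wt (-1 / 2) k * ‖modeDeriv R m t ‖k‖‖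
        ≤ T / R * wt (-1 / 2) k * (C * √(1 + ‖k‖)) := by
          gcongr
          exact ht.2
      _ = T / R * (√(1 + ‖k‖) * wt (-1 / 2) k) * C := by ring
      _ ≤ T / R * 4 * C := by
          gcongr
          exact sqrt_mul_wt_le k
      _ ≤ _ := by linarith

theorem aestronglyMeasurable_radial {f : ℝ → ℂ} (hf : ContinuousOn f (Ioi 0)) :
    AEStronglyMeasurable (fun k : E3 => f ‖k‖) volume := by
  have h1 : ContinuousOn (fun k : E3 => f ‖k‖) {0}ᶜ :=
    hf.comp continuous_norm.continuousOn fun k hk => norm_pos_iff.2 hk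
  have h2 := h1.aestronglyMeasurable (μ := volume) (measurableSet_singleton 0).compl
  rwa [Measure.restrict_eq_self_of_ae_mem] at h2
  exact compl_mem_ae_iff.2 (measure_singleton _)

theorem ae_ne_zero : ∀ᵐ k : E3, k ≠ 0 := compl_mem_ae_iff.2 (measure_singleton _)

theorem aestronglyMeasurable_symA (R m : ℝ) {t : ℝ} (ht : 0 < t) :
    AEStronglyMeasurable (symA R m t) volume :=
  (Complex.continuous_ofReal.comp (continuous_wt _)).aestronglyMeasurable.mul
    (aestronglyMeasurable_radial (continuousOn_mode R m ht))

theorem aestronglyMeasurable_symB (R m : ℝ) {t : ℝ} (ht : 0 < t) :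
    AEStronglyMeasurable (symB R m t) volume :=
  (Complex.continuous_ofReal.comp ((continuous_wt _).const_mul _)).aestronglyMeasurable.mul
    (aestronglyMeasurable_radial (continuousOn_modeDeriv R m ht))

/-- The additional weight of order `-1` is the passage to the weaker space; it is what keeps the
time derivative bounded in `k`. -/
theorem hasDerivAt_symA {R : ℝ} (hR : 0 < R) (m : ℝ) {t : ℝ} (ht : 0 < t) {k : E3} (hk : k ≠ 0) :
    HasDerivAt (fun τ => (wt (-1) k : ℂ) * symA R m τ k) (R / t * symB R m t k) t := by
  have h1 := ((hasDerivAt_mode R m ht (norm_pos_iff.2 hk)).const_mul (wt (1 / 2) k : ℂ)).const_mul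
    (wt (-1) k : ℂ)
  refine h1.congr_deriv ?_
  have h2 : (wt (-1) k : ℂ) * (wt (1 / 2) k : ℂ) = wt (-1 / 2) k := by
    rw [← Complex.ofReal_mul, wt_mul]
    norm_num
  have ht' : (t : ℂ) ≠ 0 := by exact_mod_cast ht.ne'
  have hR' : (R : ℂ) ≠ 0 := by exact_mod_cast hR.ne'
  rw [← mul_assoc, h2, symB]
  push_cast
  field_simp

/-- The time derivative of `(1 + |k/2π|²)^(-1/2)` times `symB`. -/
noncomputable def symBDeriv (R m t : ℝ) (k : E3) : ℂ :=
  -(((t / R * (‖k‖ ^ 2 * wt (-2) k) + R / t * m ^ 2 * wt (-2) k : ℝ) : ℂ) * symA R m t k) +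
    ((3 / t * wt (-1) k : ℝ) : ℂ) * symB R m t k

theorem hasDerivAt_symB {R : ℝ} (hR : 0 < R) {m : ℝ} (hm : 3 / 2 < m * R) {t : ℝ} (ht : 0 < t)
    {k : E3} (hk : k ≠ 0) :
    HasDerivAt (fun τ => (wt (-1) k : ℂ) * symB R m τ k) (symBDeriv R m t k) t := by
  have h1 := (hasDerivAt_mul_modeDeriv hm ht (norm_pos_iff.2 hk)).const_mul
    ((wt (-1) k * wt (-1 / 2) k / R : ℝ) : ℂ)
  refine (h1.congr_of_eventuallyEq (.of_forall fun τ => ?_)).congr_deriv ?_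
  · simp only [symB]
    push_cast
    ring
  · have h2 : (wt (-2) k : ℂ) * (wt (1 / 2) k : ℂ) = wt (-1) k * wt (-1 / 2) k := by
      rw [← Complex.ofReal_mul, ← Complex.ofReal_mul, wt_mul, wt_mul]
      norm_num
    have ht' : (t : ℂ) ≠ 0 := by exact_mod_cast ht.ne'
    have hR' : (R : ℂ) ≠ 0 := by exact_mod_cast hR.ne'
    simp only [symBDeriv, symA, symB]
    push_cast
    generalize wt (-1 / 2) k = w at *
    field_simp
    linear_combination (mode R m t ‖k‖ * (t ^ 2 * ‖k‖ ^ 2 + R ^ 2 * m ^ 2)) * h2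

theorem exists_symBDeriv_bound {R m : ℝ} (hR : 0 < R) (hm : 3 / 2 < m * R) {T : ℝ} (hT : 1 ≤ T) :
    ∃ C : ℝ, 0 ≤ C ∧ ∀ t ∈ Icc 1 T, ∀ k : E3, k ≠ 0 → ‖symBDeriv R m t k‖ ≤ C := by
  obtain ⟨C, hC, h⟩ := exists_sym_bound hR hm hT
  have hT0 : 0 < T := by linarith
  refine ⟨(T / R * 40 + R * m ^ 2 * 1) * C + 3 * 1 * C, by positivity, fun t ht k hk => ?_⟩
  obtain ⟨h1, h2⟩ := h t ht k hk
  have ht0 : 0 < t := by linarith [ht.1]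
  have p2 := wt_pos (-2) k
  have p1 := wt_pos (-1) k
  refine (norm_add_le _ _).trans ?_
  rw [norm_neg, norm_mul, norm_mul, Complex.norm_real, Complex.norm_real,
    Real.norm_of_nonneg (by positivity), Real.norm_of_nonneg (by positivity)]
  have e1 : R / t ≤ R := div_le_self hR.le ht.1
  have e2 : 3 / t ≤ 3 := div_le_self (by norm_num) ht.1
  gcongr
  · exact ht.2
  · exact norm_sq_mul_wt_le k
  · exact wt_le_one (by norm_num) k
  · exact wt_le_one (by norm_num) k

/-! ### Multiplication operators on `L²` -/

open Classical in
/-- Multiplication by a bounded measurable function (and `0` for other functions). -/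
noncomputable def mulOp (m : E3 → ℂ) : L2 →L[ℂ] L2 :=
  if h : MemLp m ∞ (volume : Measure E3) then
    (ContinuousLinearMap.lsmul ℂ ℂ).holderL volume ∞ 2 2 (h.toLp m) else 0

theorem mulOp_eq_smul {m : E3 → ℂ} (h : MemLp m ∞ (volume : Measure E3)) (g : L2) :
    mulOp m g = (h.toLp m • g : L2) := by
  rw [mulOp, dif_pos h, ContinuousLinearMap.holderL_apply_apply]
  rfl

theorem coeFn_mulOp {m : E3 → ℂ} (h : MemLp m ∞ (volume : Measure E3)) (g : L2) :
    mulOp m g =ᵐ[volume] fun k => m k * g k := by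
  rw [mulOp_eq_smul h]
  filter_upwards [Lp.coeFn_lpSMul (r := 2) (h.toLp m) g, h.coeFn_toLp] with k h1 h2
  rw [h1, Pi.smul_apply', h2, smul_eq_mul]

theorem norm_mulOp_le {m : E3 → ℂ} {C : ℝ} (hC0 : 0 ≤ C) (hC : ∀ᵐ k, ‖m k‖ ≤ C) (g : L2) :
    ‖mulOp m g‖ ≤ C * ‖g‖ := by
  by_cases h : MemLp m ∞ (volume : Measure E3)
  · refine Lp.norm_le_mul_norm_of_ae_le_mul ?_
    filter_upwards [coeFn_mulOp h g, hC] with k h1 h2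
    rw [h1, norm_mul]
    gcongr
  · rw [mulOp, dif_neg h]
    simp
    positivity

theorem ext_L2 {f g : L2} (h : ∀ᵐ k, f k = g k) : f = g := Lp.ext h

theorem mulOp_mulOp {m n : E3 → ℂ} (hm : MemLp m ∞ (volume : Measure E3))
    (hn : MemLp n ∞ (volume : Measure E3)) (hmn : MemLp (fun k => m k * n k) ∞ (volume : Measure E3))
    (g : L2) : mulOp m (mulOp n g) = mulOp (fun k => m k * n k) g := by
  refine ext_L2 ?_
  filter_upwards [coeFn_mulOp hm (mulOp n g), coeFn_mulOp hn g, coeFn_mulOp hmn g] with k h1 h2 h3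
  rw [h1, h2, h3, mul_assoc]

theorem norm_sq_eq_integral (f : L2) : ((‖f‖ ^ 2 : ℝ) : ℂ) = ∫ k, ((‖f k‖ ^ 2 : ℝ) : ℂ) := by
  have h1 := inner_self_eq_norm_sq_to_K (𝕜 := ℂ) f
  rw [L2.inner_def] at h1
  push_cast
  refine h1.symm.trans (integral_congr_ae (.of_forall fun k => ?_))
  simp [inner_self_eq_norm_sq_to_K]

/-- Dominated convergence with the majorant `(2C)² |g|²`. The convergence of the symbols need not be
uniform in `k`, hence only strong convergence is claimed. -/
theorem tendsto_mulOp {ι : Type*} {l : Filter ι} [l.IsCountablyGenerated] {m : ι → E3 → ℂ}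
    {m₀ : E3 → ℂ} {C : ℝ} (hm : ∀ᶠ i in l, AEStronglyMeasurable (m i) volume)
    (hm₀ : MemLp m₀ ∞ (volume : Measure E3))
    (hC : ∀ᶠ i in l, ∀ᵐ k, ‖m i k‖ ≤ C) (hC₀ : ∀ᵐ k, ‖m₀ k‖ ≤ C)
    (hlim : ∀ᵐ k, Tendsto (fun i => m i k) l (𝓝 (m₀ k))) (g : L2) :
    Tendsto (fun i => mulOp (m i) g) l (𝓝 (mulOp m₀ g)) := by
  rw [tendsto_iff_norm_sub_tendsto_zero]
  have key : Tendsto (fun i => ((‖mulOp (m i) g - mulOp m₀ g‖ ^ 2 : ℝ) : ℂ)) l (𝓝 0) := by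
    have h0 : ∀ᶠ i in l, ∫ k, ((‖(m i k - m₀ k) * g k‖ ^ 2 : ℝ) : ℂ) =
        ((‖mulOp (m i) g - mulOp m₀ g‖ ^ 2 : ℝ) : ℂ) := by
      filter_upwards [hm, hC] with i hi hiC
      rw [norm_sq_eq_integral]
      refine integral_congr_ae ?_
      filter_upwards [coeFn_mulOp (memLp_top_of_bound hi C hiC) g, coeFn_mulOp hm₀ g,
        Lp.coeFn_sub (mulOp (m i) g) (mulOp m₀ g)] with k h1 h2 h3
      rw [h3, Pi.sub_apply, h1, h2, sub_mul]
    refine Tendsto.congr' h0 ?_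
    have h1 : ∫ k : E3, ((‖(0 : ℂ) * g k‖ ^ 2 : ℝ) : ℂ) = 0 := by simp
    rw [← h1]
    refine tendsto_integral_filter_of_dominated_convergence (fun k => (2 * C) ^ 2 * ‖g k‖ ^ 2)
      ?_ ?_ ?_ ?_
    · filter_upwards [hm] with i hi
      exact Complex.continuous_ofReal.comp_aestronglyMeasurable
        (((hi.sub hm₀.1).mul (Lp.aestronglyMeasurable g)).norm.pow 2)
    · filter_upwards [hC] with i hi
      filter_upwards [hi, hC₀] with k h1 h2
      rw [Complex.norm_real, Real.norm_of_nonneg (by positivity), norm_mul, mul_pow]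
      have : ‖m i k - m₀ k‖ ≤ 2 * C := (norm_sub_le _ _).trans (by linarith)
      gcongr
    · exact ((Lp.memLp g).integrable_norm_pow (by norm_num)).const_mul _
    · filter_upwards [hlim] with k hk
      have : Tendsto (fun i => m i k - m₀ k) l (𝓝 0) := by
        simpa using hk.sub_const (m₀ k)
      exact (Complex.continuous_ofReal.tendsto _).comp (((this.mul_const (g k)).norm).pow 2)
  have h2 : Tendsto (fun i => ‖mulOp (m i) g - mulOp m₀ g‖ ^ 2) l (𝓝 0) := by
    have := (Complex.continuous_re.tendsto _).comp key
    simpa [Function.comp_def, ← Complex.ofReal_pow] using this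
  have h3 := h2.sqrt
  simpa using h3

/-- The difference quotients of the symbols converge pointwise and are bounded by `C'` through the
mean value inequality, so `tendsto_mulOp` applies. For that inequality `hd` and `hC'` must hold at
almost every `k` for all times simultaneously. -/
theorem hasDerivWithinAt_mulOp {s : Set ℝ} (hs : Convex ℝ s) {m m' : ℝ → E3 → ℂ} {C C' : ℝ}
    (hm : ∀ t ∈ s, AEStronglyMeasurable (m t) volume) (hC : ∀ t ∈ s, ∀ᵐ k, ‖m t k‖ ≤ C)
    (hm' : ∀ t ∈ s, AEStronglyMeasurable (m' t) volume)
    (hd : ∀ᵐ k, ∀ t ∈ s, HasDerivWithinAt (fun t => m t k) (m' t k) s t)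
    (hC' : ∀ᵐ k, ∀ t ∈ s, ‖m' t k‖ ≤ C') {t : ℝ} (ht : t ∈ s) (g : L2) :
    HasDerivWithinAt (fun t => mulOp (m t) g) (mulOp (m' t) g) s t := by
  rw [hasDerivWithinAt_iff_tendsto_slope]
  have hslope : ∀ᶠ τ in 𝓝[s \ {t}] t,
      mulOp (slope (fun t => m t) t τ) g = slope (fun t => mulOp (m t) g) t τ := by
    filter_upwards [self_mem_nhdsWithin] with τ hτ
    have e1 := memLp_top_of_bound (hm t ht) C (hC t ht)
    have e2 := memLp_top_of_bound (hm τ hτ.1) C (hC τ hτ.1)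
    have e3 : MemLp (slope (fun t => m t) t τ) ∞ (volume : Measure E3) := (e2.sub e1).const_smul _
    refine ext_L2 ?_
    rw [slope_def_module (fun t => mulOp (m t) g)]
    filter_upwards [coeFn_mulOp e1 g, coeFn_mulOp e2 g, coeFn_mulOp e3 g,
      Lp.coeFn_sub (mulOp (m τ) g) (mulOp (m t) g),
      Lp.coeFn_smul (τ - t)⁻¹ (mulOp (m τ) g - mulOp (m t) g)] with k h1 h2 h3 h4 h5
    rw [h3, h5, Pi.smul_apply, h4, Pi.sub_apply, h1, h2, slope_def_module]
    simp only [Pi.smul_apply, Pi.sub_apply, Complex.real_smul]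
    ring
  refine Tendsto.congr' hslope ?_
  refine tendsto_mulOp (C := C') ?_ ?_ ?_ ?_ ?_ g
  · filter_upwards [self_mem_nhdsWithin] with τ hτ
    rw [slope_def_module]
    exact ((hm τ hτ.1).sub (hm t ht)).const_smul _
  · refine memLp_top_of_bound (hm' t ht) C' ?_
    filter_upwards [hC'] with k hk using hk t ht
  · filter_upwards [self_mem_nhdsWithin] with τ hτ
    filter_upwards [hd, hC'] with k h1 h2
    have h3 := hs.norm_image_sub_le_of_norm_hasDerivWithin_le h1 h2 ht hτ.1
    have h4 : τ - t ≠ 0 := sub_ne_zero.2 hτ.2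
    rw [slope_def_module, Pi.smul_apply, Pi.sub_apply, norm_smul, norm_inv]
    rw [inv_mul_le_iff₀ (norm_pos_iff.2 h4), mul_comm]
    exact h3
  · filter_upwards [hC'] with k hk using hk t ht
  · filter_upwards [hd] with k hk
    have := hasDerivWithinAt_iff_tendsto_slope.1 (hk t ht)
    refine this.congr fun τ => ?_
    simp [slope_def_module]

/-! ### The reflection `(C g)(k) = conj (g (-k))` -/

theorem measurePreserving_neg_E3 :
    MeasurePreserving (fun k : E3 => -k) volume volume := Measure.measurePreserving_neg _

/-- The real-linear map `g ↦ (k ↦ conj (g (-k)))`. -/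
noncomputable def conjRefl : L2 →L[ℝ] L2 :=
  (Complex.conjCLE.toContinuousLinearMap.compLpL 2 volume).comp
    (Lp.compMeasurePreservingₗᵢ ℝ (fun k : E3 => -k)
      measurePreserving_neg_E3).toContinuousLinearMap

theorem coeFn_conjRefl (g : L2) : conjRefl g =ᵐ[volume] fun k => conj (g (-k)) := by
  have h1 := ContinuousLinearMap.coeFn_compLpL (p := 2) (μ := (volume : Measure E3))
    Complex.conjCLE.toContinuousLinearMap
    (Lp.compMeasurePreservingₗᵢ ℝ (fun k : E3 => -k) measurePreserving_neg_E3 g)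
  have h2 := Lp.coeFn_compMeasurePreserving g measurePreserving_neg_E3
  filter_upwards [h1, h2] with k h1 h2
  refine h1.trans ?_
  change conj ((Lp.compMeasurePreserving _ measurePreserving_neg_E3 g) k) = _
  rw [h2]
  rfl

theorem ae_neg {p : E3 → Prop} (h : ∀ᵐ k, p k) : ∀ᵐ k, p (-k) :=
  measurePreserving_neg_E3.quasiMeasurePreserving.ae h

theorem conjRefl_conjRefl (g : L2) : conjRefl (conjRefl g) = g := by
  refine ext_L2 ?_
  filter_upwards [coeFn_conjRefl (conjRefl g), ae_neg (coeFn_conjRefl g)] with k h1 h2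
  rw [h1, h2, neg_neg, Complex.conj_conj]

theorem conjRefl_mulOp {m : E3 → ℂ} (h : MemLp m ∞ (volume : Measure E3))
    (heven : ∀ k, m (-k) = m k) (g : L2) :
    conjRefl (mulOp m g) = mulOp (fun k => conj (m k)) (conjRefl g) := by
  refine ext_L2 ?_
  have h' : MemLp (fun k => conj (m k)) ∞ (volume : Measure E3) := h.star
  filter_upwards [coeFn_conjRefl (mulOp m g), ae_neg (coeFn_mulOp h g),
    coeFn_mulOp h' (conjRefl g), coeFn_conjRefl g] with k h1 h2 h3 h4
  rw [h1, h2, h3, h4, map_mul, heven]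

/-! ### Dilations -/

theorem map_smul_volume {r : ℝ} (hr : 0 < r) :
    Measure.map (fun k : E3 => r • k) volume = ENNReal.ofReal (r ^ 3)⁻¹ • volume := by
  have := Measure.map_addHaar_smul (volume : Measure E3) hr.ne'
  rw [this, abs_of_pos (by positivity)]
  simp

theorem quasiMeasurePreserving_smul {r : ℝ} (hr : 0 < r) :
    Measure.QuasiMeasurePreserving (fun k : E3 => r • k) volume volume :=
  ⟨measurable_const_smul r, by
    rw [map_smul_volume hr]
    exact Measure.smul_absolutelyContinuous⟩

/-- The Jacobian `r^(-3)` enters the norm with the power `1/2` and cancels `r^(3/2)`. The case `r =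
(2π)⁻¹` converts frequencies into wave vectors. -/
theorem eLpNorm_dilation {r : ℝ} (hr : 0 < r) (g : L2) :
    eLpNorm (fun k : E3 => ((r ^ (3 / 2 : ℝ) : ℝ) : ℂ) * g (r • k)) 2 volume =
      eLpNorm g 2 volume := by
  have h0 : (fun k : E3 => ((r ^ (3 / 2 : ℝ) : ℝ) : ℂ) * g (r • k)) =
      ((r ^ (3 / 2 : ℝ) : ℝ) : ℂ) • (g ∘ fun k : E3 => r • k) := rfl
  have h1 : eLpNorm (g ∘ fun k : E3 => r • k) 2 volume =
      eLpNorm g 2 (Measure.map (fun k : E3 => r • k) volume) := by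
    refine (eLpNorm_map_measure ?_ (measurable_const_smul r).aemeasurable).symm
    rw [map_smul_volume hr]
    exact (Lp.aestronglyMeasurable g).mono_ac Measure.smul_absolutelyContinuous
  rw [h0, eLpNorm_const_smul, h1, map_smul_volume hr,
    eLpNorm_smul_measure_of_ne_top (by norm_num), smul_eq_mul, ← mul_assoc]
  have h2 : ‖((r ^ (3 / 2 : ℝ) : ℝ) : ℂ)‖ₑ = ENNReal.ofReal (r ^ (3 / 2 : ℝ)) := by
    rw [← ofReal_norm, Complex.norm_real, Real.norm_of_nonneg (by positivity)]
  rw [h2, ENNReal.ofReal_rpow_of_pos (by positivity), ← ENNReal.ofReal_mul (by positivity)]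
  have h3 : r ^ (3 / 2 : ℝ) * (r ^ 3)⁻¹ ^ (1 / (2 : ℝ≥0∞)).toReal = 1 := by
    have : (1 / (2 : ℝ≥0∞)).toReal = 1 / 2 := by simp
    rw [this, ← Real.rpow_natCast r 3, ← Real.rpow_neg hr.le, ← Real.rpow_mul hr.le,
      ← Real.rpow_add hr]
    norm_num
  rw [h3]
  simp

theorem memLp_dilation {r : ℝ} (hr : 0 < r) (g : L2) :
    MemLp (fun k : E3 => ((r ^ (3 / 2 : ℝ) : ℝ) : ℂ) * g (r • k)) 2 volume := by
  refine ⟨aestronglyMeasurable_const.mul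
    ((Lp.aestronglyMeasurable g).comp_quasiMeasurePreserving (quasiMeasurePreserving_smul hr)), ?_⟩
  rw [eLpNorm_dilation hr]
  exact (Lp.memLp g).2

/-- The unitary dilation `g ↦ r^(3/2) g(r ·)` of `L²(ℝ³)`. -/
noncomputable def dil (r : ℝ) (hr : 0 < r) : L2 →ₗᵢ[ℂ] L2 where
  toFun g := (memLp_dilation hr g).toLp _
  map_add' f g := by
    refine ext_L2 ?_
    filter_upwards [(memLp_dilation hr (f + g)).coeFn_toLp, (memLp_dilation hr f).coeFn_toLp,
      (memLp_dilation hr g).coeFn_toLp, Lp.coeFn_add ((memLp_dilation hr f).toLp _)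
        ((memLp_dilation hr g).toLp _),
      (quasiMeasurePreserving_smul hr).ae (Lp.coeFn_add f g)] with k h1 h2 h3 h4 h5
    rw [h1, h4, Pi.add_apply, h2, h3, h5, Pi.add_apply, mul_add]
  map_smul' c g := by
    refine ext_L2 ?_
    filter_upwards [(memLp_dilation hr (c • g)).coeFn_toLp, (memLp_dilation hr g).coeFn_toLp,
      Lp.coeFn_smul c ((memLp_dilation hr g).toLp _),
      (quasiMeasurePreserving_smul hr).ae (Lp.coeFn_smul c g)] with k h1 h2 h3 h4
    rw [h1, RingHom.id_apply, h3, Pi.smul_apply, h2, h4, Pi.smul_apply, smul_eq_mul, smul_eq_mul]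
    ring
  norm_map' g := by
    change ‖(memLp_dilation hr g).toLp _‖ = _
    rw [Lp.norm_toLp, eLpNorm_dilation hr, Lp.norm_def]

theorem coeFn_dil {r : ℝ} (hr : 0 < r) (g : L2) :
    dil r hr g =ᵐ[volume] fun k => ((r ^ (3 / 2 : ℝ) : ℝ) : ℂ) * g (r • k) :=
  (memLp_dilation hr g).coeFn_toLp

theorem dil_surjective {r : ℝ} (hr : 0 < r) : Function.Surjective (dil r hr) := by
  intro g
  refine ⟨dil r⁻¹ (inv_pos.2 hr) g, ext_L2 ?_⟩
  filter_upwards [coeFn_dil hr (dil r⁻¹ (inv_pos.2 hr) g),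
    (quasiMeasurePreserving_smul hr).ae (coeFn_dil (inv_pos.2 hr) g)] with k h1 h2
  rw [h1, h2, smul_smul, inv_mul_cancel₀ hr.ne', one_smul, ← mul_assoc, ← Complex.ofReal_mul,
    Real.inv_rpow hr.le, mul_inv_cancel₀ (by positivity)]
  simp

theorem conjRefl_dil {r : ℝ} (hr : 0 < r) (g : L2) :
    conjRefl (dil r hr g) = dil r hr (conjRefl g) := by
  refine ext_L2 ?_
  filter_upwards [coeFn_conjRefl (dil r hr g), ae_neg (coeFn_dil hr g), coeFn_dil hr (conjRefl g),
    (quasiMeasurePreserving_smul hr).ae (coeFn_conjRefl g)] with k h1 h2 h3 h4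
  rw [h1, h2, h3, h4, map_mul, Complex.conj_ofReal, smul_neg]

theorem dil_mulOp {r : ℝ} (hr : 0 < r) {m : E3 → ℂ} (hm : MemLp m ∞ (volume : Measure E3))
    (hm' : MemLp (fun k => m (r • k)) ∞ (volume : Measure E3)) (g : L2) :
    dil r hr (mulOp m g) = mulOp (fun k => m (r • k)) (dil r hr g) := by
  refine ext_L2 ?_
  filter_upwards [coeFn_dil hr (mulOp m g), (quasiMeasurePreserving_smul hr).ae (coeFn_mulOp hm g),
    coeFn_mulOp hm' (dil r hr g), coeFn_dil hr g] with k h1 h2 h3 h4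
  rw [h1, h2, h3, h4]
  ring

/-! ### Sobolev spaces on the Fourier side -/

/-- The weight `(1 + |ξ|²)^(s/2)`. -/
noncomputable def jap (s : ℝ) : E3 → ℂ := fun x => (((1 + ‖x‖ ^ 2) ^ (s / 2) : ℝ) : ℂ)

theorem jap_temperate (s : ℝ) : (jap s).HasTemperateGrowth := by
  unfold jap
  fun_prop

theorem jap_mul (s r : ℝ) : jap s * jap r = jap (s + r) := by
  funext x
  simp only [jap, Pi.mul_apply]
  rw [← Complex.ofReal_mul, ← Real.rpow_add (by positivity)]
  congr 2
  ring

theorem jap_zero : jap 0 = fun _ => 1 := by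
  funext x
  simp [jap]

theorem conj_jap (s : ℝ) (x : E3) : conj (jap s x) = jap s x := Complex.conj_ofReal _

theorem jap_neg_arg (s : ℝ) (x : E3) : jap s (-x) = jap s x := by simp [jap]

theorem memLp_jap {s : ℝ} (hs : s ≤ 0) : MemLp (jap s) ∞ (volume : Measure E3) := by
  refine memLp_top_of_bound (jap_temperate s).1.continuous.aestronglyMeasurable 1
    (.of_forall fun x => ?_)
  rw [jap, Complex.norm_real, Real.norm_of_nonneg (by positivity)]
  exact Real.rpow_le_one_of_one_le_of_nonpos (by simp) (by linarith)

local notation "TD" => Lp.toTemperedDistributionCLM ℂ (volume : Measure E3) 2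

theorem smulLeft_jap_jap (s r : ℝ) (u : 𝓢'(E3, ℂ)) :
    TemperedDistribution.smulLeftCLM ℂ (jap r) (TemperedDistribution.smulLeftCLM ℂ (jap s) u) =
      TemperedDistribution.smulLeftCLM ℂ (jap (s + r)) u := by
  rw [TemperedDistribution.smulLeftCLM_smulLeftCLM_apply (jap_temperate s) (jap_temperate r),
    jap_mul]

theorem smulLeft_jap_zero (u : 𝓢'(E3, ℂ)) :
    TemperedDistribution.smulLeftCLM ℂ (jap 0) u = u := by
  rw [jap_zero, TemperedDistribution.smulLeftCLM_const, one_smul]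

theorem fourier_TD (g : L2) : 𝓕 (TD g) = TD (𝓕 g) := Lp.fourier_toTemperedDistribution_eq g

theorem TD_mulOp {m : E3 → ℂ} (hm : m.HasTemperateGrowth)
    (hm' : MemLp m ∞ (volume : Measure E3)) (g : L2) :
    TD (mulOp m g) = TemperedDistribution.smulLeftCLM ℂ m (TD g) := by
  rw [mulOp_eq_smul hm']
  exact Lp.toTemperedDistribution_smul_eq hm hm' g

/-- The Fourier transform of the Bessel potential of `u`. -/
noncomputable def Sob.phi {s : ℝ} (u : Sob s) : L2 := 𝓕 u.bessel

theorem Sob.fourier_dist {s : ℝ} (u : Sob s) :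
    𝓕 u.dist = TemperedDistribution.smulLeftCLM ℂ (jap (-s)) (TD u.phi) := by
  have h1 : TD u.phi = TemperedDistribution.smulLeftCLM ℂ (jap s) (𝓕 u.dist) := by
    rw [phi, ← fourier_TD, ← u.bessel_spec]
    exact TemperedDistribution.fourier_besselPotential_eq_smulLeftCLM_fourier_apply s u.dist
  rw [h1, smulLeft_jap_jap, add_neg_cancel, smulLeft_jap_zero]

/-- Multiplication by `jap (-s)` is invertible on tempered distributions and `L²` embeds injectively
in them; this is the tool for computing `phi`. -/
theorem Sob.phi_eq {s : ℝ} {u : Sob s} {g : L2}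
    (h : 𝓕 u.dist = TemperedDistribution.smulLeftCLM ℂ (jap (-s)) (TD g)) : u.phi = g := by
  rw [u.fourier_dist] at h
  have h1 := congrArg (TemperedDistribution.smulLeftCLM ℂ (jap s)) h
  rw [smulLeft_jap_jap, smulLeft_jap_jap, neg_add_cancel, smulLeft_jap_zero,
    smulLeft_jap_zero] at h1
  exact toDist_injective h1

theorem pairing_eq (a : ℝ) (g : L2) (φ : 𝓢(E3, ℂ)) :
    𝓕⁻ (TemperedDistribution.smulLeftCLM ℂ (jap a) (TD g)) φ =
      ∫ x, jap a x * (𝓕⁻ φ) x * g x := by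
  rw [TemperedDistribution.fourierInv_apply, TemperedDistribution.smulLeftCLM_apply_apply,
    Lp.toTemperedDistributionCLM_apply, Lp.toTemperedDistribution_apply]
  refine integral_congr_ae (.of_forall fun x => ?_)
  simp only [SchwartzMap.smulLeftCLM_apply_apply (jap_temperate a), smul_eq_mul]

theorem conj_fourierInv_of_real {φ : 𝓢(E3, ℂ)} (hφ : ∀ x, (φ x).im = 0) (x : E3) :
    conj ((𝓕⁻ φ) x) = (𝓕⁻ φ) (-x) := by
  rw [SchwartzMap.fourierInv_coe, Real.fourierInv_eq', Real.fourierInv_eq', ← integral_conj]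
  refine integral_congr_ae (.of_forall fun y => ?_)
  have h : conj (φ y) = φ y := Complex.conj_eq_iff_im.2 (hφ y)
  simp only [smul_eq_mul, map_mul, h, ← Complex.exp_conj, Complex.conj_ofReal, Complex.conj_I,
    inner_neg_right]
  push_cast
  ring_nf

/-- The weight is real and even, and conjugating the transform of a real test function reflects its
argument; the substitution `x ↦ -x` moves both operations onto `g`. -/
theorem conj_pairing (a : ℝ) (g : L2) {φ : 𝓢(E3, ℂ)} (hφ : ∀ x, (φ x).im = 0) :
    conj (𝓕⁻ (TemperedDistribution.smulLeftCLM ℂ (jap a) (TD g)) φ) =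
      𝓕⁻ (TemperedDistribution.smulLeftCLM ℂ (jap a) (TD (conjRefl g))) φ := by
  rw [pairing_eq, pairing_eq, ← integral_conj,
    ← integral_neg_eq_self (fun x => jap a x * (𝓕⁻ φ : 𝓢(E3, ℂ)) x * conjRefl g x) volume]
  refine integral_congr_ae ?_
  filter_upwards [ae_neg (coeFn_conjRefl g)] with x hx
  rw [hx, neg_neg, map_mul, map_mul, conj_jap, conj_fourierInv_of_real hφ, jap_neg_arg]

theorem eq_zero_of_real {u : 𝓢'(E3, ℂ)} (h : ∀ φ : 𝓢(E3, ℂ), (∀ x, (φ x).im = 0) → u φ = 0) :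
    u = 0 := by
  ext φ
  set a : 𝓢(E3, ℂ) := φ.postcompCLM (Complex.ofRealCLM.comp Complex.reCLM)
  set b : 𝓢(E3, ℂ) := φ.postcompCLM (Complex.ofRealCLM.comp Complex.imCLM)
  have h1 : φ = a + Complex.I • b := by
    ext x
    simp only [_root_.add_apply, _root_.smul_apply, smul_eq_mul, a, b,
      SchwartzMap.postcompCLM_apply]
    simp [mul_comm Complex.I]
  have ha : u a = 0 := h a fun x => by simp [a, SchwartzMap.postcompCLM_apply]
  have hb : u b = 0 := h b fun x => by simp [b, SchwartzMap.postcompCLM_apply]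
  rw [h1, map_add, map_smul, ha, hb]
  simp

theorem fourierInv_smulLeft_injective (a : ℝ) {g : L2}
    (h : 𝓕⁻ (TemperedDistribution.smulLeftCLM ℂ (jap a) (TD g)) = 0) : g = 0 := by
  have h1 := congrArg (fun u : 𝓢'(E3, ℂ) => TemperedDistribution.smulLeftCLM ℂ (jap (-a)) (𝓕 u)) h
  simp only [FourierTransform.fourier_fourierInv_eq] at h1
  rw [smulLeft_jap_jap, add_neg_cancel, smulLeft_jap_zero] at h1
  apply toDist_injective
  rw [h1, map_zero]
  ext φ
  simp

/-- By `conj_pairing`, reality means that the distributions of `g` and `conjRefl g` agree on real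
test functions. These determine a distribution (`eq_zero_of_real`), which in turn determines `g`. -/
theorem isReal_iff (a : ℝ) (g : L2) :
    IsReal (𝓕⁻ (TemperedDistribution.smulLeftCLM ℂ (jap a) (TD g))) ↔ conjRefl g = g := by
  constructor
  · intro h
    rw [eq_comm, ← sub_eq_zero]
    apply fourierInv_smulLeft_injective a
    apply eq_zero_of_real
    intro φ hφ
    have h1 := conj_pairing a g hφ
    rw [Complex.conj_eq_iff_im.2 (h φ hφ)] at h1
    have h2 : 𝓕⁻ (TemperedDistribution.smulLeftCLM ℂ (jap a) (TD (g - conjRefl g))) =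
        𝓕⁻ (TemperedDistribution.smulLeftCLM ℂ (jap a) (TD g)) -
        𝓕⁻ (TemperedDistribution.smulLeftCLM ℂ (jap a) (TD (conjRefl g))) := by
      rw [map_sub, map_sub]
      exact map_sub (FourierTransform.fourierInvCLM ℂ 𝓢'(E3, ℂ)) _ _
    rw [h2]
    exact sub_eq_zero.2 h1
  · intro h φ hφ
    have h1 := conj_pairing a g hφ
    rw [h] at h1
    exact Complex.conj_eq_iff_im.1 h1

theorem Sob.dist_eq {s : ℝ} (u : Sob s) :
    u.dist = 𝓕⁻ (TemperedDistribution.smulLeftCLM ℂ (jap (-s)) (TD u.phi)) := by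
  rw [← u.fourier_dist, FourierTransform.fourierInv_fourier_eq]

theorem Sob.conjRefl_phi {s : ℝ} (u : Sob s) : conjRefl u.phi = u.phi := by
  rw [← isReal_iff (-s), ← u.dist_eq]
  exact u.2.1

theorem exists_sob_phi (s : ℝ) {g : L2} (hg : conjRefl g = g) : ∃ u : Sob s, u.phi = g := by
  refine ⟨⟨𝓕⁻ (TemperedDistribution.smulLeftCLM ℂ (jap (-s)) (TD g)), (isReal_iff _ _).2 hg, ?_⟩, ?_⟩
  · rw [TemperedDistribution.memSobolev_iff_exists_smulLeftCLM_fourier]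
    refine ⟨g, ?_⟩
    rw [FourierTransform.fourier_fourierInv_eq]
    have := smulLeft_jap_jap (-s) s (TD g)
    rw [neg_add_cancel, smulLeft_jap_zero] at this
    exact this
  · apply Sob.phi_eq
    exact FourierTransform.fourier_fourierInv_eq _

theorem two_pi_inv_pos : 0 < (2 * Real.pi)⁻¹ := by positivity

/-- The map `u ↦ (1 + |k/2π|²)^(s/2) ũ(k)`, an isometry of `H^s` into `L²`. -/
noncomputable def Psi (s : ℝ) : Sob s →ₗᵢ[ℝ] L2 where
  toFun u := dil _ two_pi_inv_pos u.phi
  map_add' u v := by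
    rw [Sob.phi, map_add, FourierTransform.fourier_add, map_add]
    rfl
  map_smul' c u := by
    have h1 : Sob.bessel (c • u) = (c : ℂ) • u.bessel := map_smul _ _ _
    rw [Sob.phi, h1, FourierTransform.fourier_smul, map_smul]
    rfl
  norm_map' u := by
    change ‖dil _ two_pi_inv_pos u.phi‖ = ‖u‖
    rw [LinearIsometry.norm_map, Sob.phi, Lp.norm_fourier_eq]
    rfl

theorem Psi_apply {s : ℝ} (u : Sob s) : Psi s u = dil _ two_pi_inv_pos u.phi := rfl

theorem conjRefl_Psi {s : ℝ} (u : Sob s) : conjRefl (Psi s u) = Psi s u := by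
  rw [Psi_apply, conjRefl_dil, u.conjRefl_phi]

theorem exists_Psi_eq (s : ℝ) {g : L2} (hg : conjRefl g = g) : ∃ u : Sob s, Psi s u = g := by
  obtain ⟨f, rfl⟩ := dil_surjective two_pi_inv_pos g
  rw [conjRefl_dil] at hg
  obtain ⟨u, hu⟩ := exists_sob_phi s ((dil _ two_pi_inv_pos).injective hg)
  exact ⟨u, by rw [Psi_apply, hu]⟩

/-- The factor `r^(3/2)` of the unitary dilation, at `r = (2π)⁻¹`, is exactly the prefactor
`(2π)^(-3/2)` of the transform. -/
theorem Sob.fourier_ae_eq {s : ℝ} (u : Sob s) :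
    u.fourier =ᵐ[volume] fun k => (wt (-s) k : ℂ) * Psi s u k := by
  filter_upwards [coeFn_dil two_pi_inv_pos u.phi] with k hk
  rw [Psi_apply, hk, fourier, wt, phi, ← mul_assoc, ← Complex.ofReal_mul, mul_comm ((2 * Real.pi) ^ _),
    Real.inv_rpow (by positivity), Real.rpow_neg (by positivity) (3 / 2), neg_div]

theorem Sob.dist_eq_val {s : ℝ} (u : Sob s) : u.dist = u.1 := rfl

theorem Sob.dist_incl {s r : ℝ} (h : r ≤ s) (u : Sob s) : (Sob.incl h u).dist = u.dist := by
  rw [Sob.dist_eq_val (Sob.incl h u), Sob.incl]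

theorem Sob.dist_lap {s r : ℝ} (h : r ≤ s - 2) (u : Sob s) : (Sob.lap h u).dist = Δ u.dist := rfl

theorem memLp_wt {s : ℝ} (hs : s ≤ 0) :
    MemLp (fun k => (wt s k : ℂ)) ∞ (volume : Measure E3) := by
  refine memLp_top_of_bound (Complex.continuous_ofReal.comp
    (continuous_wt s)).aestronglyMeasurable 1 (.of_forall fun k => ?_)
  rw [Complex.norm_real, Real.norm_of_nonneg (wt_pos _ _).le]
  exact wt_le_one hs k

theorem wt_eq_jap (s : ℝ) :
    (fun k => (wt s k : ℂ)) = fun k => jap s ((2 * Real.pi)⁻¹ • k) := rfl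

theorem Sob.phi_incl {s r : ℝ} (h : r ≤ s) (u : Sob s) :
    (Sob.incl h u).phi = mulOp (jap (r - s)) u.phi := by
  apply Sob.phi_eq
  rw [TD_mulOp (jap_temperate _) (memLp_jap (by linarith)), smulLeft_jap_jap, Sob.dist_incl,
    u.fourier_dist, show r - s + -r = -s by ring]

theorem Psi_incl {s r : ℝ} (h : r ≤ s) (u : Sob s) :
    Psi r (Sob.incl h u) = mulOp (fun k => (wt (r - s) k : ℂ)) (Psi s u) := by
  rw [Psi_apply, Sob.phi_incl, dil_mulOp two_pi_inv_pos (memLp_jap (by linarith)), Psi_apply,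
    wt_eq_jap]
  rw [← wt_eq_jap]
  exact memLp_wt (by linarith)

theorem norm_incl_le {s r : ℝ} (h : r ≤ s) (u : Sob s) : ‖Sob.incl h u‖ ≤ ‖u‖ := by
  rw [← (Psi r).norm_map, ← (Psi s).norm_map, Psi_incl]
  refine (norm_mulOp_le zero_le_one (.of_forall fun k => ?_) _).trans (one_mul _).le
  rw [Complex.norm_real, Real.norm_of_nonneg (wt_pos _ _).le]
  exact wt_le_one (by linarith) k

/-- The inclusion `H^s ⊆ H^r`, as a continuous linear map. -/
noncomputable def inclCLM {s r : ℝ} (h : r ≤ s) : Sob s →L[ℝ] Sob r :=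
  LinearMap.mkContinuous
    { toFun := Sob.incl h
      map_add' := fun u v => by
        apply Sob.dist_injective
        rw [map_add, Sob.dist_incl, Sob.dist_incl, Sob.dist_incl, map_add]
      map_smul' := fun c u => by
        apply Sob.dist_injective
        rw [map_smul, Sob.dist_incl, Sob.dist_incl, map_smul, RingHom.id_apply] } 1
    fun u => (norm_incl_le h u).trans (one_mul _).ge

theorem memLp_lap_symbol :
    MemLp (fun k : E3 => ((-(‖k‖ ^ 2 * wt (-2) k) : ℝ) : ℂ)) ∞ (volume : Measure E3) := by
  refine memLp_top_of_bound (Complex.continuous_ofReal.comp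
    (((continuous_norm.pow 2).mul (continuous_wt _)).neg)).aestronglyMeasurable 40
    (.of_forall fun k => ?_)
  rw [Complex.norm_real, norm_neg, Real.norm_of_nonneg (mul_nonneg (sq_nonneg _) (wt_pos _ _).le)]
  exact norm_sq_mul_wt_le k

theorem Psi_lap {s r : ℝ} (h : r ≤ s - 2) (hr : r = s - 2) (u : Sob s) :
    Psi r (Sob.lap h u) = mulOp (fun k => ((-(‖k‖ ^ 2 * wt (-2) k) : ℝ) : ℂ)) (Psi s u) := by
  -- In the frequency variable `x = k / 2π` the Laplacian has the symbol `-(2π)² |x|²`.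
  have e : (fun k : E3 => ((-(‖k‖ ^ 2 * wt (-2) k) : ℝ) : ℂ)) = fun k : E3 =>
      (fun x : E3 => ((-(2 * Real.pi) ^ 2 : ℝ) : ℂ) * (((‖x‖ ^ 2 : ℝ) : ℂ) * jap (-2) x))
        ((2 * Real.pi)⁻¹ • k) := by
    funext k
    simp only [wt, jap]
    rw [norm_smul, Real.norm_of_nonneg two_pi_inv_pos.le, mul_pow, inv_pow]
    have : (2 * Real.pi) ^ 2 ≠ 0 := by positivity
    push_cast
    have h2 : ((2 : ℂ) * Real.pi) ^ 2 ≠ 0 := by exact_mod_cast this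
    rw [mul_assoc, ← mul_assoc (((2 : ℂ) * Real.pi) ^ 2)⁻¹, ← neg_mul_eq_neg_mul]
    field_simp
  have hm : MemLp (fun x : E3 => ((-(2 * Real.pi) ^ 2 : ℝ) : ℂ) *
      (((‖x‖ ^ 2 : ℝ) : ℂ) * jap (-2) x)) ∞ (volume : Measure E3) := by
    have hc : Continuous (fun x : E3 => ((-(2 * Real.pi) ^ 2 : ℝ) : ℂ) *
      (((‖x‖ ^ 2 : ℝ) : ℂ) * jap (-2) x)) := by
      have := (jap_temperate (-2)).1.continuous
      fun_prop
    refine memLp_top_of_bound hc.aestronglyMeasurable 40 (.of_forall fun x => ?_)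
    have h1 := congrFun e ((2 * Real.pi) • x)
    simp only [smul_smul] at h1
    rw [inv_mul_cancel₀ (by positivity), one_smul] at h1
    rw [← h1, Complex.norm_real, norm_neg,
      Real.norm_of_nonneg (mul_nonneg (sq_nonneg _) (wt_pos _ _).le)]
    exact norm_sq_mul_wt_le _
  have ht : (fun x : E3 => ((-(2 * Real.pi) ^ 2 : ℝ) : ℂ) *
      (((‖x‖ ^ 2 : ℝ) : ℂ) * jap (-2) x)).HasTemperateGrowth := by
    have := jap_temperate (-2)
    fun_prop
  have hN : (fun x : E3 => ((‖x‖ ^ 2 : ℝ) : ℂ)).HasTemperateGrowth := by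
    fun_prop
  have h1 : (Sob.lap h u).phi = mulOp (fun x : E3 => ((-(2 * Real.pi) ^ 2 : ℝ) : ℂ) *
      (((‖x‖ ^ 2 : ℝ) : ℂ) * jap (-2) x)) u.phi := by
    apply Sob.phi_eq
    rw [TD_mulOp ht hm, TemperedDistribution.smulLeftCLM_smulLeftCLM_apply ht (jap_temperate _)]
    rw [Sob.dist_lap, TemperedDistribution.laplacian_eq_fourierMultiplierCLM,
      TemperedDistribution.fourierMultiplierCLM_apply, ← Complex.coe_smul,
      FourierTransform.fourier_smul, FourierTransform.fourier_fourierInv_eq, u.fourier_dist,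
      TemperedDistribution.smulLeftCLM_smulLeftCLM_apply (jap_temperate _) hN,
      ← _root_.smul_apply, ← TemperedDistribution.smulLeftCLM_smul ((jap_temperate _).mul hN)]
    congr 2
    funext x
    have h3 : jap (-2) x * jap (-r) x = jap (-s) x := by
      have := congrFun (jap_mul (-2) (-r)) x
      rw [Pi.mul_apply] at this
      rw [this, hr]
      congr 1
      ring
    simp only [Pi.smul_apply, Pi.mul_apply, smul_eq_mul]
    rw [← h3]
    ring
  rw [Psi_apply, h1, e, dil_mulOp two_pi_inv_pos hm, Psi_apply]
  rw [← e]
  exact memLp_lap_symbol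

/-! ### Sections of the Fourier representation -/

/-- `g + C g` is fixed by the involution `C`, hence comes from a real distribution. With `g = v ψ`
this is the mode expansion of a real field. -/
theorem exists_Psi_eq_add_conjRefl (s : ℝ) (g : L2) : ∃ u : Sob s, Psi s u = g + conjRefl g :=
  exists_Psi_eq s (by rw [map_add, conjRefl_conjRefl, add_comm])

/-- The element of `H^s` whose weighted Fourier transform is `g + C g`. -/
noncomputable def liftFun (s : ℝ) (g : L2) : Sob s := (exists_Psi_eq_add_conjRefl s g).choose

theorem Psi_liftFun (s : ℝ) (g : L2) : Psi s (liftFun s g) = g + conjRefl g :=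
  (exists_Psi_eq_add_conjRefl s g).choose_spec

/-- The map `liftFun` as a continuous linear map. -/
noncomputable def lift (s : ℝ) : L2 →L[ℝ] Sob s :=
  LinearMap.mkContinuous
    { toFun := liftFun s
      map_add' := fun f g => by
        apply (Psi s).injective
        rw [map_add, Psi_liftFun, Psi_liftFun, Psi_liftFun, map_add]
        abel
      map_smul' := fun c g => by
        apply (Psi s).injective
        rw [map_smul, Psi_liftFun, RingHom.id_apply, Psi_liftFun, map_smul, smul_add] }
    (1 + ‖conjRefl‖) fun g => by
      rw [← (Psi s).norm_map]
      refine (congrArg norm (Psi_liftFun s g)).trans_le ?_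
      rw [add_mul, one_mul]
      exact (norm_add_le _ _).trans (by gcongr; exact conjRefl.le_opNorm g)

theorem Psi_lift (s : ℝ) (g : L2) : Psi s (lift s g) = g + conjRefl g := Psi_liftFun s g

/-! ### The maps `K_t` and their inverses -/

/-- The symbol with which `K_t` acts on the first Cauchy datum. -/
noncomputable def symAlpha (R m t : ℝ) (k : E3) : ℂ :=
  R / (wronskianConst R m * t ^ 3) * conj (symB R m t k)

/-- The symbol with which `K_t` acts on the second Cauchy datum. -/
noncomputable def symBeta (R m t : ℝ) (k : E3) : ℂ :=
  -(R / (wronskianConst R m * t ^ 3)) * conj (symA R m t k)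

section symbols

variable {R m : ℝ} (hR : 0 < R) (hm : 3 / 2 < m * R)
include hR hm

theorem memLp_symA {t : ℝ} (ht : 1 ≤ t) : MemLp (symA R m t) ∞ (volume : Measure E3) := by
  obtain ⟨C, -, h⟩ := exists_sym_bound hR hm ht
  refine memLp_top_of_bound (aestronglyMeasurable_symA R m (by linarith)) C ?_
  filter_upwards [ae_ne_zero] with k hk using (h t ⟨ht, le_rfl⟩ k hk).1

theorem memLp_symB {t : ℝ} (ht : 1 ≤ t) : MemLp (symB R m t) ∞ (volume : Measure E3) := by
  obtain ⟨C, -, h⟩ := exists_sym_bound hR hm ht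
  refine memLp_top_of_bound (aestronglyMeasurable_symB R m (by linarith)) C ?_
  filter_upwards [ae_ne_zero] with k hk using (h t ⟨ht, le_rfl⟩ k hk).2

theorem memLp_symAlpha {t : ℝ} (ht : 1 ≤ t) : MemLp (symAlpha R m t) ∞ (volume : Measure E3) :=
  (memLp_symB hR hm ht).star.const_mul _

theorem memLp_symBeta {t : ℝ} (ht : 1 ≤ t) : MemLp (symBeta R m t) ∞ (volume : Measure E3) :=
  (memLp_symA hR hm ht).star.const_mul _

/-- Cramer's rule for the matrix with columns `(a, b)` and `(conj a, conj b)`, whose determinant is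
the Wronskian. The first two identities give `K_t K_t⁻¹ = 1`, the other four `K_t⁻¹ K_t = 1`; the
constant of the Wronskian is imaginary, so conjugation changes its sign. -/
theorem symbol_identities {t : ℝ} (ht : 0 < t) {k : E3} (hk : k ≠ 0) :
    symAlpha R m t k * symA R m t k + symBeta R m t k * symB R m t k = 1 ∧
    symAlpha R m t k * conj (symA R m t k) + symBeta R m t k * conj (symB R m t k) = 0 ∧
    symA R m t k * symAlpha R m t k + conj (symA R m t k * symAlpha R m t k) = 1 ∧
    symA R m t k * symBeta R m t k + conj (symA R m t k * symBeta R m t k) = 0 ∧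
    symB R m t k * symAlpha R m t k + conj (symB R m t k * symAlpha R m t k) = 0 ∧
    symB R m t k * symBeta R m t k + conj (symB R m t k * symBeta R m t k) = 1 := by
  have h := symA_symB_wronskian hR m ht hk
  have hc := wronskianConst_ne_zero hm
  have hcc := conj_wronskianConst R m
  have ht' : (t : ℂ) ≠ 0 := by exact_mod_cast ht.ne'
  have hR' : (R : ℂ) ≠ 0 := by exact_mod_cast hR.ne'
  simp only [symAlpha, symBeta, map_mul, map_neg, map_div₀, Complex.conj_conj, Complex.conj_ofReal,
    hcc, map_pow]
  generalize symA R m t k = a at *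
  generalize symB R m t k = b at *
  have h' : R / (wronskianConst R m * t ^ 3) * (a * conj b - conj a * b) = 1 := by
    rw [h]
    field_simp
  generalize wronskianConst R m = c at *
  have e : (R : ℂ) / (-c * t ^ 3) = -(R / (c * t ^ 3)) := by
    rw [neg_mul, div_neg]
  rw [e]
  generalize (R : ℂ) / (c * t ^ 3) = d at *
  refine ⟨?_, ?_, ?_, ?_, ?_, ?_⟩
  · linear_combination h'
  · ring
  · linear_combination h'
  · ring
  · ring
  · linear_combination h'

theorem coeff_ae_eq {t : ℝ} (ht : 1 ≤ t) (F : Data) : coeff R m t F =ᵐ[volume] fun k =>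
    symAlpha R m t k * Psi (1 / 2) F.1 k + symBeta R m t k * Psi (-1 / 2) F.2 k := by
  have ht0 : 0 < t := by linarith
  have hc := wronskianConst_ne_zero hm
  have ht' : (t : ℂ) ≠ 0 := by exact_mod_cast ht0.ne'
  have hR' : (R : ℂ) ≠ 0 := by exact_mod_cast hR.ne'
  filter_upwards [F.1.fourier_ae_eq, F.2.fourier_ae_eq, ae_ne_zero] with k h1 h2 hk
  rw [coeff, wronskian_eq R m ht0 (norm_pos_iff.2 hk), Matrix.det_fin_two_of, h1, h2]
  simp only [symAlpha, symBeta, symA, symB, map_mul, Complex.conj_ofReal]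
  rw [show (-(-1 / 2) : ℝ) = 1 / 2 by norm_num, show (-(1 / 2) : ℝ) = -1 / 2 by norm_num]
  push_cast
  generalize wt (-1 / 2) k = w at *
  field_simp
  ring

end symbols

/-- The map `K_t` as a continuous linear map. -/
noncomputable def KCLM (R m t : ℝ) : Data →L[ℝ] L2 :=
  ((mulOp (symAlpha R m t)).restrictScalars ℝ ∘L (Psi (1 / 2)).toContinuousLinearMap ∘L
    ContinuousLinearMap.fst ℝ _ _) +
  ((mulOp (symBeta R m t)).restrictScalars ℝ ∘L (Psi (-1 / 2)).toContinuousLinearMap ∘L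
    ContinuousLinearMap.snd ℝ _ _)

theorem KCLM_apply (R m t : ℝ) (F : Data) : KCLM R m t F =
    mulOp (symAlpha R m t) (Psi (1 / 2) F.1) + mulOp (symBeta R m t) (Psi (-1 / 2) F.2) := rfl

/-- The map `K_t⁻¹` as a continuous linear map. -/
noncomputable def KinvCLM (R m t : ℝ) : L2 →L[ℝ] Data :=
  ((lift (1 / 2)) ∘L (mulOp (symA R m t)).restrictScalars ℝ).prod
    ((lift (-1 / 2)) ∘L (mulOp (symB R m t)).restrictScalars ℝ)

theorem KinvCLM_apply (R m t : ℝ) (ψ : L2) : KinvCLM R m t ψ =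
    (lift (1 / 2) (mulOp (symA R m t) ψ), lift (-1 / 2) (mulOp (symB R m t) ψ)) := rfl

theorem Psi_lift_mulOp_ae (s : ℝ) {a : E3 → ℂ} (ha : MemLp a ∞ (volume : Measure E3)) (ψ : L2) :
    Psi s (lift s (mulOp a ψ)) =ᵐ[volume] fun k =>
      a k * ψ k + conj (a (-k)) * conjRefl ψ k := by
  rw [Psi_lift]
  filter_upwards [Lp.coeFn_add (mulOp a ψ) (conjRefl (mulOp a ψ)), coeFn_mulOp ha ψ,
    ae_neg (coeFn_mulOp ha ψ), coeFn_conjRefl (mulOp a ψ), coeFn_conjRefl ψ] with k h1 h2 h3 h4 h5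
  rw [h1, Pi.add_apply, h2, h4, h3, h5, map_mul]

theorem continuousAt_symA {R : ℝ} (hR : 0 < R) (m : ℝ) {t : ℝ} (ht : 0 < t) {k : E3} (hk : k ≠ 0) :
    ContinuousAt (fun τ => symA R m τ k) t := by
  have h1 := ((hasDerivAt_symA hR m ht hk).continuousAt).const_mul (wt 1 k : ℂ)
  refine h1.congr (.of_forall fun τ => ?_)
  dsimp only
  rw [← mul_assoc, ← Complex.ofReal_mul, wt_mul]
  simp

section inverse

variable {R m : ℝ} (hR : 0 < R) (hm : 3 / 2 < m * R)
include hR hm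

theorem coeFn_KCLM {t : ℝ} (ht : 1 ≤ t) (F : Data) : KCLM R m t F =ᵐ[volume] fun k =>
    symAlpha R m t k * Psi (1 / 2) F.1 k + symBeta R m t k * Psi (-1 / 2) F.2 k := by
  rw [KCLM_apply]
  filter_upwards [Lp.coeFn_add (mulOp (symAlpha R m t) (Psi (1 / 2) F.1))
    (mulOp (symBeta R m t) (Psi (-1 / 2) F.2)), coeFn_mulOp (memLp_symAlpha hR hm ht) (Psi _ F.1),
    coeFn_mulOp (memLp_symBeta hR hm ht) (Psi _ F.2)] with k h1 h2 h3
  rw [h1, Pi.add_apply, h2, h3]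

theorem memLp_coeff {t : ℝ} (ht : 1 ≤ t) (F : Data) : MemLp (coeff R m t F) 2 volume :=
  (Lp.memLp (KCLM R m t F)).ae_eq ((coeFn_KCLM hR hm ht F).trans (coeff_ae_eq hR hm ht F).symm)

theorem K_eq {t : ℝ} (ht : 1 ≤ t) (F : Data) : K R m t F = KCLM R m t F := by
  rw [K, dif_pos (memLp_coeff hR hm ht F)]
  refine ext_L2 ?_
  filter_upwards [(memLp_coeff hR hm ht F).coeFn_toLp, coeFn_KCLM hR hm ht F,
    coeff_ae_eq hR hm ht F] with k h1 h2 h3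
  rw [h1, h2, h3]

/-- `K_t` applied to `(a ψ + conj a C ψ, b ψ + conj b C ψ)` has the coefficient `1` at `ψ` and `0`
at `C ψ`. -/
theorem KCLM_KinvCLM {t : ℝ} (ht : 1 ≤ t) (ψ : L2) : KCLM R m t (KinvCLM R m t ψ) = ψ := by
  refine ext_L2 ?_
  filter_upwards [coeFn_KCLM hR hm ht (KinvCLM R m t ψ),
    Psi_lift_mulOp_ae (1 / 2) (memLp_symA hR hm ht) ψ,
    Psi_lift_mulOp_ae (-1 / 2) (memLp_symB hR hm ht) ψ, ae_ne_zero] with k h1 h2 h3 hk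
  obtain ⟨e1, e2, -⟩ := symbol_identities hR hm (t := t) (by linarith) hk
  rw [h1, KinvCLM_apply]
  dsimp only
  rw [h2, h3, symA_neg, symB_neg]
  linear_combination ψ k * e1 + conjRefl ψ k * e2

theorem KinvCLM_KCLM {t : ℝ} (ht : 1 ≤ t) (F : Data) : KinvCLM R m t (KCLM R m t F) = F := by
  -- Reality of the data enters here: without it `K_t` would not be injective, since `C ψ` must be
  -- expressible through the same data.
  have hC : ∀ {s : ℝ} (u : Sob s), ∀ᵐ k : E3, conj (Psi s u (-k)) = Psi s u k := by
    intro s u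
    have h1 := coeFn_conjRefl (Psi s u)
    rw [conjRefl_Psi] at h1
    filter_upwards [h1] with k hk using hk.symm
  have hn : ∀ k, symAlpha R m t (-k) = symAlpha R m t k := fun k => by simp [symAlpha]
  have hn' : ∀ k, symBeta R m t (-k) = symBeta R m t k := fun k => by simp [symBeta]
  have hrefl : ∀ᵐ k : E3, conjRefl (KCLM R m t F) k = conj (symAlpha R m t k) * Psi (1 / 2) F.1 k +
      conj (symBeta R m t k) * Psi (-1 / 2) F.2 k := by
    filter_upwards [coeFn_conjRefl (KCLM R m t F), ae_neg (coeFn_KCLM hR hm ht F), hC F.1,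
      hC F.2] with k h1 h2 h3 h4
    rw [h1, h2, map_add, map_mul, map_mul, h3, h4, hn, hn']
  rw [KinvCLM_apply]
  refine Prod.ext ((Psi _).injective (ext_L2 ?_)) ((Psi _).injective (ext_L2 ?_))
  · filter_upwards [coeFn_KCLM hR hm ht F, hrefl,
      Psi_lift_mulOp_ae (1 / 2) (memLp_symA hR hm ht) (KCLM R m t F), ae_ne_zero]
      with k h1 h2 h3 hk
    obtain ⟨-, -, e1, e2, -⟩ := symbol_identities hR hm (t := t) (by linarith) hk
    rw [h3, h1, h2, symA_neg]
    rw [map_mul] at e1 e2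
    linear_combination Psi (1 / 2) F.1 k * e1 + Psi (-1 / 2) F.2 k * e2
  · filter_upwards [coeFn_KCLM hR hm ht F, hrefl,
      Psi_lift_mulOp_ae (-1 / 2) (memLp_symB hR hm ht) (KCLM R m t F), ae_ne_zero]
      with k h1 h2 h3 hk
    obtain ⟨-, -, -, -, e1, e2⟩ := symbol_identities hR hm (t := t) (by linarith) hk
    rw [h3, h1, h2, symB_neg]
    rw [map_mul] at e1 e2
    linear_combination Psi (1 / 2) F.1 k * e1 + Psi (-1 / 2) F.2 k * e2

/-- `Function.invFun` is a right inverse because `KCLM` is onto; the left inverse `KinvCLM` then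
identifies its values. -/
theorem Kinv_eq {t : ℝ} (ht : 1 ≤ t) (ψ : L2) : Kinv R m t ψ = KinvCLM R m t ψ := by
  have h1 : K R m t (Kinv R m t ψ) = ψ := by
    refine Function.invFun_eq ⟨KinvCLM R m t ψ, ?_⟩
    rw [K_eq hR hm ht, KCLM_KinvCLM hR hm ht]
  rw [K_eq hR hm ht] at h1
  rw [← KinvCLM_KCLM hR hm ht (Kinv R m t ψ), h1]

theorem exists_equiv_K {t : ℝ} (ht : 1 ≤ t) : ∃ e : Data ≃L[ℝ] L2, ∀ F, e F = K R m t F :=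
  ⟨ContinuousLinearEquiv.equivOfInverse (KCLM R m t) (KinvCLM R m t)
    (KinvCLM_KCLM hR hm ht) (KCLM_KinvCLM hR hm ht), fun F => (K_eq hR hm ht F).symm⟩

/-! ### Regularity in time -/

theorem exists_KCLM_bound {T : ℝ} (hT : 1 ≤ T) : ∃ C : ℝ, 0 ≤ C ∧ ∀ t ∈ Icc 1 T,
    (∀ F, ‖KCLM R m t F‖ ≤ C * ‖F‖) ∧ (∀ ψ, ‖KinvCLM R m t ψ‖ ≤ C * ‖ψ‖) ∧
    (∀ k : E3, k ≠ 0 → ‖symAlpha R m t k‖ ≤ C ∧ ‖symBeta R m t k‖ ≤ C) := by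
  obtain ⟨C, hC, h⟩ := exists_sym_bound hR hm hT
  set c := R / ‖wronskianConst R m‖ with hc
  have hc0 : 0 ≤ c := by positivity
  set L := ‖lift (1 / 2)‖ + ‖lift (-1 / 2)‖ with hL
  have hw := norm_pos_iff.2 (wronskianConst_ne_zero hm)
  have hsym : ∀ t ∈ Icc 1 T, ∀ k : E3, k ≠ 0 → ‖symAlpha R m t k‖ ≤ c * C ∧
      ‖symBeta R m t k‖ ≤ c * C := by
    intro t ht k hk
    have ht0 : 0 < t := by linarith [ht.1]
    have h3 : ‖(R : ℂ) / (wronskianConst R m * t ^ 3)‖ ≤ c := by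
      rw [norm_div, norm_mul, norm_pow, Complex.norm_real, Complex.norm_real,
        Real.norm_of_nonneg hR.le, Real.norm_of_nonneg ht0.le, hc]
      gcongr
      exact le_mul_of_one_le_right hw.le (one_le_pow₀ ht.1)
    rw [symAlpha, symBeta, norm_mul, norm_mul, norm_neg, RCLike.norm_conj, RCLike.norm_conj]
    constructor
    · gcongr
      exact (h t ht k hk).2
    · gcongr
      exact (h t ht k hk).1
  refine ⟨2 * (c * C) + L * C, by positivity, fun t ht => ⟨fun F => ?_, fun ψ => ?_, ?_⟩⟩
  · rw [KCLM_apply]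
    have h1 : ‖mulOp (symAlpha R m t) (Psi (1 / 2) F.1)‖ ≤ c * C * ‖F‖ := by
      refine (norm_mulOp_le (C := c * C) (by positivity) ?_ _).trans ?_
      · filter_upwards [ae_ne_zero] with k hk using (hsym t ht k hk).1
      · rw [LinearIsometry.norm_map]
        gcongr
        exact norm_fst_le F
    have h2 : ‖mulOp (symBeta R m t) (Psi (-1 / 2) F.2)‖ ≤ c * C * ‖F‖ := by
      refine (norm_mulOp_le (C := c * C) (by positivity) ?_ _).trans ?_
      · filter_upwards [ae_ne_zero] with k hk using (hsym t ht k hk).2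
      · rw [LinearIsometry.norm_map]
        gcongr
        exact norm_snd_le F
    have : 0 ≤ L * C * ‖F‖ := by positivity
    linarith [norm_add_le (mulOp (symAlpha R m t) (Psi (1 / 2) F.1))
      (mulOp (symBeta R m t) (Psi (-1 / 2) F.2))]
  · rw [KinvCLM_apply]
    have hL1 : ‖lift (1 / 2)‖ ≤ L := le_add_of_nonneg_right (norm_nonneg _)
    have hL2 : ‖lift (-1 / 2)‖ ≤ L := le_add_of_nonneg_left (norm_nonneg _)
    have : 0 ≤ 2 * (c * C) * ‖ψ‖ := by positivity
    rw [add_mul]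
    refine le_add_of_nonneg_of_le this (norm_prod_le_iff.2 ⟨?_, ?_⟩)
    · refine (ContinuousLinearMap.le_opNorm _ _).trans ?_
      rw [mul_assoc]
      gcongr
      refine norm_mulOp_le hC ?_ _
      filter_upwards [ae_ne_zero] with k hk using (h t ht k hk).1
    · refine (ContinuousLinearMap.le_opNorm _ _).trans ?_
      rw [mul_assoc]
      gcongr
      refine norm_mulOp_le hC ?_ _
      filter_upwards [ae_ne_zero] with k hk using (h t ht k hk).2
  · intro k hk
    have := hsym t ht k hk
    have h0 : 0 ≤ L * C := by positivity
    have h1 : 0 ≤ c * C := by positivity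
    exact ⟨by linarith [this.1], by linarith [this.2]⟩

theorem continuousAt_symB {t : ℝ} (ht : 0 < t) {k : E3} (hk : k ≠ 0) :
    ContinuousAt (fun τ => symB R m τ k) t := by
  have h1 := ((hasDerivAt_symB hR hm ht hk).continuousAt).const_mul (wt 1 k : ℂ)
  refine h1.congr (.of_forall fun τ => ?_)
  dsimp only
  rw [← mul_assoc, ← Complex.ofReal_mul, wt_mul]
  simp

theorem continuousOn_KinvCLM {T : ℝ} (hT : 1 ≤ T) (ψ : L2) :
    ContinuousOn (fun t => KinvCLM R m t ψ) (Icc 1 T) := by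
  obtain ⟨C, hC, h⟩ := exists_sym_bound hR hm hT
  intro t ht
  have ht0 : 0 < t := by linarith [ht.1]
  simp only [KinvCLM_apply]
  refine ContinuousWithinAt.prodMk ?_ ?_
  · refine (lift (1 / 2)).continuous.continuousAt.comp_continuousWithinAt
      (tendsto_mulOp (C := C) ?_ (memLp_symA hR hm ht.1) ?_ ?_ ?_ ψ)
    · filter_upwards [self_mem_nhdsWithin] with τ hτ using (memLp_symA hR hm hτ.1).1
    · filter_upwards [self_mem_nhdsWithin] with τ hτ
      filter_upwards [ae_ne_zero] with k hk using (h τ hτ k hk).1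
    · filter_upwards [ae_ne_zero] with k hk using (h t ht k hk).1
    · filter_upwards [ae_ne_zero] with k hk
      exact (continuousAt_symA hR m ht0 hk).continuousWithinAt
  · refine (lift (-1 / 2)).continuous.continuousAt.comp_continuousWithinAt
      (tendsto_mulOp (C := C) ?_ (memLp_symB hR hm ht.1) ?_ ?_ ?_ ψ)
    · filter_upwards [self_mem_nhdsWithin] with τ hτ using (memLp_symB hR hm hτ.1).1
    · filter_upwards [self_mem_nhdsWithin] with τ hτ
      filter_upwards [ae_ne_zero] with k hk using (h τ hτ k hk).2
    · filter_upwards [ae_ne_zero] with k hk using (h t ht k hk).2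
    · filter_upwards [ae_ne_zero] with k hk
      exact (continuousAt_symB hR hm ht0 hk).continuousWithinAt

theorem continuousOn_KCLM {T : ℝ} (hT : 1 ≤ T) (F : Data) :
    ContinuousOn (fun t => KCLM R m t F) (Icc 1 T) := by
  obtain ⟨C, hC, h⟩ := exists_KCLM_bound hR hm hT
  intro t ht
  have ht0 : 0 < t := by linarith [ht.1]
  have hd : ContinuousAt (fun τ : ℝ => (R : ℂ) / (wronskianConst R m * τ ^ 3)) t := by
    refine ContinuousAt.div continuousAt_const (by fun_prop) ?_
    have ht' : (t : ℂ) ≠ 0 := by exact_mod_cast ht0.ne'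
    exact mul_ne_zero (wronskianConst_ne_zero hm) (pow_ne_zero _ ht')
  simp only [KCLM_apply]
  refine ContinuousWithinAt.add (tendsto_mulOp (C := C) ?_ (memLp_symAlpha hR hm ht.1) ?_ ?_ ?_ _)
    (tendsto_mulOp (C := C) ?_ (memLp_symBeta hR hm ht.1) ?_ ?_ ?_ _)
  · filter_upwards [self_mem_nhdsWithin] with τ hτ using (memLp_symAlpha hR hm hτ.1).1
  · filter_upwards [self_mem_nhdsWithin] with τ hτ
    filter_upwards [ae_ne_zero] with k hk using ((h τ hτ).2.2 k hk).1
  · filter_upwards [ae_ne_zero] with k hk using ((h t ht).2.2 k hk).1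
  · filter_upwards [ae_ne_zero] with k hk
    exact (hd.mul (Complex.continuous_conj.continuousAt.comp
      (continuousAt_symB hR hm ht0 hk))).continuousWithinAt
  · filter_upwards [self_mem_nhdsWithin] with τ hτ using (memLp_symBeta hR hm hτ.1).1
  · filter_upwards [self_mem_nhdsWithin] with τ hτ
    filter_upwards [ae_ne_zero] with k hk using ((h τ hτ).2.2 k hk).2
  · filter_upwards [ae_ne_zero] with k hk using ((h t ht).2.2 k hk).2
  · filter_upwards [ae_ne_zero] with k hk
    exact (hd.neg.mul (Complex.continuous_conj.continuousAt.comp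
      (continuousAt_symA hR m ht0 hk))).continuousWithinAt

end inverse

/-! ### The generator, and the time derivative of `K_t⁻¹` in the weaker norm. -/

/-- The inclusion of `H^{1/2} × H^{-1/2}` in `H^{-1/2} × H^{-3/2}` as a continuous linear map. -/
noncomputable def embedCLM : Data →L[ℝ] Data1 :=
  (inclCLM (by norm_num)).prodMap (inclCLM (by norm_num))

theorem embedCLM_apply (F : Data) : embedCLM F = embed F := rfl

/-- The weight is real and even, so multiplication by it commutes with `conjRefl`. -/
theorem incl_lift {s r : ℝ} (h : r ≤ s) (g : L2) :
    Sob.incl h (lift s g) = lift r (mulOp (fun k => (wt (r - s) k : ℂ)) g) := by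
  apply (Psi r).injective
  rw [Psi_incl, Psi_lift, Psi_lift, map_add, conjRefl_mulOp (memLp_wt (by linarith)) (by simp)]
  simp only [Complex.conj_ofReal]

theorem lap_lift {s r : ℝ} (h : r ≤ s - 2) (hr : r = s - 2) (g : L2) :
    Sob.lap h (lift s g) =
      lift r (mulOp (fun k => ((-(‖k‖ ^ 2 * wt (-2) k) : ℝ) : ℂ)) g) := by
  apply (Psi r).injective
  rw [Psi_lap h hr, Psi_lift, Psi_lift, map_add, conjRefl_mulOp memLp_lap_symbol (by simp)]
  simp only [Complex.conj_ofReal]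

section derivative

variable {R m : ℝ} (hR : 0 < R) (hm : 3 / 2 < m * R)
include hR hm

theorem memLp_symBDeriv {t : ℝ} (ht : 1 ≤ t) : MemLp (symBDeriv R m t) ∞ (volume : Measure E3) := by
  obtain ⟨C, -, h⟩ := exists_symBDeriv_bound hR hm ht
  refine memLp_top_of_bound ?_ C ?_
  · have h2 := continuous_wt (-2)
    have h1 := continuous_wt (-1)
    refine (Continuous.aestronglyMeasurable ?_ |>.mul (memLp_symA hR hm ht).1).neg.add
      (Continuous.aestronglyMeasurable ?_ |>.mul (memLp_symB hR hm ht).1)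
    · fun_prop
    · fun_prop
  · filter_upwards [ae_ne_zero] with k hk using h t ⟨ht, le_rfl⟩ k hk

theorem memLp_mul_symA {t : ℝ} (ht : 1 ≤ t) :
    MemLp (fun k => (wt (-1) k : ℂ) * symA R m t k) ∞ (volume : Measure E3) :=
  (memLp_symA hR hm ht).mul (memLp_wt (by norm_num))

theorem memLp_mul_symB {t : ℝ} (ht : 1 ≤ t) :
    MemLp (fun k => (wt (-1) k : ℂ) * symB R m t k) ∞ (volume : Measure E3) :=
  (memLp_symB hR hm ht).mul (memLp_wt (by norm_num))

theorem memLp_const_mul_symB {t : ℝ} (ht : 1 ≤ t) :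
    MemLp (fun k => (R / t : ℂ) * symB R m t k) ∞ (volume : Measure E3) :=
  (memLp_symB hR hm ht).const_mul _

theorem embed_KinvCLM {t : ℝ} (ht : 1 ≤ t) (ψ : L2) : embed (KinvCLM R m t ψ) =
    (lift (-1 / 2) (mulOp (fun k => (wt (-1) k : ℂ) * symA R m t k) ψ),
      lift (-3 / 2) (mulOp (fun k => (wt (-1) k : ℂ) * symB R m t k) ψ)) := by
  rw [embed, KinvCLM_apply]
  dsimp only
  rw [incl_lift, incl_lift]
  norm_num only
  rw [mulOp_mulOp (memLp_wt (by norm_num)) (memLp_symA hR hm ht) (memLp_mul_symA hR hm ht),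
    mulOp_mulOp (memLp_wt (by norm_num)) (memLp_symB hR hm ht) (memLp_mul_symB hR hm ht)]

/-- Pure algebra of symbols. That the symbols on the right are the time derivatives of those in
`embed_KinvCLM` is the mode equation, contained in `hasDerivAt_symA` and `hasDerivAt_symB`. -/
theorem H0_KinvCLM {t : ℝ} (ht : 1 ≤ t) (ψ : L2) : -H0 R m t (KinvCLM R m t ψ) =
    (lift (-1 / 2) (mulOp (fun k => (R / t : ℂ) * symB R m t k) ψ),
      lift (-3 / 2) (mulOp (symBDeriv R m t) ψ)) := by
  rw [H0, KinvCLM_apply]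
  dsimp only
  rw [lap_lift _ (by norm_num), incl_lift, incl_lift, ← map_smul (lift (-1 / 2)),
    ← map_smul (lift (-3 / 2)), ← map_smul (lift (-3 / 2)), ← map_smul (lift (-3 / 2)),
    ← map_neg (lift (-1 / 2)), ← map_neg (lift (-3 / 2)), ← map_add (lift (-3 / 2)),
    ← map_sub (lift (-3 / 2)), Prod.neg_mk, ← map_neg (lift (-1 / 2)), ← map_neg (lift (-3 / 2))]
  norm_num only
  have e1 := memLp_symA hR hm ht
  have e2 := memLp_symB hR hm ht
  have w1 : MemLp (fun k => (wt (-1) k : ℂ)) ∞ (volume : Measure E3) := memLp_wt (by norm_num)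
  have w2 : MemLp (fun k => (wt (-2) k : ℂ)) ∞ (volume : Measure E3) := memLp_wt (by norm_num)
  refine Prod.ext ?_ ?_
  · dsimp only
    congr 1
    refine ext_L2 ?_
    rw [neg_neg]
    filter_upwards [Lp.coeFn_smul (R / t) (mulOp (symB R m t) ψ), coeFn_mulOp e2 ψ,
      coeFn_mulOp (memLp_const_mul_symB hR hm ht) ψ] with k h1 h2 h3
    rw [h1, h3, Pi.smul_apply, h2, Complex.real_smul]
    push_cast
    ring
  · dsimp only
    congr 1
    set A := mulOp (symA R m t) ψ
    set B := mulOp (symB R m t) ψ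
    set L := mulOp (fun k => ((-(‖k‖ ^ 2 * wt (-2) k) : ℝ) : ℂ)) A
    set A2 := mulOp (fun k => (wt (-2) k : ℂ)) A
    set B1 := mulOp (fun k => (wt (-1) k : ℂ)) B
    have e : -(-((t / R) • L) + (R / t * m ^ 2) • A2 - (3 / t) • B1) =
        (t / R) • L + (-(R / t * m ^ 2)) • A2 + (3 / t) • B1 := by
      rw [neg_smul]
      abel
    refine ext_L2 ?_
    rw [e]
    filter_upwards [Lp.coeFn_add ((t / R) • L + (-(R / t * m ^ 2)) • A2) ((3 / t) • B1),
      Lp.coeFn_add ((t / R) • L) ((-(R / t * m ^ 2)) • A2), Lp.coeFn_smul (t / R) L,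
      Lp.coeFn_smul (-(R / t * m ^ 2)) A2, Lp.coeFn_smul (3 / t) B1,
      coeFn_mulOp memLp_lap_symbol A, coeFn_mulOp w2 A, coeFn_mulOp w1 B, coeFn_mulOp e1 ψ,
      coeFn_mulOp e2 ψ, coeFn_mulOp (memLp_symBDeriv hR hm ht) ψ]
      with k h1 h2 h3 h4 h5 h6 h7 h8 h9 h10 h11
    rw [h1, Pi.add_apply, h2, Pi.add_apply, h3, h4, h5, Pi.smul_apply, Pi.smul_apply,
      Pi.smul_apply, h6, h7, h8, h9, h10, h11, symBDeriv]
    simp only [Complex.real_smul]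
    push_cast
    ring

theorem hasDerivWithinAt_embed_KinvCLM {T : ℝ} (hT : 1 ≤ T) {t : ℝ} (ht : t ∈ Icc 1 T) (ψ : L2) :
    HasDerivWithinAt (fun τ => embed (KinvCLM R m τ ψ)) (-H0 R m t (KinvCLM R m t ψ))
      (Icc 1 T) t := by
  obtain ⟨C, hC, h⟩ := exists_sym_bound hR hm hT
  obtain ⟨C', hC', h'⟩ := exists_symBDeriv_bound hR hm hT
  have hw : ∀ k : E3, ‖(wt (-1) k : ℂ)‖ ≤ 1 := fun k => by
    rw [Complex.norm_real, Real.norm_of_nonneg (wt_pos _ _).le]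
    exact wt_le_one (by norm_num) k
  have hRt : ∀ t ∈ Icc 1 T, ‖(R / t : ℂ)‖ ≤ R := fun t ht => by
    rw [norm_div, Complex.norm_real, Complex.norm_real, Real.norm_of_nonneg hR.le,
      Real.norm_of_nonneg (by linarith [ht.1])]
    exact div_le_self hR.le ht.1
  have h1 := hasDerivWithinAt_mulOp (convex_Icc 1 T) (C := 1 * C) (C' := R * C)
    (m := fun t k => (wt (-1) k : ℂ) * symA R m t k) (m' := fun t k => (R / t : ℂ) * symB R m t k)
    (fun τ hτ => (memLp_mul_symA hR hm hτ.1).1)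
    (fun τ hτ => by
      filter_upwards [ae_ne_zero] with k hk
      rw [norm_mul]
      gcongr
      exacts [hw k, (h τ hτ k hk).1])
    (fun τ hτ => (memLp_const_mul_symB hR hm hτ.1).1)
    (by
      filter_upwards [ae_ne_zero] with k hk τ hτ
      exact (hasDerivAt_symA hR m (by linarith [hτ.1]) hk).hasDerivWithinAt)
    (by
      filter_upwards [ae_ne_zero] with k hk τ hτ
      rw [norm_mul]
      gcongr
      exacts [hRt τ hτ, (h τ hτ k hk).2]) ht ψ
  have h2 := hasDerivWithinAt_mulOp (convex_Icc 1 T) (C := 1 * C) (C' := C')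
    (m := fun t k => (wt (-1) k : ℂ) * symB R m t k) (m' := fun t k => symBDeriv R m t k)
    (fun τ hτ => (memLp_mul_symB hR hm hτ.1).1)
    (fun τ hτ => by
      filter_upwards [ae_ne_zero] with k hk
      rw [norm_mul]
      gcongr
      exacts [hw k, (h τ hτ k hk).2])
    (fun τ hτ => (memLp_symBDeriv hR hm hτ.1).1)
    (by
      filter_upwards [ae_ne_zero] with k hk τ hτ
      exact (hasDerivAt_symB hR hm (by linarith [hτ.1]) hk).hasDerivWithinAt)
    (by filter_upwards [ae_ne_zero] with k hk τ hτ using h' τ hτ k hk) ht ψ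
  rw [H0_KinvCLM hR hm ht.1]
  have h3 := ((lift (-1 / 2)).hasFDerivAt.comp_hasDerivWithinAt t h1).prodMk
    ((lift (-3 / 2)).hasFDerivAt.comp_hasDerivWithinAt t h2)
  exact h3.congr (fun τ hτ => embed_KinvCLM hR hm hτ.1 ψ) (embed_KinvCLM hR hm ht.1 ψ)

/-- The mean value inequality with a constant linear in `‖ψ‖`, so that it can be used along a curve
of vectors `ψ`. -/
theorem exists_lipschitz_embed_KinvCLM {T : ℝ} (hT : 1 ≤ T) : ∃ L : ℝ, 0 ≤ L ∧
    ∀ t ∈ Icc 1 T, ∀ s ∈ Icc 1 T, ∀ ψ : L2,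
      ‖embed (KinvCLM R m t ψ) - embed (KinvCLM R m s ψ)‖ ≤ L * ‖ψ‖ * ‖t - s‖ := by
  obtain ⟨C, hC, h⟩ := exists_sym_bound hR hm hT
  obtain ⟨C', hC', h'⟩ := exists_symBDeriv_bound hR hm hT
  set L := ‖lift (-1 / 2)‖ * (R * C) + ‖lift (-3 / 2)‖ * C' with hL
  refine ⟨L, by positivity, fun t ht s hs ψ => ?_⟩
  refine (convex_Icc 1 T).norm_image_sub_le_of_norm_hasDerivWithin_le
    (fun τ hτ => hasDerivWithinAt_embed_KinvCLM hR hm hT hτ ψ) (fun τ hτ => ?_) hs ht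
  rw [H0_KinvCLM hR hm hτ.1, hL, add_mul]
  have p1 : 0 ≤ ‖lift (-1 / 2)‖ * (R * C) * ‖ψ‖ := by positivity
  have p2 : 0 ≤ ‖lift (-3 / 2)‖ * C' * ‖ψ‖ := by positivity
  refine norm_prod_le_iff.2 ⟨le_add_of_le_of_nonneg ?_ p2, le_add_of_nonneg_of_le p1 ?_⟩
  · refine (ContinuousLinearMap.le_opNorm _ _).trans ?_
    rw [mul_assoc]
    gcongr
    refine norm_mulOp_le (by positivity) ?_ _
    filter_upwards [ae_ne_zero] with k hk
    rw [norm_mul, norm_div, Complex.norm_real, Complex.norm_real, Real.norm_of_nonneg hR.le,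
      Real.norm_of_nonneg (by linarith [hτ.1])]
    gcongr
    exacts [div_le_self hR.le hτ.1, (h τ hτ k hk).2]
  · refine (ContinuousLinearMap.le_opNorm _ _).trans ?_
    rw [mul_assoc]
    gcongr
    refine norm_mulOp_le hC' ?_ _
    filter_upwards [ae_ne_zero] with k hk using h' τ hτ k hk

end derivative

/-! ### Multiplication by the potential -/

/-- The inverse Fourier integral `(2π)^(-3/2) ∫ exp(i k·x) g(k) dk`. -/
noncomputable def invFourierInt (g : E3 → ℂ) (x : E3) : ℂ :=
  (((2 * Real.pi) ^ (-(3 / 2) : ℝ) : ℝ) : ℂ) *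
    ∫ k : E3, Complex.exp (Complex.I * (inner ℝ k x : ℝ)) * g k

theorem norm_exp_mul (k x : E3) (z : ℂ) :
    ‖Complex.exp (Complex.I * (inner ℝ k x : ℝ)) * z‖ = ‖z‖ := by
  rw [norm_mul, mul_comm Complex.I, Complex.norm_exp_ofReal_mul_I, one_mul]

theorem continuous_exp_inner (x : E3) :
    Continuous fun k : E3 => Complex.exp (Complex.I * (inner ℝ k x : ℝ)) := by
  fun_prop

theorem integrable_exp_mul {g : E3 → ℂ} (hg : Integrable g) (x : E3) :
    Integrable fun k : E3 => Complex.exp (Complex.I * (inner ℝ k x : ℝ)) * g k := by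
  refine hg.mono ((continuous_exp_inner x).aestronglyMeasurable.mul hg.1) (.of_forall fun k => ?_)
  rw [norm_exp_mul]

/-- The bound of the potential by the `L¹` norm of its transform; the prefactor, at most `1`, is
dropped. -/
theorem norm_invFourierInt_le (g : E3 → ℂ) (x : E3) :
    ‖invFourierInt g x‖ ≤ ∫ k, ‖g k‖ := by
  rw [invFourierInt, norm_mul, Complex.norm_real, Real.norm_of_nonneg (by positivity)]
  have h1 : ((2 * Real.pi) ^ (-(3 / 2) : ℝ) : ℝ) ≤ 1 :=
    Real.rpow_le_one_of_one_le_of_nonpos (by linarith [Real.pi_gt_three]) (by norm_num)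
  have h2 : ‖∫ k : E3, Complex.exp (Complex.I * (inner ℝ k x : ℝ)) * g k‖ ≤ ∫ k, ‖g k‖ := by
    refine (norm_integral_le_integral_norm _).trans_eq ?_
    simp only [norm_exp_mul]
  calc _ ≤ 1 * ∫ k, ‖g k‖ := by gcongr
    _ = _ := one_mul _

theorem continuous_invFourierInt {g : E3 → ℂ} (hg : Integrable g) :
    Continuous (invFourierInt g) := by
  refine continuous_const.mul (continuous_of_dominated (bound := fun k => ‖g k‖)
    (fun x => (integrable_exp_mul hg x).1) (fun x => .of_forall fun k => ?_) hg.norm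
    (.of_forall fun k => ?_))
  · rw [norm_exp_mul]
  · fun_prop

theorem memLp_invFourierInt {g : E3 → ℂ} (hg : Integrable g) :
    MemLp (invFourierInt g) ∞ (volume : Measure E3) :=
  memLp_top_of_bound (continuous_invFourierInt hg).aestronglyMeasurable _
    (.of_forall (norm_invFourierInt_le g))

theorem invFourierInt_sub {g g' : E3 → ℂ} (hg : Integrable g) (hg' : Integrable g') (x : E3) :
    invFourierInt g x - invFourierInt g' x = invFourierInt (g - g') x := by
  rw [invFourierInt, invFourierInt, invFourierInt, ← mul_sub,
    ← integral_sub (integrable_exp_mul hg x) (integrable_exp_mul hg' x)]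
  simp only [Pi.sub_apply, mul_sub]

theorem norm_mulOp_invFourierInt_le (g : E3 → ℂ) (f : L2) :
    ‖mulOp (invFourierInt g) f‖ ≤ (∫ k, ‖g k‖) * ‖f‖ :=
  norm_mulOp_le (integral_nonneg fun _ => norm_nonneg _)
    (.of_forall (norm_invFourierInt_le g)) f

theorem norm_mulOp_invFourierInt_sub_le {g g' : E3 → ℂ} (hg : Integrable g) (hg' : Integrable g')
    (f : L2) : ‖mulOp (invFourierInt g) f - mulOp (invFourierInt g') f‖ ≤
      (∫ k, ‖g k - g' k‖) * ‖f‖ := by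
  have h : mulOp (invFourierInt g) f - mulOp (invFourierInt g') f =
      mulOp (invFourierInt (g - g')) f := by
    refine ext_L2 ?_
    filter_upwards [coeFn_mulOp (memLp_invFourierInt hg) f,
      coeFn_mulOp (memLp_invFourierInt hg') f, coeFn_mulOp (memLp_invFourierInt (hg.sub hg')) f,
      Lp.coeFn_sub (mulOp (invFourierInt g) f) (mulOp (invFourierInt g') f)] with x h1 h2 h3 h4
    rw [h4, Pi.sub_apply, h1, h2, h3, ← invFourierInt_sub hg hg', sub_mul]
  rw [h]
  exact norm_mulOp_invFourierInt_le _ f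

/-! ### Real square-integrable functions as elements of `H^0`, and the multiplication operator. -/

/-- The real part of an `L²` function. -/
noncomputable def reL2 : L2 →L[ℝ] L2 :=
  (Complex.ofRealCLM ∘L Complex.reCLM).compLpL 2 volume

theorem coeFn_reL2 (g : L2) : reL2 g =ᵐ[volume] fun x => ((g x).re : ℂ) :=
  (Complex.ofRealCLM ∘L Complex.reCLM).coeFn_compLpL g

theorem norm_reL2_le (g : L2) : ‖reL2 g‖ ≤ ‖g‖ := by
  refine Lp.norm_le_norm_of_ae_le ?_
  filter_upwards [coeFn_reL2 g] with x hx
  rw [hx, Complex.norm_real]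
  exact Complex.abs_re_le_norm _

theorem toTD_apply (g : L2) (φ : 𝓢(E3, ℂ)) :
    Lp.toTemperedDistributionCLM ℂ (volume : Measure E3) 2 g φ = ∫ x, φ x * g x := by
  rw [Lp.toTemperedDistributionCLM_apply, Lp.toTemperedDistribution_apply]
  rfl

theorem integrable_schwartz_mul (φ : 𝓢(E3, ℂ)) (g : L2) : Integrable fun x => φ x * g x :=
  (φ.memLp 2 volume).integrable_mul (Lp.memLp g)

theorem isReal_of_ae {g : L2} (h : ∀ᵐ x, (g x).im = 0) :
    IsReal (Lp.toTemperedDistributionCLM ℂ (volume : Measure E3) 2 g) := by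
  intro φ hφ
  rw [toTD_apply, ← RCLike.im_eq_complex_im, ← integral_im (integrable_schwartz_mul φ g)]
  refine (integral_congr_ae ?_).trans (integral_zero _ _)
  filter_upwards [h] with x hx
  simp [hx, hφ x]

/-- The imaginary part of `g` defines a distribution that vanishes on real test functions, hence
vanishes. -/
theorem ae_of_isReal {g : L2} (h : IsReal (Lp.toTemperedDistributionCLM ℂ (volume : Measure E3) 2 g)) :
    ∀ᵐ x, (g x).im = 0 := by
  set L := Complex.ofRealCLM ∘L Complex.imCLM
  have h1 := L.coeFn_compLpL (p := 2) (μ := (volume : Measure E3)) g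
  have h2 : Lp.toTemperedDistributionCLM ℂ (volume : Measure E3) 2 (L.compLpL 2 volume g) = 0 := by
    apply eq_zero_of_real
    intro φ hφ
    have h3 := h φ hφ
    rw [toTD_apply, ← RCLike.im_eq_complex_im, ← integral_im (integrable_schwartz_mul φ g)] at h3
    rw [toTD_apply]
    have h4 : ∫ x, φ x * (L.compLpL 2 volume g) x =
        ∫ x, ((RCLike.im (φ x * g x) : ℝ) : ℂ) := by
      refine integral_congr_ae ?_
      filter_upwards [h1] with x hx
      rw [hx]
      have : φ x = ((φ x).re : ℂ) := Complex.ext rfl (by simp [hφ x])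
      simp only [L, ContinuousLinearMap.comp_apply, Complex.ofRealCLM_apply, Complex.imCLM_apply,
        RCLike.im_eq_complex_im, Complex.mul_im, hφ x]
      rw [this]
      simp
    rw [h4, integral_complex_ofReal, h3, Complex.ofReal_zero]
  have h5 : L.compLpL 2 volume g = 0 := by
    apply toDist_injective
    rw [h2, map_zero]
  rw [h5] at h1
  filter_upwards [h1, Lp.coeFn_zero ℂ 2 (volume : Measure E3)] with x h6 h7
  rw [h7] at h6
  simpa [L] using h6.symm

/-- The element of `H^0` given by the real part of an `L²` function. -/
noncomputable def ofL2Fun (g : L2) : Sob 0 :=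
  ⟨Lp.toTemperedDistributionCLM ℂ (volume : Measure E3) 2 (reL2 g),
    isReal_of_ae (by
      filter_upwards [coeFn_reL2 g] with x hx
      rw [hx, Complex.ofReal_im]),
    TemperedDistribution.memSobolev_zero_iff.2 ⟨reL2 g, rfl⟩⟩

theorem dist_ofL2Fun (g : L2) : (ofL2Fun g).dist =
    Lp.toTemperedDistributionCLM ℂ (volume : Measure E3) 2 (reL2 g) := by
  rw [Sob.dist_eq_val, ofL2Fun]

theorem Sob.dist_eq_bessel (u : Sob 0) : u.dist =
    Lp.toTemperedDistributionCLM ℂ (volume : Measure E3) 2 u.bessel := by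
  rw [← u.bessel_spec, TemperedDistribution.besselPotential_zero]
  rfl

theorem bessel_ofL2Fun (g : L2) : (ofL2Fun g).bessel = reL2 g := by
  apply toDist_injective
  rw [← Sob.dist_eq_bessel, dist_ofL2Fun]

theorem norm_eq_bessel {s : ℝ} (u : Sob s) : ‖u‖ = ‖u.bessel‖ := rfl

/-- The map `ofL2Fun` as a continuous linear map. -/
noncomputable def ofL2 : L2 →L[ℝ] Sob 0 :=
  LinearMap.mkContinuous
    { toFun := ofL2Fun
      map_add' := fun f g => by
        apply Sob.bessel_injective
        rw [map_add, bessel_ofL2Fun, bessel_ofL2Fun, bessel_ofL2Fun, map_add]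
      map_smul' := fun c g => by
        apply Sob.bessel_injective
        rw [map_smul, bessel_ofL2Fun, bessel_ofL2Fun, map_smul, RingHom.id_apply] } 1
    fun g => by
      rw [norm_eq_bessel, one_mul]
      exact (congrArg norm (bessel_ofL2Fun g)).trans_le (norm_reL2_le g)

theorem dist_ofL2 (g : L2) : (ofL2 g).dist =
    Lp.toTemperedDistributionCLM ℂ (volume : Measure E3) 2 (reL2 g) := dist_ofL2Fun g

theorem norm_ofL2_le (g : L2) : ‖ofL2 g‖ ≤ ‖g‖ := by
  rw [norm_eq_bessel]
  exact (congrArg norm (bessel_ofL2Fun g)).trans_le (norm_reL2_le g)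

/-- The `L²` function underlying an element of `H^0`. -/
noncomputable def besselCLM : Sob 0 →L[ℝ] L2 :=
  Sob.bessel.mkContinuous 1 fun _ => (one_mul _).ge

/-- Multiplication by the inverse Fourier integral of `g`. -/
noncomputable def potOp (g : E3 → ℂ) : Sob (1 / 2) →L[ℝ] Sob (-1 / 2) :=
  (inclCLM (s := 0) (r := -1 / 2) (by norm_num)) ∘L ofL2 ∘L
    (mulOp (invFourierInt g)).restrictScalars ℝ ∘L besselCLM ∘L
    (inclCLM (s := 1 / 2) (r := 0) (by norm_num))

theorem potOp_apply (g : E3 → ℂ) (f : Sob (1 / 2)) : potOp g f =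
    Sob.incl (by norm_num) (ofL2 (mulOp (invFourierInt g)
      (Sob.incl (s := 1 / 2) (r := 0) (by norm_num) f).bessel)) := rfl

theorem norm_bessel_incl_le (f : Sob (1 / 2)) :
    ‖(Sob.incl (s := 1 / 2) (r := 0) (by norm_num) f).bessel‖ ≤ ‖f‖ := by
  rw [← norm_eq_bessel]
  exact norm_incl_le _ f

theorem norm_potOp_le (g : E3 → ℂ) (f : Sob (1 / 2)) : ‖potOp g f‖ ≤ (∫ k, ‖g k‖) * ‖f‖ := by
  rw [potOp_apply]
  refine (norm_incl_le _ _).trans ((norm_ofL2_le _).trans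
    ((norm_mulOp_invFourierInt_le g _).trans ?_))
  have : 0 ≤ ∫ k, ‖g k‖ := integral_nonneg fun _ => norm_nonneg _
  gcongr
  exact norm_bessel_incl_le f

theorem norm_potOp_sub_le {g g' : E3 → ℂ} (hg : Integrable g) (hg' : Integrable g')
    (f : Sob (1 / 2)) : ‖potOp g f - potOp g' f‖ ≤ (∫ k, ‖g k - g' k‖) * ‖f‖ := by
  have h : potOp g f - potOp g' f = inclCLM (s := 0) (r := -1 / 2) (by norm_num) (ofL2
      (mulOp (invFourierInt g) (Sob.incl (s := 1 / 2) (r := 0) (by norm_num) f).bessel -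
      mulOp (invFourierInt g') (Sob.incl (s := 1 / 2) (r := 0) (by norm_num) f).bessel)) := by
    rw [map_sub, map_sub]
    rfl
  rw [h]
  refine (norm_incl_le (s := 0) (r := -1 / 2) (by norm_num) _).trans ((norm_ofL2_le _).trans
    ((norm_mulOp_invFourierInt_sub_le hg hg' _).trans ?_))
  have : 0 ≤ ∫ k, ‖g k - g' k‖ := integral_nonneg fun _ => norm_nonneg _
  gcongr
  exact norm_bessel_incl_le f

theorem IsProduct.unique {V : E3 → ℝ} {f : Sob (1 / 2)} {g g' : Sob (-1 / 2)}
    (h : IsProduct V f g) (h' : IsProduct V f g') : g = g' := by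
  obtain ⟨f₀, h1, h2⟩ := h
  obtain ⟨f₁, h3, h4⟩ := h'
  have h5 : f₀ = f₁ := toDist_injective (h1.symm.trans h3)
  subst h5
  apply Sob.dist_injective
  ext φ
  rw [(h2 φ).2, (h4 φ).2]

theorem isProduct_potOp {V : E3 → ℝ} {Vt : E3 → ℂ} (h : HasIntegrableFourier V Vt)
    (f : Sob (1 / 2)) : IsProduct V f (potOp Vt f) := by
  set u : Sob 0 := Sob.incl (s := 1 / 2) (r := 0) (by norm_num) f with hu
  have h0 : f.dist = Lp.toTemperedDistributionCLM ℂ (volume : Measure E3) 2 u.bessel := by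
    rw [← Sob.dist_eq_bessel, hu, Sob.dist_incl]
  have hreal : ∀ᵐ x, (u.bessel x).im = 0 := by
    apply ae_of_isReal
    rw [← h0]
    exact f.2.1
  set g := mulOp (invFourierInt Vt) u.bessel with hg
  -- The real part built into `ofL2` makes `potOp` available for every `g`; here both factors are
  -- real and it changes nothing.
  have hV : ∀ᵐ x, reL2 g x = (V x : ℂ) * u.bessel x := by
    filter_upwards [coeFn_reL2 g, coeFn_mulOp (memLp_invFourierInt h.1) u.bessel, h.2, hreal]
      with x h1 h2 h3 h4
    have h5 : g x = (V x : ℂ) * u.bessel x := by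
      rw [hg, h2, h3, invFourierInt]
    rw [h1, h5]
    exact Complex.ext (by simp) (by simp [h4])
  refine ⟨u.bessel, h0, fun φ => ?_⟩
  have hae : (fun x => φ x * reL2 g x) =ᵐ[volume] fun x => φ x * ((V x : ℂ) * u.bessel x) := by
    filter_upwards [hV] with x hx
    rw [hx]
  refine ⟨(integrable_schwartz_mul φ (reL2 g)).congr hae, ?_⟩
  rw [← integral_congr_ae hae, ← toTD_apply, potOp_apply, Sob.dist_incl, dist_ofL2]

/-- The product chosen in `potMul` is unique, hence equals the explicit one. -/
theorem potMul_eq {V : E3 → ℝ} {Vt : E3 → ℂ} (h : HasIntegrableFourier V Vt) (f : Sob (1 / 2)) :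
    potMul V f = potOp Vt f := by
  have hex : ∃ g, IsProduct V f g := ⟨_, isProduct_potOp h f⟩
  rw [potMul, dif_pos hex]
  exact hex.choose_spec.unique (isProduct_potOp h f)

/-- The perturbation `(f, h) ↦ (0, V f)` as a continuous linear map. -/
noncomputable def potCLM (g : E3 → ℂ) : Data →L[ℝ] Data :=
  (0 : Data →L[ℝ] Sob (1 / 2)).prod (potOp g ∘L ContinuousLinearMap.fst ℝ _ _)

theorem potCLM_apply (g : E3 → ℂ) (F : Data) : potCLM g F = (0, potOp g F.1) := rfl

theorem pot_eq {V : E3 → ℝ} {Vt : E3 → ℂ} (h : HasIntegrableFourier V Vt) (F : Data) :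
    pot V F = potCLM Vt F := by
  rw [pot, potCLM_apply, potMul_eq h]

theorem norm_potCLM_le (g : E3 → ℂ) (F : Data) : ‖potCLM g F‖ ≤ (∫ k, ‖g k‖) * ‖F‖ := by
  have h0 : 0 ≤ ∫ k, ‖g k‖ := integral_nonneg fun _ => norm_nonneg _
  rw [potCLM_apply]
  refine norm_prod_le_iff.2 ⟨?_, (norm_potOp_le g F.1).trans ?_⟩
  · simp only [norm_zero]
    positivity
  · gcongr
    exact norm_fst_le F

theorem norm_potCLM_sub_le {g g' : E3 → ℂ} (hg : Integrable g) (hg' : Integrable g')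
    (F : Data) : ‖potCLM g F - potCLM g' F‖ ≤ (∫ k, ‖g k - g' k‖) * ‖F‖ := by
  have h0 : 0 ≤ ∫ k, ‖g k - g' k‖ := integral_nonneg fun _ => norm_nonneg _
  rw [potCLM_apply, potCLM_apply, Prod.mk_sub_mk, sub_zero]
  refine norm_prod_le_iff.2 ⟨?_, (norm_potOp_sub_le hg hg' F.1).trans ?_⟩
  · simp only [norm_zero]
    positivity
  · gcongr
    exact norm_fst_le F

theorem integral_norm_L1_sub (g g' : Lp ℂ 1 (volume : Measure E3)) :
    ∫ k, ‖g k - g' k‖ = ‖g - g'‖ := by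
  rw [L1.norm_eq_integral_norm]
  refine integral_congr_ae ?_
  filter_upwards [Lp.coeFn_sub g g'] with k hk
  rw [hk, Pi.sub_apply]

/-- Joint continuity in the `L¹` class and the data lets measurability of the curve of potentials
pass to its action on a moving vector. -/
theorem continuous_potCLM :
    Continuous fun p : Lp ℂ 1 (volume : Measure E3) × Data => potCLM p.1 p.2 := by
  rw [continuous_iff_continuousAt]
  rintro ⟨g₀, F₀⟩
  rw [ContinuousAt, tendsto_iff_norm_sub_tendsto_zero]
  have hb : Tendsto (fun p : Lp ℂ 1 (volume : Measure E3) × Data =>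
      ‖p.1 - g₀‖ * ‖p.2‖ + (∫ k, ‖g₀ k‖) * ‖p.2 - F₀‖) (𝓝 (g₀, F₀)) (𝓝 0) := by
    have : Continuous (fun p : Lp ℂ 1 (volume : Measure E3) × Data =>
      ‖p.1 - g₀‖ * ‖p.2‖ + (∫ k, ‖g₀ k‖) * ‖p.2 - F₀‖) := by fun_prop
    simpa using this.tendsto (g₀, F₀)
  refine squeeze_zero (fun _ => norm_nonneg _) (fun p => ?_) hb
  have e : potCLM p.1 p.2 - potCLM g₀ F₀ =
      (potCLM p.1 p.2 - potCLM g₀ p.2) + potCLM g₀ (p.2 - F₀) := by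
    rw [map_sub]
    abel
  rw [e]
  refine (norm_add_le _ _).trans (add_le_add ?_ (norm_potCLM_le _ _))
  rw [← integral_norm_L1_sub]
  exact norm_potCLM_sub_le (L1.integrable_coeFn _) (L1.integrable_coeFn _) _

theorem potCLM_congr {g g' : E3 → ℂ} (h : g =ᵐ[volume] g') : potCLM g = potCLM g' := by
  have : invFourierInt g = invFourierInt g' := by
    funext x
    rw [invFourierInt, invFourierInt]
    congr 1
    refine integral_congr_ae ?_
    filter_upwards [h] with k hk
    rw [hk]
  rw [potCLM, potCLM, potOp, potOp, this]

/-! ### Measurability of families of integrable functions -/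

/-- By second countability an open set is a countable union of balls, whose preimages are measurable
by hypothesis. -/
theorem measurable_of_measurable_dist {α X : Type*} [MeasurableSpace α] [PseudoMetricSpace X]
    [SecondCountableTopology X] [MeasurableSpace X] [BorelSpace X] {f : α → X}
    (h : ∀ c, Measurable fun a => dist (f a) c) : Measurable f := by
  refine measurable_of_isOpen fun O hO => ?_
  choose! ε hε using fun x (hx : x ∈ O) => Metric.isOpen_iff.1 hO x hx
  obtain ⟨S, hS, hc, hU⟩ := TopologicalSpace.isOpen_biUnion_countable O
    (fun x => Metric.ball x (ε x)) fun _ _ => Metric.isOpen_ball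
  have hO' : O = ⋃ x ∈ S, Metric.ball x (ε x) := by
    rw [hU]
    refine Subset.antisymm (fun x hx => mem_biUnion hx (Metric.mem_ball_self (hε x hx).1))
      (iUnion₂_subset fun x hx => (hε x hx).2)
  rw [hO', preimage_iUnion₂]
  refine MeasurableSet.biUnion hc fun x _ => ?_
  exact h x measurableSet_Iio

open Classical in
/-- The class in `L¹` of a function (and `0` for functions which are not integrable). -/
noncomputable def classL1 (g : E3 → ℂ) : Lp ℂ 1 (volume : Measure E3) :=
  if h : Integrable g then h.toL1 g else 0

theorem coeFn_classL1 {g : E3 → ℂ} (h : Integrable g) : classL1 g =ᵐ[volume] g := by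
  rw [classL1, dif_pos h]
  exact h.coeFn_toL1

theorem classL1_congr {g g' : E3 → ℂ} (h : g =ᵐ[volume] g') : classL1 g = classL1 g' := by
  by_cases hg : Integrable g
  · have hg' := hg.congr h
    refine Lp.ext ?_
    filter_upwards [coeFn_classL1 hg, coeFn_classL1 hg', h] with k h1 h2 h3
    rw [h1, h2, h3]
  · rw [classL1, classL1, dif_neg hg, dif_neg (fun h' => hg (h'.congr h.symm))]

theorem norm_classL1_sub {g g' : E3 → ℂ} (h : Integrable g) (h' : Integrable g') :
    ‖classL1 g - classL1 g'‖ = ∫ k, ‖g k - g' k‖ := by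
  rw [← integral_norm_L1_sub]
  refine integral_congr_ae ?_
  filter_upwards [coeFn_classL1 h, coeFn_classL1 h'] with k h1 h2
  rw [h1, h2]

theorem norm_classL1 {g : E3 → ℂ} (h : Integrable g) : ‖classL1 g‖ = ∫ k, ‖g k‖ := by
  rw [L1.norm_eq_integral_norm]
  refine integral_congr_ae ?_
  filter_upwards [coeFn_classL1 h] with k h1
  rw [h1]

/-- `L¹(ℝ³)` is separable, so measurability of the distances to fixed elements `c` suffices, and
these are integrals depending on a parameter. A jointly measurable version `g` of `f` changes almost
every slice only on a null set. -/
theorem aestronglyMeasurable_classL1 {α : Type*} [MeasurableSpace α] {ν : Measure α} [SFinite ν]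
    {f : α → E3 → ℂ}
    (hf : AEStronglyMeasurable (Function.uncurry f) (ν.prod (volume : Measure E3))) :
    AEStronglyMeasurable (fun a => classL1 (f a)) ν := by
  borelize ↥(Lp ℂ 1 (volume : Measure E3))
  classical
  have : Fact ((1 : ℝ≥0∞) ≠ ∞) := ⟨ENNReal.one_ne_top⟩
  set g := hf.mk _ with hg
  have hgm : StronglyMeasurable g := hf.stronglyMeasurable_mk
  have hgm' : StronglyMeasurable (Function.uncurry fun a k => g (a, k)) := hgm
  have hae : ∀ᵐ a ∂ν, f a =ᵐ[volume] fun k => g (a, k) := Measure.ae_ae_of_ae_prod hf.ae_eq_mk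
  have hA : MeasurableSet {a | Integrable (fun k => g (a, k)) volume} := measurableSet_integrable hgm'
  have hmeas : Measurable fun a => classL1 (fun k => g (a, k)) := by
    refine measurable_of_measurable_dist fun c => ?_
    have h1 : StronglyMeasurable fun a => ∫ k, ‖g (a, k) - c k‖ := by
      have : StronglyMeasurable (Function.uncurry fun (a : α) (k : E3) => ‖g (a, k) - c k‖) :=
        (hgm.sub ((Lp.stronglyMeasurable c).comp_measurable measurable_snd)).norm
      exact this.integral_prod_right
    -- On slices that are not integrable `classL1` is `0`, which explains the second branch.
    have h2 : (fun a => dist (classL1 (fun k => g (a, k))) c) =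
        {a | Integrable (fun k => g (a, k)) volume}.piecewise (fun a => ∫ k, ‖g (a, k) - c k‖)
          (fun _ => dist 0 c) := by
      funext a
      by_cases ha : Integrable (fun k => g (a, k))
      · rw [Set.piecewise_eq_of_mem _ _ _ (show a ∈ {a | Integrable (fun k => g (a, k)) volume} from ha),
          dist_eq_norm, ← integral_norm_L1_sub]
        refine integral_congr_ae ?_
        filter_upwards [coeFn_classL1 ha] with k hk
        rw [hk]
      · rw [Set.piecewise_eq_of_notMem _ _ _ (show a ∉ {a | Integrable (fun k => g (a, k)) volume} from ha),
          classL1, dif_neg ha]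
    rw [h2]
    exact h1.measurable.piecewise hA measurable_const
  refine ⟨_, hmeas.stronglyMeasurable, ?_⟩
  filter_upwards [hae] with a ha using classL1_congr ha

/-! ### The Dyson series of a bounded family of operators -/

theorem summable_pow_div_factorial_mul (r c : ℝ) :
    Summable fun n : ℕ => r ^ n / n.factorial * c :=
  (Real.summable_pow_div_factorial r).mul_right c

theorem intervalIntegrable_of_integrableOn_Icc {F : Type*} [NormedAddCommGroup F] {f : ℝ → F}
    {a b u v : ℝ} (hf : IntegrableOn f (Icc a b)) (hu : u ∈ Icc a b) (hv : v ∈ Icc a b) :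
    IntervalIntegrable f volume u v :=
  (hf.mono_set (uIcc_subset_Icc hu hv)).intervalIntegrable

section dysonSeries

variable {E : Type*} [NormedAddCommGroup E] [NormedSpace ℝ E]

/-- The Dyson series of `-B`, term by term. -/
noncomputable def dysonTerm (B : ℝ → E →L[ℝ] E) (a : ℝ) : ℕ → ℝ → E → E
  | 0, _, ψ => ψ
  | n + 1, t, ψ => -∫ s in a..t, B s (dysonTerm B a n s ψ)

/-- The sum of the Dyson series of `-B`. -/
noncomputable def dysonSum (B : ℝ → E →L[ℝ] E) (a t : ℝ) (ψ : E) : E :=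
  ∑' n : ℕ, dysonTerm B a n t ψ

theorem dysonTerm_smul (B : ℝ → E →L[ℝ] E) (a : ℝ) (n : ℕ) (c : ℝ) (ψ : E) (t : ℝ) :
    dysonTerm B a n t (c • ψ) = c • dysonTerm B a n t ψ := by
  induction n generalizing t with
  | zero => rfl
  | succ n ih =>
    rw [dysonTerm, dysonTerm, smul_neg, ← intervalIntegral.integral_smul]
    congr 1
    refine intervalIntegral.integral_congr fun s _ => ?_
    rw [ih s, map_smul]

/-- A family of operators bounded by `M` on `[a, b]` which maps continuous curves to measurable
curves. -/
structure IsBoundedFamily (B : ℝ → E →L[ℝ] E) (a b M : ℝ) : Prop where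
  nonneg : 0 ≤ M
  bound : ∀ s ∈ Icc a b, ∀ x, ‖B s x‖ ≤ M * ‖x‖
  meas : ∀ x : ℝ → E, ContinuousOn x (Icc a b) →
    AEStronglyMeasurable (fun s => B s (x s)) (volume.restrict (Icc a b))

namespace IsBoundedFamily

variable {B : ℝ → E →L[ℝ] E} {a b M : ℝ} (hB : IsBoundedFamily B a b M)
include hB

theorem integrableOn {x : ℝ → E} (hx : ContinuousOn x (Icc a b)) :
    IntegrableOn (fun s => B s (x s)) (Icc a b) := by
  obtain ⟨K, hK⟩ := isCompact_Icc.exists_bound_of_continuousOn hx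
  refine IntegrableOn.of_bound measure_Icc_lt_top (hB.meas x hx) (M * K) ?_
  filter_upwards [ae_restrict_mem measurableSet_Icc] with s hs
  exact (hB.bound s hs _).trans (mul_le_mul_of_nonneg_left (hK s hs) hB.nonneg)

theorem intervalIntegrable {x : ℝ → E} (hx : ContinuousOn x (Icc a b)) {u v : ℝ}
    (hu : u ∈ Icc a b) (hv : v ∈ Icc a b) :
    IntervalIntegrable (fun s => B s (x s)) volume u v :=
  ((hB.integrableOn hx).mono_set (uIcc_subset_Icc hu hv)).intervalIntegrable

theorem norm_integral_le {x : ℝ → E} {K : ℝ} (hK : ∀ s ∈ Icc a b, ‖x s‖ ≤ K) {u v : ℝ}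
    (hu : u ∈ Icc a b) (hv : v ∈ Icc a b) :
    ‖∫ s in u..v, B s (x s)‖ ≤ M * K * |v - u| := by
  refine intervalIntegral.norm_integral_le_of_norm_le_const fun s hs => ?_
  have hs' := uIcc_subset_Icc hu hv (uIoc_subset_uIcc hs)
  exact (hB.bound s hs' _).trans (mul_le_mul_of_nonneg_left (hK s hs') hB.nonneg)

theorem integral_sub {x : ℝ → E} (hx : ContinuousOn x (Icc a b)) {u v : ℝ}
    (hu : u ∈ Icc a b) (hv : v ∈ Icc a b) :
    (∫ s in a..v, B s (x s)) - ∫ s in a..u, B s (x s) = ∫ s in u..v, B s (x s) := by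
  have ha : a ∈ Icc a b := left_mem_Icc.2 (hu.1.trans hu.2)
  exact intervalIntegral.integral_interval_sub_left (hB.intervalIntegrable hx ha hv)
    (hB.intervalIntegrable hx ha hu)

theorem exists_lipschitz_integral {x : ℝ → E} (hx : ContinuousOn x (Icc a b)) :
    ∃ L : ℝ, 0 ≤ L ∧ ∀ u ∈ Icc a b, ∀ v ∈ Icc a b,
      ‖(∫ s in a..v, B s (x s)) - ∫ s in a..u, B s (x s)‖ ≤ L * |v - u| := by
  obtain ⟨K, hK⟩ := isCompact_Icc.exists_bound_of_continuousOn hx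
  refine ⟨M * |K|, mul_nonneg hB.nonneg (abs_nonneg _), fun u hu v hv => ?_⟩
  rw [hB.integral_sub hx hu hv]
  exact hB.norm_integral_le (fun s hs => (hK s hs).trans (le_abs_self K)) hu hv

theorem continuousOn_integral {x : ℝ → E} (hx : ContinuousOn x (Icc a b)) :
    ContinuousOn (fun t => ∫ s in a..t, B s (x s)) (Icc a b) := by
  obtain ⟨L, hL0, hL⟩ := hB.exists_lipschitz_integral hx
  refine (LipschitzOnWith.of_dist_le_mul (K := ⟨L, hL0⟩) fun u hu v hv => ?_).continuousOn
  rw [dist_eq_norm, Real.dist_eq]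
  exact hL v hv u hu

theorem continuousOn_dysonTerm (n : ℕ) (ψ : E) :
    ContinuousOn (fun t => dysonTerm B a n t ψ) (Icc a b) := by
  induction n with
  | zero => exact continuousOn_const
  | succ n ih => exact (hB.continuousOn_integral ih).neg

/-- Each integration of `(s - a)^n` gains `1/(n+1)`; the factorial is the volume of the time-ordered
simplex. -/
theorem norm_dysonTerm_le (n : ℕ) (ψ : E) : ∀ t ∈ Icc a b,
    ‖dysonTerm B a n t ψ‖ ≤ (M * (t - a)) ^ n / n.factorial * ‖ψ‖ := by
  induction n with
  | zero => intro t _; simp [dysonTerm]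
  | succ n ih =>
    intro t ht
    have ha : a ∈ Icc a b := left_mem_Icc.2 (ht.1.trans ht.2)
    rw [dysonTerm, norm_neg]
    have h1 : ‖∫ s in a..t, B s (dysonTerm B a n s ψ)‖ ≤
        ∫ s in a..t, M * ((M * (s - a)) ^ n / n.factorial * ‖ψ‖) := by
      refine intervalIntegral.norm_integral_le_of_norm_le ht.1 (ae_of_all _ fun s hs => ?_)
        (Continuous.intervalIntegrable (by fun_prop) _ _)
      have hs' : s ∈ Icc a b := ⟨hs.1.le, hs.2.trans ht.2⟩
      exact (hB.bound s hs' _).trans (mul_le_mul_of_nonneg_left (ih s hs') hB.nonneg)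
    refine h1.trans_eq ?_
    have h2 : ∀ s, M * ((M * (s - a)) ^ n / n.factorial * ‖ψ‖) =
        (M ^ (n + 1) / n.factorial * ‖ψ‖) * (s - a) ^ n := fun s => by
      rw [mul_pow, pow_succ]; ring
    simp_rw [h2]
    rw [intervalIntegral.integral_const_mul,
      intervalIntegral.integral_comp_sub_right (fun s => s ^ n), sub_self, integral_pow,
      Nat.factorial_succ, mul_pow]
    push_cast
    have : (n.factorial : ℝ) ≠ 0 := by positivity
    field_simp
    simp

theorem norm_dysonTerm_le' (n : ℕ) (ψ : E) {t : ℝ} (ht : t ∈ Icc a b) :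
    ‖dysonTerm B a n t ψ‖ ≤ (M * (b - a)) ^ n / n.factorial * ‖ψ‖ := by
  refine (hB.norm_dysonTerm_le n ψ t ht).trans ?_
  have h0 : 0 ≤ M * (t - a) := mul_nonneg hB.nonneg (by linarith [ht.1])
  have h1 : M * (t - a) ≤ M * (b - a) := mul_le_mul_of_nonneg_left (by linarith [ht.2]) hB.nonneg
  gcongr

theorem norm_dysonSum_le {t : ℝ} (ht : t ∈ Icc a b) (ψ : E) :
    ‖dysonSum B a t ψ‖ ≤ (∑' n : ℕ, (M * (b - a)) ^ n / n.factorial) * ‖ψ‖ := by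
  rw [← tsum_mul_right]
  exact tsum_of_norm_bounded (summable_pow_div_factorial_mul _ ‖ψ‖).hasSum fun n => hB.norm_dysonTerm_le' n ψ ht

/-- Additivity of the integral requires integrability, hence `t ∈ [a,b]`; `dysonTerm_smul` holds for
all `t`. -/
theorem dysonTerm_add (n : ℕ) (ψ φ : E) : ∀ t ∈ Icc a b,
    dysonTerm B a n t (ψ + φ) = dysonTerm B a n t ψ + dysonTerm B a n t φ := by
  induction n with
  | zero => exact fun _ _ => rfl
  | succ n ih =>
    intro t ht
    have ha : a ∈ Icc a b := left_mem_Icc.2 (ht.1.trans ht.2)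
    rw [dysonTerm, dysonTerm, dysonTerm, ← neg_add, ← intervalIntegral.integral_add
      (hB.intervalIntegrable (hB.continuousOn_dysonTerm n ψ) ha ht)
      (hB.intervalIntegrable (hB.continuousOn_dysonTerm n φ) ha ht)]
    congr 1
    refine intervalIntegral.integral_congr fun s hs => ?_
    rw [ih s (uIcc_subset_Icc ha ht hs), map_add]

variable [CompleteSpace E]

theorem summable_dysonTerm {t : ℝ} (ht : t ∈ Icc a b) (ψ : E) :
    Summable fun n => dysonTerm B a n t ψ :=
  Summable.of_norm_bounded (summable_pow_div_factorial_mul _ ‖ψ‖) fun n => hB.norm_dysonTerm_le' n ψ ht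

theorem continuousOn_dysonSum (ψ : E) : ContinuousOn (fun t => dysonSum B a t ψ) (Icc a b) :=
  continuousOn_tsum (fun n => hB.continuousOn_dysonTerm n ψ) (summable_pow_div_factorial_mul _ ‖ψ‖)
    fun n _ ht => hB.norm_dysonTerm_le' n ψ ht

/-- The Volterra equation: sum and integral are interchanged by dominated convergence with the
exponential series, and the index shifts by one. -/
theorem dysonSum_eq {t : ℝ} (ht : t ∈ Icc a b) (ψ : E) :
    dysonSum B a t ψ = ψ - ∫ s in a..t, B s (dysonSum B a s ψ) := by
  have ha : a ∈ Icc a b := left_mem_Icc.2 (ht.1.trans ht.2)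
  have h1 : HasSum (fun n => ∫ s in a..t, B s (dysonTerm B a n s ψ))
      (∫ s in a..t, B s (dysonSum B a s ψ)) := by
    refine intervalIntegral.hasSum_integral_of_dominated_convergence
      (fun n _ => M * ((M * (b - a)) ^ n / n.factorial * ‖ψ‖)) (fun n => ?_) (fun n => ?_) ?_ ?_ ?_
    · rw [uIoc_of_le ht.1]
      exact (hB.intervalIntegrable (hB.continuousOn_dysonTerm n ψ) ha ht).1.aestronglyMeasurable
    · refine ae_of_all _ fun s hs => ?_
      rw [uIoc_of_le ht.1] at hs
      have hs' : s ∈ Icc a b := ⟨hs.1.le, hs.2.trans ht.2⟩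
      exact (hB.bound s hs' _).trans
        (mul_le_mul_of_nonneg_left (hB.norm_dysonTerm_le' n ψ hs') hB.nonneg)
    · exact ae_of_all _ fun s _ => (summable_pow_div_factorial_mul _ ‖ψ‖).mul_left M
    · exact intervalIntegrable_const
    · refine ae_of_all _ fun s hs => ?_
      rw [uIoc_of_le ht.1] at hs
      have hs' : s ∈ Icc a b := ⟨hs.1.le, hs.2.trans ht.2⟩
      exact (B s).hasSum (hB.summable_dysonTerm hs' ψ).hasSum
  rw [dysonSum, (hB.summable_dysonTerm ht ψ).tsum_eq_zero_add, sub_eq_add_neg, ← h1.neg.tsum_eq]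
  rfl

theorem exists_clm_dysonSum {t : ℝ} (ht : t ∈ Icc a b) :
    ∃ D : E →L[ℝ] E, ∀ ψ, D ψ = dysonSum B a t ψ :=
  ⟨LinearMap.mkContinuous
    { toFun := dysonSum B a t
      map_add' := fun ψ φ => by
        rw [dysonSum, dysonSum, dysonSum, ← (hB.summable_dysonTerm ht ψ).tsum_add
          (hB.summable_dysonTerm ht φ)]
        exact tsum_congr fun n => hB.dysonTerm_add n ψ φ t ht
      map_smul' := fun c ψ => by
        rw [dysonSum, dysonSum, RingHom.id_apply, ← (hB.summable_dysonTerm ht ψ).tsum_const_smul]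
        exact tsum_congr fun n => dysonTerm_smul B a n c ψ t }
    _ (hB.norm_dysonSum_le ht), fun _ => rfl⟩

end IsBoundedFamily

/-- The primitive of `G` has derivative `h t` at `t` if `h` is continuous and `G - h` is dominated
by a function whose primitive from `t` has derivative zero. -/
theorem hasDerivWithinAt_integral_of_norm_sub_le [CompleteSpace E] {a b t : ℝ} {G h : ℝ → E}
    {q : ℝ → ℝ} (ht : t ∈ Icc a b) (hG : IntegrableOn G (Icc a b)) (hh : ContinuousOn h (Icc a b))
    (hq : IntegrableOn q (Icc a b)) (hle : ∀ s ∈ Icc a b, ‖G s - h s‖ ≤ q s)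
    (ho : (fun τ => ∫ s in t..τ, q s) =o[𝓝[Icc a b] t] fun τ => τ - t) :
    HasDerivWithinAt (fun τ => ∫ s in a..τ, G s) (h t) (Icc a b) t := by
  have ha : a ∈ Icc a b := left_mem_Icc.2 (ht.1.trans ht.2)
  have hhI : IntegrableOn h (Icc a b) := hh.integrableOn_Icc
  have hGh : IntegrableOn (fun s => G s - h s) (Icc a b) := hG.sub hhI
  have : Fact (t ∈ Icc a b) := ⟨ht⟩
  have h1 : HasDerivWithinAt (fun τ => ∫ s in a..τ, h s) (h t) (Icc a b) t :=
    intervalIntegral.integral_hasDerivWithinAt_right (intervalIntegrable_of_integrableOn_Icc hhI ha ht)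
      (hh.stronglyMeasurableAtFilter_nhdsWithin measurableSet_Icc t) (hh t ht)
  -- The primitive of the error `G - h` is dominated by that of `q`; both orientations of the
  -- interval occur, since `τ` may lie on either side of `t`.
  have h2 : HasDerivWithinAt (fun τ => ∫ s in a..τ, (G s - h s)) 0 (Icc a b) t := by
    rw [hasDerivWithinAt_iff_isLittleO]
    refine Asymptotics.IsBigO.trans_isLittleO (Asymptotics.IsBigO.of_bound 1 ?_) ho
    filter_upwards [self_mem_nhdsWithin] with τ hτ
    have e := intervalIntegral.integral_interval_sub_left
      (intervalIntegrable_of_integrableOn_Icc hGh ha hτ)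
      (intervalIntegrable_of_integrableOn_Icc hGh ha ht)
    rw [smul_zero, sub_zero, e, one_mul, Real.norm_eq_abs]
    refine (intervalIntegral.norm_integral_le_abs_integral_norm).trans ?_
    rcases le_total t τ with hle' | hle'
    · rw [abs_of_nonneg (intervalIntegral.integral_nonneg hle' fun _ _ => norm_nonneg _)]
      refine le_trans ?_ (le_abs_self _)
      refine intervalIntegral.integral_mono_on hle' (intervalIntegrable_of_integrableOn_Icc hGh.norm ht hτ)
        (intervalIntegrable_of_integrableOn_Icc hq ht hτ) fun s hs => hle s ⟨ht.1.trans hs.1, hs.2.trans hτ.2⟩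
    · rw [intervalIntegral.integral_symm τ t, intervalIntegral.integral_symm τ t, abs_neg, abs_neg,
        abs_of_nonneg (intervalIntegral.integral_nonneg hle' fun _ _ => norm_nonneg _)]
      refine le_trans ?_ (le_abs_self _)
      refine intervalIntegral.integral_mono_on hle' (intervalIntegrable_of_integrableOn_Icc hGh.norm hτ ht)
        (intervalIntegrable_of_integrableOn_Icc hq hτ ht) fun s hs => hle s ⟨hτ.1.trans hs.1, hs.2.trans ht.2⟩
  have h3 := h1.add h2
  rw [add_zero] at h3
  have e : ∀ τ ∈ Icc a b, ∫ s in a..τ, G s = (∫ s in a..τ, h s) + ∫ s in a..τ, (G s - h s) := by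
    intro τ hτ
    rw [← intervalIntegral.integral_add (intervalIntegrable_of_integrableOn_Icc hhI ha hτ)
      (intervalIntegrable_of_integrableOn_Icc hGh ha hτ)]
    simp
  exact h3.congr e (e t ht)

end dysonSeries

/-! ### Lebesgue points -/

theorem isLittleO_integral_norm_sub_of_continuousWithinAt {E : Type*} [NormedAddCommGroup E]
    {a b t : ℝ} {w : ℝ → E} (ht : t ∈ Icc a b) (hw : ContinuousWithinAt w (Icc a b) t) :
    (fun τ => ∫ s in t..τ, ‖w s - w t‖) =o[𝓝[Icc a b] t] fun τ => τ - t := by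
  rw [Asymptotics.isLittleO_iff]
  intro ε hε
  obtain ⟨δ, hδ, h⟩ := Metric.continuousWithinAt_iff.1 hw ε hε
  filter_upwards [self_mem_nhdsWithin, mem_nhdsWithin_of_mem_nhds (Metric.ball_mem_nhds t hδ)]
    with τ hτ hτ'
  refine intervalIntegral.norm_integral_le_of_norm_le_const fun s hs => ?_
  have hs' := uIoc_subset_uIcc hs
  rw [norm_norm, ← dist_eq_norm]
  refine (h (uIcc_subset_Icc ht hτ hs') (lt_of_le_of_lt ?_ hτ')).le
  rw [Real.dist_eq, Real.dist_eq]
  exact abs_sub_left_of_mem_uIcc hs'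

/-- Lebesgue differentiation for `w` extended by zero. The Vitali family also contains the one-sided
intervals ending at `t`, which are those of the primitive. -/
theorem ae_isLittleO_integral_norm_sub {E : Type*} [NormedAddCommGroup E]
    {a b : ℝ} {w : ℝ → E} (hw : IntegrableOn w (Icc a b)) :
    ∀ᵐ t ∂(volume.restrict (Icc a b)),
      (fun τ => ∫ s in t..τ, ‖w s - w t‖) =o[𝓝[Icc a b] t] fun τ => τ - t := by
  rw [ae_restrict_iff' measurableSet_Icc]
  have hI : Integrable ((Icc a b).indicator w) := hw.integrable_indicator measurableSet_Icc
  filter_upwards [(IsUnifLocDoublingMeasure.vitaliFamily (volume : Measure ℝ)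
    1).ae_tendsto_average_norm_sub hI.locallyIntegrable] with t ht htI
  have hr := ht.comp (Real.tendsto_Icc_vitaliFamily_right t)
  have hl := ht.comp (Real.tendsto_Icc_vitaliFamily_left t)
  rw [Asymptotics.isLittleO_iff]
  intro ε hε
  have hr' := (eventually_nhdsWithin_iff.1 (hr.eventually (gt_mem_nhds hε))).filter_mono
    (nhdsWithin_le_nhds (s := Icc a b))
  have hl' := (eventually_nhdsWithin_iff.1 (hl.eventually (gt_mem_nhds hε))).filter_mono
    (nhdsWithin_le_nhds (s := Icc a b))
  have key : ∀ {u v : ℝ}, u ∈ Icc a b → v ∈ Icc a b → u < v →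
      (⨍ y in Icc u v, ‖(Icc a b).indicator w y - (Icc a b).indicator w t‖) < ε →
      |∫ s in u..v, ‖w s - w t‖| ≤ ε * |v - u| := by
    intro u v hu hv huv h
    have e : (⨍ y in Icc u v, ‖(Icc a b).indicator w y - (Icc a b).indicator w t‖) =
        (v - u)⁻¹ * ∫ s in u..v, ‖w s - w t‖ := by
      rw [setAverage_eq, intervalIntegral.integral_of_le huv.le, integral_Icc_eq_integral_Ioc,
        Real.volume_real_Icc_of_le huv.le, smul_eq_mul]
      congr 1
      refine setIntegral_congr_fun measurableSet_Ioc fun s hs => ?_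
      rw [indicator_of_mem htI, indicator_of_mem (s := Icc a b) ⟨hu.1.trans hs.1.le, hs.2.trans hv.2⟩]
    rw [e, inv_mul_lt_iff₀ (sub_pos.2 huv)] at h
    rw [abs_of_nonneg (intervalIntegral.integral_nonneg huv.le fun _ _ => norm_nonneg _),
      abs_of_pos (sub_pos.2 huv), mul_comm]
    exact h.le
  filter_upwards [hr', hl', self_mem_nhdsWithin] with τ h1 h2 hτ
  rw [Real.norm_eq_abs, Real.norm_eq_abs]
  rcases lt_trichotomy t τ with h | h | h
  · exact key htI hτ h (h1 h)
  · simp [h]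
  · rw [intervalIntegral.integral_symm, abs_neg, abs_sub_comm]
    exact key hτ htI h (h2 h)

/-! ### The perturbation in the interaction picture -/

/-- A uniform bound upgrades strong continuity to joint continuity, by `A_s x - A_{s₀} x₀ = A_s (x -
x₀) + (A_s - A_{s₀}) x₀`. -/
theorem continuousOn_uncurry_clm {X Y Z : Type*} [TopologicalSpace Z] [NormedAddCommGroup X]
    [NormedSpace ℝ X] [NormedAddCommGroup Y] [NormedSpace ℝ Y] {A : Z → X →L[ℝ] Y} {S : Set Z}
    {C : ℝ} (hb : ∀ s ∈ S, ∀ x, ‖A s x‖ ≤ C * ‖x‖) (hc : ∀ x, ContinuousOn (fun s => A s x) S) :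
    ContinuousOn (fun p : Z × X => A p.1 p.2) (S ×ˢ univ) := by
  rintro ⟨s₀, x₀⟩ ⟨hs₀, -⟩
  rw [ContinuousWithinAt, tendsto_iff_norm_sub_tendsto_zero]
  have h1 : Tendsto (fun p : Z × X => ‖A p.1 x₀ - A s₀ x₀‖) (𝓝[S ×ˢ univ] (s₀, x₀)) (𝓝 0) := by
    have h2 : Tendsto (fun p : Z × X => p.1) (𝓝[S ×ˢ univ] (s₀, x₀)) (𝓝[S] s₀) :=
      continuousWithinAt_fst.tendsto_nhdsWithin fun p hp => hp.1
    exact (tendsto_iff_norm_sub_tendsto_zero.1 (hc x₀ s₀ hs₀)).comp h2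
  have h3 : Tendsto (fun p : Z × X => C * ‖p.2 - x₀‖) (𝓝[S ×ˢ univ] (s₀, x₀)) (𝓝 0) := by
    have : Continuous fun p : Z × X => C * ‖p.2 - x₀‖ := by fun_prop
    simpa using (this.tendsto (s₀, x₀)).mono_left nhdsWithin_le_nhds
  refine squeeze_zero' (Eventually.of_forall fun _ => norm_nonneg _) ?_ (by simpa using h3.add h1)
  filter_upwards [self_mem_nhdsWithin] with p hp
  have e : A p.1 p.2 - A s₀ x₀ = A p.1 (p.2 - x₀) + (A p.1 x₀ - A s₀ x₀) := by
    rw [map_sub]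
    abel
  rw [e]
  exact (norm_add_le _ _).trans (add_le_add_left (hb _ hp.1 _) _)

theorem continuousOn_clm_apply {X Y : Type*} [NormedAddCommGroup X]
    [NormedSpace ℝ X] [NormedAddCommGroup Y] [NormedSpace ℝ Y] {A : ℝ → X →L[ℝ] Y} {S : Set ℝ}
    {C : ℝ} (hb : ∀ s ∈ S, ∀ x, ‖A s x‖ ≤ C * ‖x‖) (hc : ∀ x, ContinuousOn (fun s => A s x) S)
    {x : ℝ → X} (hx : ContinuousOn x S) : ContinuousOn (fun s => A s (x s)) S :=
  (continuousOn_uncurry_clm hb hc).comp (continuousOn_id.prodMk hx) fun _ hs => ⟨hs, mem_univ _⟩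

theorem aestronglyMeasurable_clm_apply {X Y : Type*} [NormedAddCommGroup X]
    [NormedSpace ℝ X] [NormedAddCommGroup Y] [NormedSpace ℝ Y] {A : ℝ → X →L[ℝ] Y} {a b : ℝ}
    (hab : a ≤ b) {C : ℝ} (hb : ∀ s ∈ Icc a b, ∀ x, ‖A s x‖ ≤ C * ‖x‖)
    (hc : ∀ x, ContinuousOn (fun s => A s x) (Icc a b)) {x : ℝ → X}
    (hx : AEStronglyMeasurable x (volume.restrict (Icc a b))) :
    AEStronglyMeasurable (fun s => A s (x s)) (volume.restrict (Icc a b)) := by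
  -- Projecting the time onto `[a,b]` makes the joint map continuous everywhere, so that it can be
  -- composed with a measurable curve.
  have h1 : Continuous fun p : ℝ × X => A (projIcc a b hab p.1) p.2 :=
    (continuousOn_uncurry_clm hb hc).comp_continuous
      (f := fun p : ℝ × X => ((projIcc a b hab p.1 : ℝ), p.2))
      ((continuous_subtype_val.comp (continuous_projIcc.comp continuous_fst)).prodMk continuous_snd)
      fun p => ⟨(projIcc a b hab p.1).2, mem_univ _⟩
  refine (h1.comp_aestronglyMeasurable
    ((aestronglyMeasurable_id (α := ℝ)).prodMk hx)).congr ?_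
  filter_upwards [ae_restrict_mem measurableSet_Icc] with s hs
  simp only [id, projIcc_of_mem hab hs]

/-- The perturbation `K_s V(s) K_s⁻¹` in the interaction picture. -/
noncomputable def interaction (R m : ℝ) (Vt : ℝ → E3 → ℂ) (s : ℝ) : L2 →L[ℝ] L2 :=
  KCLM R m s ∘L potCLM (classL1 (Vt s)) ∘L KinvCLM R m s

theorem interaction_apply (R m : ℝ) (Vt : ℝ → E3 → ℂ) (s : ℝ) (ψ : L2) :
    interaction R m Vt s ψ = KCLM R m s (potCLM (classL1 (Vt s)) (KinvCLM R m s ψ)) := rfl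

theorem pot_eq_classL1 {V : E3 → ℝ} {Vt : E3 → ℂ} (h : HasIntegrableFourier V Vt) (F : Data) :
    pot V F = potCLM (classL1 Vt) F := by
  rw [pot_eq h, potCLM_congr (coeFn_classL1 h.1)]

/-! ### The perturbed evolution as `K_t⁻¹ D(t) K_1`. -/

section evolution

variable {R m : ℝ} (hR : 0 < R) (hm : 3 / 2 < m * R) {T : ℝ} (hT : 1 ≤ T)
  {V : ℝ → E3 → ℝ} {Vt : ℝ → E3 → ℂ}
  (hmeas : AEStronglyMeasurable (Function.uncurry Vt) ((volume.restrict (Icc 1 T)).prod volume))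
  (hV : ∀ s ∈ Icc 1 T, HasIntegrableFourier (V s) (Vt s))
  (hbound : ∃ C : ℝ, ∀ s ∈ Icc 1 T, ∫ k, ‖Vt s k‖ ≤ C)

include hV hbound in
theorem exists_norm_potCLM_classL1_le : ∃ C : ℝ, 0 ≤ C ∧ ∀ s ∈ Icc 1 T,
    ‖classL1 (Vt s)‖ ≤ C ∧ ∀ F, ‖potCLM (classL1 (Vt s)) F‖ ≤ C * ‖F‖ := by
  obtain ⟨C, hC⟩ := hbound
  refine ⟨|C|, abs_nonneg C, fun s hs => ?_⟩
  have h1 : ‖classL1 (Vt s)‖ ≤ |C| := by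
    rw [norm_classL1 (hV s hs).1]
    exact (hC s hs).trans (le_abs_self C)
  refine ⟨h1, fun F => (norm_potCLM_le _ F).trans ?_⟩
  rw [← L1.norm_eq_integral_norm]
  gcongr

include hmeas hV hbound in
theorem integrableOn_classL1 : IntegrableOn (fun s => classL1 (Vt s)) (Icc 1 T) := by
  obtain ⟨D, -, hD⟩ := exists_norm_potCLM_classL1_le hV hbound
  refine IntegrableOn.of_bound measure_Icc_lt_top (aestronglyMeasurable_classL1 hmeas) D ?_
  filter_upwards [ae_restrict_mem measurableSet_Icc] with s hs using (hD s hs).1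

include hR hm hT hmeas hV hbound in
-- Along a continuous curve `K_s⁻¹` gives a continuous one, the potential acts on it jointly
-- continuously and measurably in time, and `K_s` preserves measurability.
theorem exists_isBoundedFamily_interaction :
    ∃ M, IsBoundedFamily (interaction R m Vt) 1 T M := by
  obtain ⟨C, hC0, hC⟩ := exists_KCLM_bound hR hm hT
  obtain ⟨D, hD0, hD⟩ := exists_norm_potCLM_classL1_le hV hbound
  refine ⟨C * (D * C), by positivity, fun s hs ψ => ?_, fun x hx => ?_⟩
  · rw [interaction_apply, mul_assoc, mul_assoc]
    refine ((hC s hs).1 _).trans (mul_le_mul_of_nonneg_left ?_ hC0)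
    exact ((hD s hs).2 _).trans (mul_le_mul_of_nonneg_left ((hC s hs).2.1 _) hD0)
  · have h1 : AEStronglyMeasurable (fun s => KinvCLM R m s (x s)) (volume.restrict (Icc 1 T)) :=
      (continuousOn_clm_apply (fun s hs => (hC s hs).2.1)
        (fun ψ => continuousOn_KinvCLM hR hm hT ψ) hx).aestronglyMeasurable measurableSet_Icc
    have h0 : AEStronglyMeasurable (fun s => classL1 (Vt s)) (volume.restrict (Icc 1 T)) :=
      aestronglyMeasurable_classL1 hmeas
    have h3 := h0.prodMk h1
    have h2 := continuous_potCLM.comp_aestronglyMeasurable h3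
    dsimp only at h2
    exact aestronglyMeasurable_clm_apply (A := KCLM R m) hT (fun s hs => (hC s hs).1)
      (fun F => continuousOn_KCLM hR hm hT F) h2

include hR hm hV in
-- All factors `K_1⁻¹ K_1` cancel. The dependence on `t` is left in the fixed operator `K_1 K_t⁻¹`,
-- which can be pulled out of the Dyson integrals.
theorem U0hat_potHat {s t : ℝ} (hs : s ∈ Icc 1 T) (ht : 1 ≤ t) (φ : L2) :
    U0hat R m t s (potHat R m (V s) (KCLM R m 1 (KinvCLM R m s φ))) =
      KCLM R m 1 (KinvCLM R m t (interaction R m Vt s φ)) := by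
  rw [U0hat, U0, potHat, Kinv_eq hR hm le_rfl, Kinv_eq hR hm le_rfl, K_eq hR hm le_rfl,
    K_eq hR hm le_rfl, K_eq hR hm hs.1, Kinv_eq hR hm ht, KinvCLM_KCLM hR hm le_rfl,
    KinvCLM_KCLM hR hm le_rfl, pot_eq_classL1 (hV s hs), interaction_apply]

section series

variable {M : ℝ} (hB : IsBoundedFamily (interaction R m Vt) 1 T M)

include hR hm hV hB in
theorem dyson_eq (n : ℕ) (ψ : L2) : ∀ t ∈ Icc 1 T, dyson R m V n t ψ =
    KCLM R m 1 (KinvCLM R m t (dysonTerm (interaction R m Vt) 1 n t ψ)) := by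
  induction n with
  | zero =>
    intro t ht
    rw [dyson, dysonTerm, U0hat, U0, Kinv_eq hR hm le_rfl, K_eq hR hm le_rfl, K_eq hR hm le_rfl,
      Kinv_eq hR hm ht.1, KCLM_KinvCLM hR hm le_rfl]
  | succ n ih =>
    intro t ht
    have h1 : (1 : ℝ) ∈ Icc 1 T := left_mem_Icc.2 (ht.1.trans ht.2)
    have hI := hB.intervalIntegrable (hB.continuousOn_dysonTerm n ψ) h1 ht
    rw [dyson, dysonTerm, map_neg, map_neg, ← ContinuousLinearMap.comp_apply (KCLM R m 1),
      ← (KCLM R m 1 ∘L KinvCLM R m t).intervalIntegral_comp_comm hI]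
    congr 1
    refine intervalIntegral.integral_congr fun s hs => ?_
    have hs' := uIcc_subset_Icc h1 ht hs
    rw [ih s hs', ContinuousLinearMap.comp_apply, U0hat_potHat hR hm hV hs' ht.1]

include hR hm hV hB in
theorem intervalIntegrable_dyson {t : ℝ} (ht : t ∈ Icc 1 T) (ψ : L2) (n : ℕ) :
    IntervalIntegrable (fun s => U0hat R m t s (potHat R m (V s) (dyson R m V n s ψ)))
      volume 1 t := by
  have h1 : (1 : ℝ) ∈ Icc 1 T := left_mem_Icc.2 (ht.1.trans ht.2)
  have hI := hB.intervalIntegrable (hB.continuousOn_dysonTerm n ψ) h1 ht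
  set S := KCLM R m 1 ∘L KinvCLM R m t with hS
  have hSI : IntervalIntegrable (fun s => S (interaction R m Vt s
      (dysonTerm (interaction R m Vt) 1 n s ψ))) volume 1 t :=
    ⟨S.integrable_comp hI.1, S.integrable_comp hI.2⟩
  refine hSI.congr fun s hs => ?_
  have hs' := uIcc_subset_Icc h1 ht (uIoc_subset_uIcc hs)
  rw [hS, ContinuousLinearMap.comp_apply, dyson_eq hR hm hV hB n ψ s hs', U0hat_potHat hR hm hV hs' ht.1]

include hR hm hV hB in
theorem hasSum_dyson {t : ℝ} (ht : t ∈ Icc 1 T) (ψ : L2) :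
    HasSum (fun n => dyson R m V n t ψ)
      (KCLM R m 1 (KinvCLM R m t (dysonSum (interaction R m Vt) 1 t ψ))) := by
  have h := (KCLM R m 1).hasSum ((KinvCLM R m t).hasSum (hB.summable_dysonTerm ht ψ).hasSum)
  exact h.congr_fun fun n => dyson_eq hR hm hV hB n ψ t ht

include hR hm hV hB in
theorem UV_eq {t : ℝ} (ht : t ∈ Icc 1 T) (F : Data) : UV R m V t F =
    KinvCLM R m t (dysonSum (interaction R m Vt) 1 t (KCLM R m 1 F)) := by
  rw [UV, UVhat, K_eq hR hm le_rfl, (hasSum_dyson hR hm hV hB ht _).tsum_eq,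
    Kinv_eq hR hm le_rfl, KinvCLM_KCLM hR hm le_rfl]

include hR hm hV hB in
theorem exists_clm_UV {t : ℝ} (ht : t ∈ Icc 1 T) :
    ∃ U : Data →L[ℝ] Data, ∀ F, U F = UV R m V t F := by
  obtain ⟨D, hD⟩ := hB.exists_clm_dysonSum ht
  refine ⟨KinvCLM R m t ∘L D ∘L KCLM R m 1, fun F => ?_⟩
  rw [UV_eq hR hm hV hB ht, ← hD]
  rfl

include hR hm hV hB hT in
theorem UV_one (F : Data) : UV R m V 1 F = F := by
  have h1 : (1 : ℝ) ∈ Icc 1 T := left_mem_Icc.2 hT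
  rw [UV_eq hR hm hV hB h1, hB.dysonSum_eq h1, intervalIntegral.integral_same, sub_zero,
    KinvCLM_KCLM hR hm le_rfl]

include hR hm hV hB hT in
theorem continuousOn_UV (F : Data) : ContinuousOn (fun t => UV R m V t F) (Icc 1 T) := by
  obtain ⟨C, -, hC⟩ := exists_KCLM_bound hR hm hT
  exact (continuousOn_clm_apply (fun s hs => (hC s hs).2.1)
    (fun ψ => continuousOn_KinvCLM hR hm hT ψ) (hB.continuousOn_dysonSum (KCLM R m 1 F))).congr
    fun t ht => UV_eq hR hm hV hB ht F

include hB in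
theorem exists_lipschitz_dysonSum (ψ : L2) : ∃ L : ℝ, 0 ≤ L ∧ ∀ t ∈ Icc 1 T, ∀ s ∈ Icc 1 T,
    ‖dysonSum (interaction R m Vt) 1 t ψ - dysonSum (interaction R m Vt) 1 s ψ‖ ≤
      L * ‖t - s‖ := by
  obtain ⟨L, hL0, hL⟩ := hB.exists_lipschitz_integral (hB.continuousOn_dysonSum ψ)
  refine ⟨L, hL0, fun t ht s hs => ?_⟩
  rw [hB.dysonSum_eq ht, hB.dysonSum_eq hs, sub_sub_sub_cancel_left, norm_sub_rev]
  rw [norm_sub_rev]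
  refine (hL t ht s hs).trans_eq ?_
  rw [abs_sub_comm, Real.norm_eq_abs]

include hR hm hV hB hT in
theorem exists_lipschitzOnWith_embed_UV (F : Data) :
    ∃ L, LipschitzOnWith L (fun t => embed (UV R m V t F)) (Icc 1 T) := by
  obtain ⟨C, hC0, hC⟩ := exists_KCLM_bound hR hm hT
  obtain ⟨L, hL0, hL⟩ := exists_lipschitz_embed_KinvCLM hR hm hT
  set d := fun t => dysonSum (interaction R m Vt) 1 t (KCLM R m 1 F) with hd
  obtain ⟨L', hL0', hL'⟩ := exists_lipschitz_dysonSum hB (KCLM R m 1 F)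
  obtain ⟨D, hD⟩ := isCompact_Icc.exists_bound_of_continuousOn
    (hB.continuousOn_dysonSum (KCLM R m 1 F))
  have h0 : 0 ≤ ‖embedCLM‖ * (C * L') + L * |D| := by positivity
  refine ⟨⟨_, h0⟩, LipschitzOnWith.of_dist_le_mul fun t ht s hs => ?_⟩
  rw [dist_eq_norm, dist_eq_norm, UV_eq hR hm hV hB ht, UV_eq hR hm hV hB hs]
  change ‖embed (KinvCLM R m t (d t)) - embed (KinvCLM R m s (d s))‖ ≤
    (‖embedCLM‖ * (C * L') + L * |D|) * ‖t - s‖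
  -- The increment splits into the change of `d`, estimated in the strong norm, and the change of
  -- `K_t⁻¹` on a fixed vector, estimated in the weak one.
  have e : embed (KinvCLM R m t (d t)) - embed (KinvCLM R m s (d s)) =
      embedCLM (KinvCLM R m t (d t - d s)) +
        (embed (KinvCLM R m t (d s)) - embed (KinvCLM R m s (d s))) := by
    rw [map_sub, map_sub, embedCLM_apply, embedCLM_apply]
    abel
  rw [e, add_mul]
  refine (norm_add_le _ _).trans (add_le_add ?_ ?_)
  · rw [mul_assoc, mul_assoc]
    refine (embedCLM.le_opNorm _).trans (mul_le_mul_of_nonneg_left ?_ (norm_nonneg _))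
    exact ((hC t ht).2.1 _).trans (mul_le_mul_of_nonneg_left (hL' t ht s hs) hC0)
  · refine (hL t ht s hs _).trans ?_
    have := (hD s hs).trans (le_abs_self D)
    gcongr

include hR hm hV hB hT hmeas hbound in
/-- The evolution equation holds at the Lebesgue points of the potential. -/
theorem solvesAt_of_isLittleO {t : ℝ} (ht : t ∈ Icc 1 T)
    (ho : (fun τ => ∫ s in t..τ, ‖classL1 (Vt s) - classL1 (Vt t)‖) =o[𝓝[Icc 1 T] t]
      fun τ => τ - t) : SolvesAt R m V T t := by
  intro F
  obtain ⟨C, hC0, hC⟩ := exists_KCLM_bound hR hm hT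
  set d := fun t => dysonSum (interaction R m Vt) 1 t (KCLM R m 1 F) with hd
  have hdc : ContinuousOn d (Icc 1 T) := hB.continuousOn_dysonSum (KCLM R m 1 F)
  set x := fun s => KinvCLM R m s (d s) with hx
  have hxc : ContinuousOn x (Icc 1 T) := continuousOn_clm_apply (fun s hs => (hC s hs).2.1)
    (fun ψ => continuousOn_KinvCLM hR hm hT ψ) hdc
  obtain ⟨X, hX⟩ := isCompact_Icc.exists_bound_of_continuousOn hxc
  -- The potential is frozen at time `t`: this comparison curve is continuous in `s`, while the true
  -- integrand is only known to be measurable.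
  have hhc : ContinuousOn (fun s => KCLM R m s (potCLM (classL1 (Vt t)) (x s))) (Icc 1 T) :=
    continuousOn_clm_apply (fun s hs => (hC s hs).1) (fun F => continuousOn_KCLM hR hm hT F)
      ((potCLM (classL1 (Vt t))).continuous.comp_continuousOn hxc)
  -- The error of freezing the potential is at most the `L¹` distance of the transforms, up to the
  -- bounds of `K_s` and `x`.
  have hq : IntegrableOn (fun s => (C * |X|) * ‖classL1 (Vt s) - classL1 (Vt t)‖) (Icc 1 T) := by
    refine Integrable.const_mul ?_ _
    exact ((integrableOn_classL1 hmeas hV hbound).sub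
      (integrableOn_const measure_Icc_lt_top.ne)).norm
  have hdd : HasDerivWithinAt d (-KCLM R m t (potCLM (classL1 (Vt t)) (x t))) (Icc 1 T) t := by
    have h1 := hasDerivWithinAt_integral_of_norm_sub_le
      (G := fun s => interaction R m Vt s (d s)) ht (hB.integrableOn hdc) hhc hq (fun s hs => ?_) ?_
    · have h2 := h1.const_sub (KCLM R m 1 F)
      exact h2.congr (fun τ hτ => hB.dysonSum_eq hτ _) (hB.dysonSum_eq ht _)
    · rw [interaction_apply, ← map_sub, mul_assoc]
      refine ((hC s hs).1 _).trans (mul_le_mul_of_nonneg_left ?_ hC0)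
      refine (norm_potCLM_sub_le (L1.integrable_coeFn _) (L1.integrable_coeFn _) _).trans ?_
      rw [integral_norm_L1_sub, mul_comm]
      have := (hX s hs).trans (le_abs_self X)
      exact mul_le_mul_of_nonneg_right this (norm_nonneg _)
    · simp_rw [intervalIntegral.integral_const_mul]
      exact ho.const_mul_left _
  -- the product rule
  have hprod : HasDerivWithinAt (fun τ => embed (KinvCLM R m τ (d τ)))
      (-H0 R m t (x t) + embedCLM (KinvCLM R m t
        (-KCLM R m t (potCLM (classL1 (Vt t)) (x t))))) (Icc 1 T) t := by
    -- With `d τ = d t + (d τ - d t)`, only `K_τ⁻¹` varies in the first summand.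
    have h1 := hasDerivWithinAt_embed_KinvCLM hR hm hT ht (d t)
    have h2 : HasDerivWithinAt (fun τ => embedCLM (KinvCLM R m τ (d τ - d t)))
        (embedCLM (KinvCLM R m t (-KCLM R m t (potCLM (classL1 (Vt t)) (x t))))) (Icc 1 T) t := by
      rw [hasDerivWithinAt_iff_tendsto_slope] at hdd ⊢
      -- The slope of the second summand is `K_τ⁻¹` applied to the slope of `d`, as `d τ - d t`
      -- vanishes at `τ = t`. Joint continuity gives its limit, so no norm continuity of `K_τ⁻¹` is
      -- needed.
      have hjoint := continuousOn_uncurry_clm (fun s hs => (hC s hs).2.1)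
        (fun ψ => continuousOn_KinvCLM hR hm hT ψ)
        (t, -KCLM R m t (potCLM (classL1 (Vt t)) (x t))) ⟨ht, mem_univ _⟩
      have h3 : Tendsto (fun τ => (τ, slope d t τ)) (𝓝[Icc 1 T \ {t}] t)
          (𝓝[Icc 1 T ×ˢ univ] (t, -KCLM R m t (potCLM (classL1 (Vt t)) (x t)))) := by
        refine tendsto_nhdsWithin_iff.2 ⟨(tendsto_id.mono_left nhdsWithin_le_nhds).prodMk_nhds hdd,
          ?_⟩
        filter_upwards [self_mem_nhdsWithin] with τ hτ using ⟨hτ.1, mem_univ _⟩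
      refine ((embedCLM.continuous.tendsto _).comp (hjoint.tendsto.comp h3)).congr fun τ => ?_
      simp only [Function.comp_apply, slope, vsub_eq_sub, map_smul, sub_self, map_zero, sub_zero]
    refine (h1.add h2).congr (fun τ _ => ?_) ?_
    · simp only [Pi.add_apply, map_sub, embedCLM_apply, add_sub_cancel]
    · simp only [Pi.add_apply, map_sub, embedCLM_apply, add_sub_cancel]
  have hfin := hprod.congr (f₁ := fun τ => embed (UV R m V τ F))
    (fun τ hτ => by rw [UV_eq hR hm hV hB hτ]) (by rw [UV_eq hR hm hV hB ht])
  -- `K_t⁻¹ K_t` cancels and leaves the potential acting on `U_V(t,1) F`.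
  rw [map_neg, map_neg, KinvCLM_KCLM hR hm ht.1, ← neg_add, embedCLM_apply] at hfin
  rw [UV_eq hR hm hV hB ht, pot_eq_classL1 (hV t ht)]
  exact hfin

end series

end evolution

end DeSitter

theorem corollary1 (R m : ℝ) (hR : 0 < R) (hm : 3 / 2 < m * R)
    (T : ℝ) (hT : 1 ≤ T) (V : ℝ → E3 → ℝ) (Vt : ℝ → E3 → ℂ)
    (hmeas : AEStronglyMeasurable (Function.uncurry Vt)
      ((volume.restrict (Icc 1 T)).prod volume))
    (hV : ∀ s ∈ Icc 1 T, HasIntegrableFourier (V s) (Vt s))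
    (hbound : ∃ C : ℝ, ∀ s ∈ Icc 1 T, ∫ k, ‖Vt s k‖ ≤ C) :
    -- the maps `K_t` and the multiplication by the potential are well defined
    (∀ t : ℝ, 1 ≤ t → (∀ F : Data, MemLp (coeff R m t F) 2 volume) ∧
      ∃ e : Data ≃L[ℝ] L2, ∀ F, e F = K R m t F) ∧
    (∀ s ∈ Icc 1 T, ∀ f : Sob (1 / 2), IsProduct (V s) f (potMul (V s) f)) ∧
    -- the integrals and the sum in the Dyson series exist
    (∀ t ∈ Icc 1 T, ∀ ψ : L2, (∀ n : ℕ, IntervalIntegrable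
        (fun s => U0hat R m t s (potHat R m (V s) (dyson R m V n s ψ))) volume 1 t) ∧
      Summable (fun n : ℕ => dyson R m V n t ψ)) ∧
    -- `U_V(t,1)` is a bounded operator on `H^{1/2} × H^{-1/2}`
    (∀ t ∈ Icc 1 T, ∃ U : Data →L[ℝ] Data, ∀ F, U F = UV R m V t F) ∧
    -- the initial condition
    (∀ F : Data, UV R m V 1 F = F) ∧
    -- the regularity of the solution in time
    (∀ F : Data, ContinuousOn (fun t => UV R m V t F) (Icc 1 T)) ∧
    (∀ F : Data, ∃ L, LipschitzOnWith L (fun t => embed (UV R m V t F)) (Icc 1 T)) ∧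
    -- the evolution equation, at almost every time and at every time where the
    -- potential is continuous
    (∀ᵐ t ∂(volume.restrict (Icc 1 T)), SolvesAt R m V T t) ∧
    (∀ t ∈ Icc 1 T, Tendsto (fun s => ∫ k, ‖Vt s k - Vt t k‖) (𝓝[Icc 1 T] t) (𝓝 0) →
      SolvesAt R m V T t) := by
  obtain ⟨M, hB⟩ := exists_isBoundedFamily_interaction hR hm hT hmeas hV hbound
  refine ⟨fun t ht => ⟨memLp_coeff hR hm ht, exists_equiv_K hR hm ht⟩, fun s hs f => ?_,
    fun t ht ψ => ⟨intervalIntegrable_dyson hR hm hV hB ht ψ,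
      (hasSum_dyson hR hm hV hB ht ψ).summable⟩,
    fun t ht => exists_clm_UV hR hm hV hB ht, UV_one hR hm hT hV hB,
    continuousOn_UV hR hm hT hV hB, exists_lipschitzOnWith_embed_UV hR hm hT hV hB, ?_,
    fun t ht hVt => ?_⟩
  · rw [potMul_eq (hV s hs)]
    exact isProduct_potOp (hV s hs) f
  · filter_upwards [ae_restrict_mem measurableSet_Icc, ae_isLittleO_integral_norm_sub
      (integrableOn_classL1 hmeas hV hbound)] with t ht ho
    exact solvesAt_of_isLittleO hR hm hT hmeas hV hbound hB ht ho
  -- A point of continuity in `L¹` is a Lebesgue point.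
  · refine solvesAt_of_isLittleO hR hm hT hmeas hV hbound hB ht
      (isLittleO_integral_norm_sub_of_continuousWithinAt ht ?_)
    rw [ContinuousWithinAt, tendsto_iff_norm_sub_tendsto_zero]
    refine hVt.congr' ?_
    filter_upwards [self_mem_nhdsWithin] with s hs
    rw [norm_classL1_sub (hV s hs).1 (hV t ht).1]
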